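/- **Model.** There are $n\ge 3$ nodes and one server. Node $i$ observes a data item $d_i$ from a totally ordered set $\mathcal D$; the items are pairwise distinct initially and whenever a query is posed. The rank of $d_i$ is $|\{j : d_j\le d_i\}|$. Communication is synchronous: in a round the server may send a broadcast (received by all nodes) and single messages to nodes, and then each node may send a message to the server, depending on its own memory, its own current item, its private coins and what it has received. Every message, a broadcast included, costs $1$; a message consists of at most one data item and $O(\log n)$ further bits. An operation UPDATE$(i,d)$ replaces the item of node $i$ by $d$; only node $i$ notices it, and it may then send one message. Each of the other operations (INITIALIZE, REFRESH, answering a query) takes at most polylogarithmically many (in $n$) rounds. INITIALIZE is executed once on the initial items; afterwards an arbitrary sequence of UPDATEs and queries, fixed independently of the coins, takes place. When a query is posed, REFRESH is executed and then the query is answered. ROUGH-RANK$(k)$ returns an item read off the server's memory, without communication. The queries, which may be of mixed type and with varying parameters that are not known beforehand, are: * Top-$k$ ($1\le k\le n$): output the set of the $k$ smallest current items; * approximate $k$-Select ($1\le k\le n$, $0<\varepsilon<1$, $0<\delta<1$): output a current item whose rank lies in $[(1-\varepsilon)k,(1+\varepsilon)k]$, with probability at least $1-\delta$. **Theorem.**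 There are absolute constants $C,c,c'>0$ such that for every $\mathcal D$ and every $n\ge 3$ there is a randomized protocol in this model, with at most $n^C$ different control words, and at most $C\log^C n$ rounds per operation, for which INITIALIZE uses at most $C\log n$ messages in expectation and for which, at every query of every such sequence, the following holds, where $m$ is the number of UPDATEs since the previous query (since INITIALIZE, for the first query), with the convention $\log 0=0$. 1. After the REFRESH of this query, for each $k'\in\{1,\dots,n\}$, ROUGH-RANK$(k')$ returns a current item of rank in $[k',k'\log^{c}n]$ with probability at least $1-\log^{-c'}n$. 2. If the query is Top-$k$, then the output is correct with probability $1$, and the expected number of all messages sent since the previous query was answered (for UPDATEs, for REFRESH and for answering the query) is at most $$k+C\,(\log m+\log\log n).$$ 3. If the query is approximate $k$-Select with parameters $\varepsilon,\delta$, then the output is correct with probability at least $1-\delta$, and the expected number of all messages sent since the previous query was answered is at most $$C\Bigl(\tfrac1{\varepsilon^2}\log\tfrac1\delta+\log m+(\log\log n)^2\Bigr).$$ -/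

import Mathlib

universe u

noncomputable section

namespace Monitoring

/-! ### Ranks and the two query problems -/

/-- The rank of `x` among the items currently observed by the `n` nodes. -/
def rank {α : Type u} [LinearOrder α] {n : ℕ} (d : Fin n → α) (x : α) : ℕ :=
  (Finset.univ.filter fun j => d j ≤ x).card

/-- The `k` smallest items currently observed. -/
def topKSet {α : Type u} [LinearOrder α] {n : ℕ} (d : Fin n → α) (k : ℕ) : Finset α :=
  (Finset.univ.filter fun j => rank d (d j) ≤ k).image d

/-- `o` is an item that is currently observed, and its rank is between `a` and `b`. -/
def HasRankIn {α : Type u} [LinearOrder α] {n : ℕ} (d : Fin n → α) (o : Option α) (a b : ℝ) :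
    Prop :=
  ∃ j, o = some (d j) ∧ a ≤ (rank d (d j) : ℝ) ∧ (rank d (d j) : ℝ) ≤ b

/-- The two kinds of requests that are posed to the server. -/
inductive Query : Type
  | topK (k : ℕ)
  | select (k : ℕ) (ε δ : ℝ)

/-- Legal parameters of a request. -/
def Query.Valid (n : ℕ) : Query → Prop
  | .topK k => 1 ≤ k ∧ k ≤ n
  | .select k ε δ => 1 ≤ k ∧ k ≤ n ∧ 0 < ε ∧ ε < 1 ∧ 0 < δ ∧ δ < 1

/-- The operations that the server is told to carry out. -/
inductive Op : Type
  | setUp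
  | refresh
  | answer (q : Query)

/-! ### Protocols -/

/-- A message: a control word out of `W` many, and at most one data item. -/
abbrev Msg (α : Type u) (W : ℕ) : Type u := Fin W × Option α

/-- What the server sends in one round: possibly a broadcast, received by all nodes,
and possibly single messages to individual nodes. -/
structure Downlink (α : Type u) (W n : ℕ) : Type u where
  broadcast : Option (Msg α W)
  single : Fin n → Option (Msg α W)

/-- The number of single messages in a family of optional messages. -/
def countMsgs {β : Type u} {n : ℕ} (r : Fin n → Option β) : ℕ :=
  (Finset.univ.filter fun i => (r i).isSome = true).card

/-- The cost of what the server sends: one per broadcast and one per single message. -/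
def Downlink.cost {α : Type u} {W n : ℕ} (s : Downlink α W n) : ℕ :=
  (if s.broadcast.isSome = true then 1 else 0) + countMsgs s.single

/-- A randomized synchronous protocol for one server and `n` nodes. A node sees only its own
memory, its own current item and the messages it receives; the server sees only its own memory,
the requests and the messages it receives. Server and nodes toss private coins. -/
structure Protocol (α : Type u) (n : ℕ) : Type (u + 1) where
  /-- number of different control words -/
  W : ℕ
  /-- number of communication rounds reserved for one operation -/
  R : ℕ
  /-- memory states of the server -/
  Srv : Type u
  /-- memory states of a node -/
  Mem : Type u
  srv₀ : Srv
  mem₀ : Fin n → Mem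
  /-- the server is told to start an operation -/
  accept : Srv → Op → Srv
  /-- first half of a round: the server sends -/
  send : Srv → PMF (Srv × Downlink α W n)
  /-- second half of a round: node `i`, with its memory and current item, gets the broadcast
  and its single message (if any) and possibly sends a message to the server -/
  node : Fin n → Mem → α → Option (Msg α W) → Option (Msg α W) → PMF (Mem × Option (Msg α W))
  /-- the server reads the messages of the nodes -/
  recv : Srv → (Fin n → Option (Msg α W)) → Srv
  /-- UPDATE: node `i` replaces its old item by a new one and possibly sends a message -/
  upd : Fin n → Mem → α → α → PMF (Mem × Option (Msg α W))
  /-- the server's output for the last Top-`k` request -/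
  outTopK : Srv → Option (Finset α)
  /-- the server's output for the last approximate `k`-Select request -/
  outSelect : Srv → Option α
  /-- ROUGH-RANK: read off the server's memory, without communication -/
  roughRank : Srv → ℕ → Option α

/-- Joint law of independent draws from `p 0, …, p (n - 1)`. -/
def independent {β : Type u} : (n : ℕ) → (Fin n → PMF β) → PMF (Fin n → β)
  | 0, _ => PMF.pure Fin.elim0
  | n + 1, p => (p 0).bind fun x =>
      (independent n fun i => p i.succ).bind fun xs => PMF.pure (Fin.cons x xs)

/-- Expected value of a natural number valued cost. -/
def expect {β : Type u} (p : PMF β) (f : β → ℕ) : ENNReal := ∑' b, p b * (f b : ENNReal)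

/-- Probability of an event. -/
def prob {β : Type u} (p : PMF β) (A : β → Prop) : ENNReal := p.toOuterMeasure {b | A b}

namespace Protocol

variable {α : Type u} {n : ℕ}

/-- Global state of the system, with a counter for the messages sent. -/
structure Config (P : Protocol α n) : Type u where
  server : P.Srv
  mem : Fin n → P.Mem
  item : Fin n → α
  msgs : ℕ

variable (P : Protocol α n)

/-- One communication round. -/
def round (s : P.Config) : PMF P.Config :=
  (P.send s.server).bind fun a =>
    (independent n fun i =>
      P.node i (s.mem i) (s.item i) a.2.broadcast (a.2.single i)).bind fun r =>
      PMF.pure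
        { server := P.recv a.1 fun i => (r i).2
          mem := fun i => (r i).1
          item := s.item
          msgs := s.msgs + a.2.cost + countMsgs fun i => (r i).2 }

/-- `t` communication rounds. -/
def rounds : ℕ → P.Config → PMF P.Config
  | 0, s => PMF.pure s
  | t + 1, s => (P.round s).bind (rounds t)

/-- The server starts an operation, and the rounds reserved for it take place. -/
def runOp (o : Op) (s : P.Config) : PMF P.Config :=
  P.rounds P.R { s with server := P.accept s.server o }

/-- UPDATE`(i, x)`. Only node `i` notices it, unless that node sends a message. -/
def update (s : P.Config) (w : Fin n × α) : PMF P.Config :=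
  (P.upd w.1 (s.mem w.1) (s.item w.1) w.2).bind fun r =>
    PMF.pure
      { server := match r.2 with
          | none => s.server
          | some a => P.recv s.server (Function.update (fun _ => none) w.1 (some a))
        mem := Function.update s.mem w.1 r.1
        item := Function.update s.item w.1 w.2
        msgs := s.msgs + if r.2.isSome = true then 1 else 0 }

/-- A list of UPDATEs, in this order. -/
def updates : List (Fin n × α) → P.Config → PMF P.Config
  | [], s => PMF.pure s
  | w :: ws, s => (P.update s w).bind (updates ws)

/-- The state after INITIALIZE, the nodes having observed the items `d`. -/
def start (d : Fin n → α) : PMF P.Config :=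
  P.runOp .setUp { server := P.srv₀, mem := P.mem₀, item := d, msgs := 0 }

end Protocol

/-- The UPDATEs between two consecutive requests, and the request that follows them. -/
structure Epoch (α : Type u) (n : ℕ) : Type u where
  ups : List (Fin n × α)
  query : Query

/-- The items observed after a list of UPDATEs. -/
def itemsAfter {α : Type u} {n : ℕ} (d : Fin n → α) (ws : List (Fin n × α)) : Fin n → α :=
  ws.foldl (fun d w => Function.update d w.1 w.2) d

/-- The items are pairwise distinct initially and whenever a request is posed, and all requests
have legal parameters. -/
def Admissible {α : Type u} {n : ℕ} : (Fin n → α) → List (Epoch α n) → Prop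
  | d, [] => Function.Injective d
  | d, e :: es =>
      Function.Injective d ∧ e.query.Valid n ∧ Admissible (itemsAfter d e.ups) es

namespace Protocol

variable {α : Type u} {n : ℕ} (P : Protocol α n)

/-- Reset the message counter, process the UPDATEs of the epoch, then call REFRESH. -/
def untilRefresh (e : Epoch α n) (s : P.Config) : PMF P.Config :=
  (P.updates e.ups { s with msgs := 0 }).bind (P.runOp .refresh)

/-- A whole epoch: UPDATEs, REFRESH, and then the request is answered. The counter of the
resulting state is the number of all messages since the previous request was answered. -/
def epoch (e : Epoch α n) (s : P.Config) : PMF P.Config :=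
  (P.untilRefresh e s).bind (P.runOp (.answer e.query))

/-- The state after INITIALIZE and a sequence of epochs. -/
def run (d : Fin n → α) (es : List (Epoch α n)) : PMF P.Config :=
  es.foldl (fun p e => p.bind (P.epoch e)) (P.start d)

end Protocol

end Monitoring

end

universe v

noncomputable section

namespace Monitoring

open Finset

/-! ### Expectations with respect to a `PMF` -/

/-! The server keeps a sketch. During INITIALIZE every node draws, once and for all, a geometric
height in each of `B + 1` copies. In a copy the server stores, for every level `l`, the least item
among the nodes of height at least `l`; the last copy uses the opposite order and so supplies the
maximum. UPDATEs and queries are fixed independently of the coins. Hence the heights stay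
independent of the items, and after a REFRESH sketch and flags are functions of heights and current
items (`Suitable.run_eq`). Every estimate about the sketch is then an estimate about independent
geometric variables.

UPDATEs are silent. REFRESH finds the largest height of a changed node by counting down in silent
rounds and repairs only the levels below. The minimum of a level is announced, and only nodes of the
next smaller height with smaller items reply. The expected number of messages at level `h` is at
most a constant, and at most a constant times `M * 2 ^ (-h)` when `M` nodes changed; the sum is
logarithmic in `M` (`mean_copy_le`).

Both kinds of queries are answered by a search for the `t` smallest items of a population. The
server holds a stack of thresholds. In a test of the top one, members up to it reply with
probabilities `2 ^ (-E)`, ..., `1 / 2`, `1`. If the replies suggest that there are enough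
candidates, the test is aborted and the least reply becomes a new threshold; otherwise all
candidates have replied in the end and the threshold is popped. The search never errs
(`Fitting.support_rounds`); only its cost is random. Replies of members that belong to the output
are charged to the output. What remains is controlled by the potential `start`: `bigA` times the
harmonic numbers of the silent output members and of the superfluous members below the lowest
threshold that is too high, a constant per low threshold, minus a discount for a low threshold that
is likely to be passed. The core is `mid_le_start`: a test does not increase the potential. Either
the threshold is likely to be passed (`mid_le_of_likely`), or with constant probability a uniformly
random candidate is the only one to reply. As a pivot it either cuts the superfluous set by half
often enough, or becomes a threshold with a discount often enough (`sum_gain_of_low`,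
`sum_gain_of_not_low`, `mid_le_base_of_gain`).

For a worst-case bound on the rounds the search is restarted when a phase has used up its rounds,
and after the last phase everybody replies. Every round is charged `tau`, so that an exhausted phase
has paid for a restart with a larger weight (`Fitting.future_tick`, `Fitting.step`).

For Top-`k` the logarithmic overhead of a search would be too much. An item of rank `r`, however, is
missing in the sketch with probability at most `8 * r / (8 * r + B)`, so the sketch saves about `B /
8 * log k` replies, and `B` is chosen such that this cancels the term `4 * bigA * log k` of the
search (`sum_hidden_le`, `Suitable.topK_le`). The term `log log n` survives because the first
threshold, taken from the sketch, has a rank of about `k * log ^ 2 n`.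

Approximate selection searches in a random sample of the nodes. Two Chernoff bounds give the error
(`mean_sample_bad_le`). For `δ > 1 / 2` the server reacts only with probability `2 * (1 - δ)` and
then aims at error `1 / 2`, which makes the cost proportional to `log (1 / δ)` also near `δ = 1`.
ROUGH-RANK reads the sketch at the level used for the first threshold
(`Suitable.roughRank_correct`). -/

/-- Expected value of an extended nonnegative function. -/
def mean {β : Type*} (p : PMF β) (f : β → ENNReal) : ENNReal := ∑' b, p b * f b

section mean

variable {β γ : Type*}

@[simp] theorem mean_pure (a : β) (f : β → ENNReal) : mean (PMF.pure a) f = f a := by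
  classical
  unfold mean
  rw [tsum_eq_single a]
  · simp
  · intro b hb; simp [hb]

theorem mean_bind (p : PMF β) (q : β → PMF γ) (f : γ → ENNReal) :
    mean (p.bind q) f = mean p fun b => mean (q b) f := by
  unfold mean
  simp only [PMF.bind_apply, ← ENNReal.tsum_mul_right, ← ENNReal.tsum_mul_left]
  rw [ENNReal.tsum_comm]
  simp only [mul_assoc]

theorem mean_map (p : PMF β) (g : β → γ) (f : γ → ENNReal) :
    mean (p.map g) f = mean p fun b => f (g b) := by
  rw [PMF.map, mean_bind]
  simp

theorem mean_mono_support {p : PMF β} {f g : β → ENNReal} (h : ∀ b ∈ p.support, f b ≤ g b) :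
    mean p f ≤ mean p g := by
  refine ENNReal.tsum_le_tsum fun b => ?_
  by_cases hb : p b = 0
  · simp [hb]
  · exact mul_le_mul_right (h b ((PMF.mem_support_iff _ _).2 hb)) _

theorem mean_mono {p : PMF β} {f g : β → ENNReal} (h : ∀ b, f b ≤ g b) : mean p f ≤ mean p g :=
  mean_mono_support fun b _ => h b

theorem mean_congr_support {p : PMF β} {f g : β → ENNReal} (h : ∀ b ∈ p.support, f b = g b) :
    mean p f = mean p g :=
  le_antisymm (mean_mono_support fun b hb => (h b hb).le)
    (mean_mono_support fun b hb => (h b hb).ge)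

theorem mean_add (p : PMF β) (f g : β → ENNReal) :
    mean p (fun b => f b + g b) = mean p f + mean p g := by
  simp only [mean, mul_add, ENNReal.tsum_add]

@[simp] theorem mean_const (p : PMF β) (c : ENNReal) : mean p (fun _ => c) = c := by
  simp [mean, ENNReal.tsum_mul_right, p.tsum_coe]

theorem mean_const_mul (p : PMF β) (c : ENNReal) (f : β → ENNReal) :
    mean p (fun b => c * f b) = c * mean p f := by
  simp only [mean, ← ENNReal.tsum_mul_left]
  exact tsum_congr fun b => by ring

theorem mean_mul_const (p : PMF β) (c : ENNReal) (f : β → ENNReal) :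
    mean p (fun b => f b * c) = mean p f * c := by
  simp only [mean, ← ENNReal.tsum_mul_right, mul_assoc]

theorem mean_sum {ι : Type*} (p : PMF β) (s : Finset ι) (f : ι → β → ENNReal) :
    mean p (fun b => ∑ i ∈ s, f i b) = ∑ i ∈ s, mean p (f i) := by
  classical
  induction s using Finset.induction_on with
  | empty => simp
  | insert a s ha ih => simp [Finset.sum_insert ha, mean_add, ih]

theorem mean_le_of_support {p : PMF β} {f : β → ENNReal} {c : ENNReal}
    (h : ∀ b ∈ p.support, f b ≤ c) : mean p f ≤ c :=
  (mean_mono_support h).trans (mean_const p c).le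

theorem mean_ite_add_ite_not (p : PMF β) (A : β → Prop) [DecidablePred A] :
    mean p (fun b => if A b then 1 else 0) + mean p (fun b => if A b then 0 else 1) = 1 := by
  rw [← mean_add]
  refine (mean_congr_support fun b _ => ?_).trans (mean_const p 1)
  split_ifs <;> simp

theorem prob_eq_mean {β : Type u} (p : PMF β) (A : β → Prop) [DecidablePred A] :
    prob p A = mean p fun b => if A b then 1 else 0 := by
  rw [prob, PMF.toOuterMeasure_apply]
  refine tsum_congr fun b => ?_
  by_cases h : A b <;> simp [h]

theorem mean_fintype [Fintype β] (p : PMF β) (f : β → ENNReal) :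
    mean p f = ∑ b, p b * f b := tsum_fintype _

end mean

/-! ### Independent families -/

section independent

variable {β : Type u} {γ : Type v}

/-- The product form is what identifies the law of a random subset and what allows rows and columns
of a matrix of coins to be exchanged. -/
theorem independent_apply : ∀ (n : ℕ) (p : Fin n → PMF β) (x : Fin n → β),
    independent n p x = ∏ i, p i (x i)
  | 0, p, x => by
    have : x = Fin.elim0 := funext fun i => i.elim0
    simp [independent, this]
  | n + 1, p, x => by
    classical
    rw [independent, PMF.bind_apply, tsum_eq_single (x 0), PMF.bind_apply,
      tsum_eq_single (fun i : Fin n => x i.succ), Fin.prod_univ_succ,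
      independent_apply n]
    · have : (Fin.cons (x 0) (fun i : Fin n => x i.succ) : Fin (n + 1) → β) = x :=
        Fin.cons_self_tail x
      simp [this]
    · intro y hy
      have : x ≠ Fin.cons (x 0) y := by
        intro h
        apply hy
        funext i
        rw [h]
        simp
      simp [this]
    · intro a ha
      rw [PMF.bind_apply]
      have : ∀ y : Fin n → β, x ≠ Fin.cons a y := by
        intro y h
        apply ha
        rw [h]
        simp
      simp [this]

theorem mean_independent_prod : ∀ (n : ℕ) (p : Fin n → PMF β) (f : Fin n → β → ENNReal),
    mean (independent n p) (fun x => ∏ i, f i (x i)) = ∏ i, mean (p i) (f i)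
  | 0, p, f => by simp [independent]
  | n + 1, p, f => by
    simp only [independent, mean_bind, mean_pure, Fin.prod_univ_succ, Fin.cons_zero,
      Fin.cons_succ]
    simp only [mean_const_mul, mean_mul_const]
    rw [mean_independent_prod n (fun i => p i.succ) fun i => f i.succ]

theorem independent_map : ∀ (n : ℕ) (p : Fin n → PMF β) (f : Fin n → β → γ),
    independent n (fun i => (p i).map (f i)) = (independent n p).map fun x i => f i (x i)
  | 0, p, f => by
    simp only [independent, PMF.pure_map]
    congr 1
    exact funext fun i => i.elim0
  | n + 1, p, f => by
    simp only [independent, independent_map n (fun i => p i.succ) fun i => f i.succ,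
      PMF.bind_map, PMF.map_bind, PMF.pure_map]
    congr 1
    funext x
    simp only [Function.comp_apply]
    congr 1
    funext y
    simp only [Function.comp_apply]
    congr 1
    funext i
    refine Fin.cases ?_ (fun j => ?_) i <;> simp

theorem independent_pure : ∀ (n : ℕ) (f : Fin n → β),
    independent n (fun i => PMF.pure (f i)) = PMF.pure f
  | 0, f => by
    simp only [independent]
    congr 1
    exact funext fun i => i.elim0
  | n + 1, f => by
    simp only [independent, independent_pure n fun i => f i.succ, PMF.pure_bind]
    congr 1
    exact Fin.cons_self_tail f

theorem mem_support_independent {n : ℕ} {p : Fin n → PMF β} {x : Fin n → β} :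
    x ∈ (independent n p).support ↔ ∀ i, x i ∈ (p i).support := by
  simp [PMF.mem_support_iff, independent_apply, Finset.prod_eq_zero_iff]

end independent

/-! ### Coins and random subsets -/

/-- A coin showing `true` with probability `x`, if `0 ≤ x ≤ 1`. -/
def flip (x : ℝ) : PMF Bool :=
  PMF.ofFintype
    (fun b => cond b (ENNReal.ofReal (max 0 (min x 1))) (ENNReal.ofReal (1 - max 0 (min x 1))))
    (by
      have h1 : max 0 (min x 1) ≤ 1 := max_le zero_le_one (min_le_right _ _)
      have h0 : 0 ≤ max 0 (min x 1) := le_max_left _ _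
      simp only [Fintype.sum_bool, cond_true, cond_false]
      rw [← ENNReal.ofReal_add h0 (by linarith)]
      simp)

theorem flip_true {x : ℝ} (h0 : 0 ≤ x) (h1 : x ≤ 1) : flip x true = ENNReal.ofReal x := by
  simp [flip, min_eq_left h1, max_eq_right h0]

theorem flip_false {x : ℝ} (h0 : 0 ≤ x) (h1 : x ≤ 1) :
    flip x false = ENNReal.ofReal (1 - x) := by
  simp [flip, min_eq_left h1, max_eq_right h0]

theorem mean_flip {x : ℝ} (h0 : 0 ≤ x) (h1 : x ≤ 1) (f : Bool → ENNReal) :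
    mean (flip x) f = ENNReal.ofReal x * f true + ENNReal.ofReal (1 - x) * f false := by
  rw [mean_fintype, Fintype.sum_bool, flip_true h0 h1, flip_false h0 h1]

/-- A random subset of `C`: every element is chosen with probability `x`, independently. -/
def sample {n : ℕ} (x : ℝ) (C : Finset (Fin n)) : PMF (Finset (Fin n)) :=
  (independent n fun i => if i ∈ C then flip x else PMF.pure false).map
    fun b => univ.filter fun i => b i = true

/-- Expectations over random subsets become finite sums over a powerset with Bernoulli weights. -/
theorem mean_sample {n : ℕ} {x : ℝ} (h0 : 0 ≤ x) (h1 : x ≤ 1) (C : Finset (Fin n))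
    (F : Finset (Fin n) → ENNReal) :
    mean (sample x C) F =
      ∑ R ∈ C.powerset, ENNReal.ofReal (x ^ #R * (1 - x) ^ (#C - #R)) * F R := by
  classical
  rw [sample, mean_map, mean_fintype]
  -- A node outside `C` shows `false` for sure: it contributes a factor `1` if it is not in `R`, and
  -- makes the product vanish otherwise.
  have key : ∀ R : Finset (Fin n), (∏ i, (if i ∈ C then flip x else PMF.pure false)
      (decide (i ∈ R))) =
      if R ⊆ C then ENNReal.ofReal (x ^ #R * (1 - x) ^ (#C - #R)) else 0 := by
    intro R
    split_ifs with hR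
    · have h2 : ∀ i, (if i ∈ C then flip x else PMF.pure false) (decide (i ∈ R)) =
          ENNReal.ofReal ((if i ∈ R then x else 1) * (if i ∈ C \ R then 1 - x else 1)) := by
        intro i
        by_cases hi : i ∈ R
        · simp [hi, hR hi, flip_true h0 h1]
        · by_cases hc : i ∈ C
          · simp [hi, hc, flip_false h0 h1]
          · simp [hi, hc]
      simp only [h2]
      rw [← ENNReal.ofReal_prod_of_nonneg, Finset.prod_mul_distrib]
      · simp only [Finset.prod_ite_mem, Finset.univ_inter, Finset.prod_const]
        rw [Finset.card_sdiff_of_subset hR]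
      · intro i _
        have : 0 ≤ 1 - x := by linarith
        positivity
    · obtain ⟨i, hi, hc⟩ := Finset.not_subset.1 hR
      exact Finset.prod_eq_zero (Finset.mem_univ i) (by simp [hi, hc])
  have e : ∑ b : Fin n → Bool, (independent n fun i => if i ∈ C then flip x else PMF.pure false) b *
        F (univ.filter fun i => b i = true) =
      ∑ R : Finset (Fin n), (if R ⊆ C then ENNReal.ofReal (x ^ #R * (1 - x) ^ (#C - #R)) else 0) *
        F R := by
    refine Finset.sum_bij' (fun b _ => univ.filter fun i => b i = true)
      (fun R _ => fun i => decide (i ∈ R)) (by simp) (by simp) (by intro b _; funext i; simp)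
      (by intro R _; ext i; simp) ?_
    intro b _
    rw [← key, independent_apply]
    congr 1
    refine Finset.prod_congr rfl fun i _ => ?_
    simp
  rw [e, ← Finset.sum_subset (Finset.subset_univ C.powerset)]
  · refine Finset.sum_congr rfl fun R hR => ?_
    rw [if_pos (Finset.mem_powerset.1 hR)]
  · intro R _ hR
    rw [if_neg (fun h => hR (Finset.mem_powerset.2 h)), zero_mul]

theorem subset_of_mem_support_sample {n : ℕ} {x : ℝ} {C R : Finset (Fin n)}
    (h : R ∈ (sample x C).support) : R ⊆ C := by
  rw [sample, PMF.mem_support_map_iff] at h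
  obtain ⟨b, hb, rfl⟩ := h
  rw [mem_support_independent] at hb
  intro i hi
  by_contra hc
  have := hb i
  simp [hc] at this
  simp [this] at hi

theorem eq_of_mem_support_sample_one {n : ℕ} {C R : Finset (Fin n)}
    (h : R ∈ (sample 1 C).support) : R = C := by
  refine (subset_of_mem_support_sample h).antisymm fun i hi => ?_
  rw [sample, PMF.mem_support_map_iff] at h
  obtain ⟨b, hb, rfl⟩ := h
  rw [mem_support_independent] at hb
  have := hb i
  rw [if_pos hi, PMF.mem_support_iff] at this
  by_contra hc
  have hf : b i = false := by simpa using hc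
  rw [hf, flip_false zero_le_one le_rfl] at this
  simp at this

/-- Real-valued expectation over the random subsets of `C`. -/
def avg {ι : Type*} (x : ℝ) (C : Finset ι) (f : Finset ι → ℝ) : ℝ :=
  ∑ R ∈ C.powerset, x ^ #R * (1 - x) ^ (#C - #R) * f R

/-- The potential argument needs subtraction, hence real numbers. This is the bridge from the law of
the replies to `avg`. -/
theorem mean_sample_ofReal {n : ℕ} {x : ℝ} (h0 : 0 ≤ x) (h1 : x ≤ 1) (C : Finset (Fin n))
    (f : Finset (Fin n) → ℝ) (hf : ∀ R ⊆ C, 0 ≤ f R) :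
    mean (sample x C) (fun R => ENNReal.ofReal (f R)) = ENNReal.ofReal (avg x C f) := by
  have hw : ∀ R : Finset (Fin n), 0 ≤ x ^ #R * (1 - x) ^ (#C - #R) := fun R =>
    mul_nonneg (pow_nonneg h0 _) (pow_nonneg (by linarith) _)
  rw [mean_sample h0 h1, avg, ENNReal.ofReal_sum_of_nonneg]
  · refine Finset.sum_congr rfl fun R _ => ?_
    rw [ENNReal.ofReal_mul (hw R)]
  · intro R hR
    exact mul_nonneg (hw R) (hf R (Finset.mem_powerset.1 hR))

end Monitoring

end

noncomputable section

namespace Monitoring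

open Finset

/-! ### Real-valued averages over random subsets -/

section avg

variable {ι : Type*} {x : ℝ} {C : Finset ι} {f g : Finset ι → ℝ}

theorem avg_weight_nonneg (h0 : 0 ≤ x) (h1 : x ≤ 1) (a b : ℕ) : 0 ≤ x ^ a * (1 - x) ^ b :=
  mul_nonneg (pow_nonneg h0 _) (pow_nonneg (by linarith) _)

theorem avg_mono (h0 : 0 ≤ x) (h1 : x ≤ 1) (h : ∀ R ⊆ C, f R ≤ g R) : avg x C f ≤ avg x C g :=
  Finset.sum_le_sum fun R hR =>
    mul_le_mul_of_nonneg_left (h R (Finset.mem_powerset.1 hR)) (avg_weight_nonneg h0 h1 _ _)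

theorem avg_congr (h : ∀ R ⊆ C, f R = g R) : avg x C f = avg x C g :=
  Finset.sum_congr rfl fun R hR => by rw [h R (Finset.mem_powerset.1 hR)]

theorem avg_add : avg x C (fun R => f R + g R) = avg x C f + avg x C g := by
  simp only [avg, mul_add, Finset.sum_add_distrib]

theorem avg_const_mul (c : ℝ) : avg x C (fun R => c * f R) = c * avg x C f := by
  simp only [avg, Finset.mul_sum]
  exact Finset.sum_congr rfl fun R _ => by ring

/-- The binomial theorem. It serves as the moment generating function of the size of a random
subset. -/
theorem avg_pow_card (x z : ℝ) (C : Finset ι) :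
    avg x C (fun R => z ^ #R) = (x * z + (1 - x)) ^ #C := by
  rw [← Finset.sum_pow_mul_eq_add_pow, avg]
  exact Finset.sum_congr rfl fun R _ => by rw [mul_pow]; ring

@[simp] theorem avg_const (x : ℝ) (C : Finset ι) (c : ℝ) : avg x C (fun _ => c) = c := by
  have := avg_pow_card x 1 C
  simp only [one_pow, mul_one, add_sub_cancel] at this
  simpa [this] using avg_const_mul (x := x) (C := C) (f := fun _ => 1) c

@[simp] theorem avg_empty (x : ℝ) (f : Finset ι → ℝ) : avg x ∅ f = f ∅ := by simp [avg]

@[simp] theorem avg_one (C : Finset ι) (f : Finset ι → ℝ) : avg 1 C f = f C := by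
  rw [avg, Finset.sum_eq_single C]
  · simp
  · intro R hR hne
    have : #R < #C := Finset.card_lt_card ((Finset.mem_powerset.1 hR).ssubset_of_ne hne)
    have h : #C - #R ≠ 0 := by omega
    simp [h]
  · simp

/-- Condition on whether the additional element is chosen. -/
theorem avg_insert [DecidableEq ι] {a : ι} (ha : a ∉ C) (f : Finset ι → ℝ) :
    avg x (insert a C) f = (1 - x) * avg x C f + x * avg x C fun R => f (insert a R) := by
  rw [avg, Finset.sum_powerset_insert ha, avg, avg, Finset.mul_sum, Finset.mul_sum]
  congr 1
  · refine Finset.sum_congr rfl fun R hR => ?_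
    have : #R ≤ #C := Finset.card_le_card (Finset.mem_powerset.1 hR)
    rw [Finset.card_insert_of_notMem ha, Nat.succ_sub this, pow_succ]
    ring
  · refine Finset.sum_congr rfl fun R hR => ?_
    have h1 : a ∉ R := fun h => ha (Finset.mem_powerset.1 hR h)
    rw [Finset.card_insert_of_notMem ha, Finset.card_insert_of_notMem h1, Nat.add_sub_add_right,
      pow_succ]
    ring

theorem avg_card_filter (P : ι → Prop) [DecidablePred P] :
    avg x C (fun R => (#(R.filter P) : ℝ)) = x * #(C.filter P) := by
  classical
  induction C using Finset.induction_on with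
  | empty => simp
  | insert a C ha ih =>
    rw [avg_insert ha, ih]
    have h : avg x C (fun R => (#((insert a R).filter P) : ℝ)) =
        avg x C (fun R => (#(R.filter P) : ℝ) + if P a then 1 else 0) := by
      refine avg_congr fun R hR => ?_
      rw [Finset.filter_insert]
      split_ifs with hp
      · rw [Finset.card_insert_of_notMem (fun h => ha (hR (Finset.mem_filter.1 h).1))]
        push_cast; ring
      · simp
    rw [h, avg_add, ih, avg_const, Finset.filter_insert]
    split_ifs with hp
    · rw [Finset.card_insert_of_notMem (fun h => ha (Finset.mem_filter.1 h).1)]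
      push_cast; ring
    · ring

/-- An average is at most another one, minus what is gained on a family of disjoint events. -/
theorem avg_le_sub_sum (h0 : 0 ≤ x) (h1 : x ≤ 1) (S : Finset (Finset ι)) (hS : S ⊆ C.powerset)
    (gain : Finset ι → ℝ) (h : ∀ R ⊆ C, f R ≤ g R) (hg : ∀ R ∈ S, f R ≤ g R - gain R) :
    avg x C f ≤ avg x C g - ∑ R ∈ S, x ^ #R * (1 - x) ^ (#C - #R) * gain R := by
  classical
  rw [avg, avg, ← Finset.sum_sdiff hS, ← Finset.sum_sdiff hS, add_sub_assoc,
    ← Finset.sum_sub_distrib]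
  refine add_le_add (Finset.sum_le_sum fun R hR => ?_) (Finset.sum_le_sum fun R hR => ?_)
  · exact mul_le_mul_of_nonneg_left (h R (Finset.mem_powerset.1 (Finset.mem_sdiff.1 hR).1))
      (avg_weight_nonneg h0 h1 _ _)
  · rw [← mul_sub]
    exact mul_le_mul_of_nonneg_left (hg R hR) (avg_weight_nonneg h0 h1 _ _)

/-- The event that nobody replies. It carries a gain from a later round to an earlier one. -/
theorem avg_le_sub_empty (h0 : 0 ≤ x) (h1 : x ≤ 1) (gain : ℝ) (h : ∀ R ⊆ C, f R ≤ g R)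
    (hg : f ∅ ≤ g ∅ - gain) : avg x C f ≤ avg x C g - (1 - x) ^ #C * gain := by
  classical
  have := avg_le_sub_sum h0 h1 {∅} (by simp) (fun _ => gain) h (by simpa using hg)
  simpa using this

/-- The events that a single member replies are disjoint and equally likely, so the gain of a
uniformly random member enters. -/
theorem avg_le_sub_singleton (h0 : 0 ≤ x) (h1 : x ≤ 1) (gain : ι → ℝ) (h : ∀ R ⊆ C, f R ≤ g R)
    (hg : ∀ v ∈ C, f {v} ≤ g {v} - gain v) :
    avg x C f ≤ avg x C g - x * (1 - x) ^ (#C - 1) * ∑ v ∈ C, gain v := by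
  classical
  rcases C.eq_empty_or_nonempty with rfl | ⟨w, hw⟩
  · simpa using h ∅ (by simp)
  have inj : Function.Injective (fun v : ι => ({v} : Finset ι)) := Finset.singleton_injective
  let gain' : Finset ι → ℝ := fun R => ∑ v ∈ R, gain v
  have := avg_le_sub_sum h0 h1 (C.image fun v => ({v} : Finset ι))
    (by
      intro R hR
      obtain ⟨v, hv, rfl⟩ := Finset.mem_image.1 hR
      simpa using hv) gain' h
    (by
      intro R hR
      obtain ⟨v, hv, rfl⟩ := Finset.mem_image.1 hR
      simpa [gain'] using hg v hv)
  rw [Finset.sum_image (fun a _ b _ hab => inj hab)] at this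
  refine this.trans (le_of_eq ?_)
  rw [Finset.mul_sum]
  simp [gain']

/-- Markov's inequality for `z ^ #R`. With `z > 1` it bounds upper tails, with `z < 1` lower tails.
-/
theorem avg_ite_le {z : ℝ} (h0 : 0 ≤ x) (h1 : x ≤ 1) (hz : 0 ≤ z) (A : Finset ι → Prop)
    [DecidablePred A] (c : ℝ) (h : ∀ R ⊆ C, A R → 1 ≤ c * z ^ #R) (hc : 0 ≤ c) :
    avg x C (fun R => if A R then 1 else 0) ≤ c * (x * z + (1 - x)) ^ #C := by
  rw [← avg_pow_card, ← avg_const_mul]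
  refine avg_mono h0 h1 fun R hR => ?_
  split_ifs with hA
  · exact h R hR hA
  · positivity

theorem mul_add_one_sub_pow_le_exp (h0 : 0 ≤ x) (h1 : x ≤ 1) {z : ℝ} (hz : 0 ≤ z) (k : ℕ) :
    (x * z + (1 - x)) ^ k ≤ Real.exp (k * x * (z - 1)) := by
  have h := Real.add_one_le_exp (x * (z - 1))
  have h2 : 0 ≤ x * z + (1 - x) := add_nonneg (mul_nonneg h0 hz) (by linarith)
  calc (x * z + (1 - x)) ^ k ≤ (Real.exp (x * (z - 1))) ^ k :=
        pow_le_pow_left₀ h2 (by linarith) _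
    _ = _ := by rw [← Real.exp_nat_mul]; congr 1; ring

end avg

/-! ### Harmonic numbers -/

/-- The harmonic numbers as real numbers. -/
def harm (k : ℕ) : ℝ := ∑ i ∈ range k, 1 / ((i : ℝ) + 1)

@[simp] theorem harm_zero : harm 0 = 0 := by simp [harm]

theorem harm_mono {a b : ℕ} (h : a ≤ b) : harm a ≤ harm b :=
  Finset.sum_le_sum_of_subset_of_nonneg (Finset.range_mono h) fun _ _ _ => by positivity

theorem harm_nonneg (a : ℕ) : 0 ≤ harm a := Finset.sum_nonneg fun _ _ => by positivity

/-- Each of the `a - b` terms between the two harmonic numbers is at least `1 / a`. -/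
theorem harm_sub_ge {a b : ℕ} (h : b ≤ a) : ((a : ℝ) - b) / a ≤ harm a - harm b := by
  induction a, h using Nat.le_induction with
  | base => simp
  | succ a hb ih =>
    rw [harm, Finset.sum_range_succ, ← harm]
    rcases Nat.eq_zero_or_pos a with rfl | ha
    · obtain rfl : b = 0 := by omega
      simp
    · have ha' : (0 : ℝ) < a := by exact_mod_cast ha
      have hb' : (b : ℝ) ≤ a := by exact_mod_cast hb
      push_cast
      have : ((a : ℝ) + 1 - b) / (a + 1) ≤ (a - b) / a + 1 / (a + 1) := by
        have h2 : ((a : ℝ) - b) / (a + 1) ≤ (a - b) / a :=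
          div_le_div_of_nonneg_left (by linarith) ha' (by linarith)
        have h3 : ((a : ℝ) + 1 - b) / (a + 1) = (a - b) / (a + 1) + 1 / (a + 1) := by
          rw [← add_div]; ring
        linarith
      linarith

theorem harm_eq_harmonic (k : ℕ) : harm k = (harmonic k : ℝ) := by
  simp [harm, harmonic]

theorem harm_le (k : ℕ) : harm k ≤ 1 + Real.log k := by
  rw [harm_eq_harmonic]
  exact harmonic_le_one_add_log k

/-- In a finite set with injective labels, the number of elements below takes each value once. -/
theorem sum_card_filter_lt {ι α M : Type*} [LinearOrder α] [AddCommMonoid M] (d : ι → α)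
    (hd : Function.Injective d) (f : ℕ → M) (S : Finset ι) :
    ∑ v ∈ S, f #(S.filter fun w => d w < d v) = ∑ r ∈ range #S, f r := by
  classical
  induction hk : #S generalizing S with
  | zero =>
    obtain rfl := Finset.card_eq_zero.1 hk
    simp
  | succ k ih =>
    have hne : S.Nonempty := Finset.card_pos.1 (by omega)
    -- The largest element lies below no other one, so its removal leaves all other counts
    -- unchanged, and its own count is the largest index.
    obtain ⟨a, ha, hmax⟩ := Finset.exists_max_image S d hne
    have hc : #(S.erase a) = k := by rw [Finset.card_erase_of_mem ha, hk]; rfl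
    rw [Finset.sum_range_succ, ← Finset.sum_erase_add _ _ ha]
    congr 1
    · rw [← ih (S.erase a) hc]
      refine Finset.sum_congr rfl fun v hv => ?_
      congr 2
      ext w
      simp only [Finset.mem_filter, Finset.mem_erase]
      constructor
      · rintro ⟨h1, h2⟩
        refine ⟨⟨?_, h1⟩, h2⟩
        rintro rfl
        exact absurd h2 (not_lt.2 (hmax v (Finset.mem_of_mem_erase hv)))
      · rintro ⟨⟨_, h1⟩, h2⟩
        exact ⟨h1, h2⟩
    · congr 1
      rw [← hc]
      congr 1
      ext w
      simp only [Finset.mem_filter, Finset.mem_erase]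
      constructor
      · rintro ⟨h1, h2⟩
        exact ⟨by rintro rfl; exact lt_irrefl _ h2, h1⟩
      · rintro ⟨h1, h2⟩
        exact ⟨h2, lt_of_le_of_ne (hmax w h2) fun h => h1 (hd h)⟩

end Monitoring

end

noncomputable section

namespace Monitoring

open Finset

/-! ### The potential of a search, and tests of likely thresholds -/

section test

set_option linter.unusedSectionVars false

/-- `a` is at most the threshold `X`, where `none` stands for `∞`. -/
def UpTo {α : Type*} [LinearOrder α] : Option α → α → Prop
  | none, _ => True
  | some x, a => a ≤ x

instance {α : Type*} [LinearOrder α] (X : Option α) (a : α) : Decidable (UpTo X a) :=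
  match X with
  | none => isTrue trivial
  | some x => inferInstanceAs (Decidable (a ≤ x))

@[simp] theorem upTo_none {α : Type*} [LinearOrder α] (a : α) : UpTo none a := trivial

@[simp] theorem upTo_some {α : Type*} [LinearOrder α] (x a : α) : UpTo (some x) a ↔ a ≤ x :=
  Iff.rfl

theorem UpTo.mono {α : Type*} [LinearOrder α] {X : Option α} {a b : α} (h : UpTo X b)
    (hab : a ≤ b) : UpTo X a := by
  cases X with
  | none => trivial
  | some x => exact hab.trans h

/-- Put the smallest of the new items on the stack. -/
def push {α : Type*} [LinearOrder α] (I : Finset α) (st : List α) : List α :=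
  if h : I.Nonempty then I.min' h :: st else st

variable {α : Type*} [LinearOrder α] {ι : Type*} [DecidableEq ι]
  (d : ι → α) (Pop : Finset ι) (t : ℕ)

/-- At most `t` members of the population are up to the threshold. -/
def Low (X : Option α) : Prop := #(Pop.filter fun i => UpTo X (d i)) ≤ t

instance (X : Option α) : Decidable (Low d Pop t X) := inferInstanceAs (Decidable (_ ≤ _))

/-- The members that have not sent their item and are up to the threshold. -/
def cand (U : Finset ι) (X : Option α) : Finset ι := U.filter fun i => UpTo X (d i)

/-- How many more items up to the threshold are needed. -/
def need (U : Finset ι) (X : Option α) : ℕ :=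
  t - #((Pop \ U).filter fun i => UpTo X (d i))

/-- Number of members that are to be output but have not sent their item. -/
def open' (U : Finset ι) : ℕ := #(U.filter fun i => Low d Pop t (some (d i)))

/-- Number of members outside the output which are up to the lowest high threshold. -/
def surplus (U : Finset ι) (st : List α) : ℕ :=
  #(U.filter fun i => ¬ Low d Pop t (some (d i)) ∧
    UpTo (st.find? fun x => ¬ Low d Pop t (some x)) (d i))

/-- A large constant. -/
def bigA : ℝ := 2 ^ 42

theorem bigA_pos : 0 < bigA := by unfold bigA; positivity

/-- The potential without discount. -/
def base (U : Finset ι) (st : List α) : ℝ :=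
  bigA * harm (open' d Pop t U) + bigA * harm (surplus d Pop t U st) +
    4 * (st.countP fun x => Low d Pop t (some x)) + 3

/-- The discount for a threshold that is likely to be passed. -/
def disc (U : Finset ι) (st : List α) : ℝ :=
  if Low d Pop t st.head? ∧ 2048 * #(cand d U st.head?) ≤ need d Pop t U st.head? then
    bigA / 2 * (harm (open' d Pop t U) - harm (open' d Pop t U - #(cand d U st.head?)))
  else 0

/-- The potential before a test. -/
def start (U : Finset ι) (st : List α) : ℝ := base d Pop t U st - disc d Pop t U st

/-- A test is aborted: sufficiently many members replied. -/
def Abort (U : Finset ι) (X : Option α) (e : ℕ) (R : Finset ι) : Prop :=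
  R.Nonempty ∧ need d Pop t U X ≤ 2 * #R * 2 ^ e

instance (U : Finset ι) (X : Option α) (e : ℕ) (R : Finset ι) :
    Decidable (Abort d Pop t U X e R) := inferInstanceAs (Decidable (_ ∧ _))

/-- The search ends when the threshold has been passed. -/
def Final (U : Finset ι) (X : Option α) : Prop :=
  X = none ∨ t ≤ #((Pop \ U).filter fun i => UpTo X (d i))

instance (U : Finset ι) (X : Option α) : Decidable (Final d Pop t U X) :=
  inferInstanceAs (Decidable (_ ∨ _))

/-- Potential during a test: the next members to reply are chosen with probability `2 ^ (-e)`;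
every round costs `τ`, every new threshold and every superfluous reply costs `1`. -/
def mid (τ : ℝ) (st : List α) : ℕ → Finset ι → ℝ
  | 0, U => τ + #((cand d U st.head?).filter fun i => ¬ Low d Pop t (some (d i))) +
      if Final d Pop t (U \ cand d U st.head?) st.head? then 0
      else 1 + start d Pop t (U \ cand d U st.head?) st.tail
  | e + 1, U => avg ((1 / 2) ^ (e + 1)) (cand d U st.head?) fun R =>
      τ + #(R.filter fun i => ¬ Low d Pop t (some (d i))) +
        if Abort d Pop t U st.head? (e + 1) R then 1 + start d Pop t (U \ R) (push (R.image d) st)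
        else mid τ st e (U \ R)

variable {d Pop t}

theorem Low.anti {x y : α} (h : Low d Pop t (some y)) (hxy : x ≤ y) : Low d Pop t (some x) :=
  (Finset.card_le_card fun i hi => by
    simp only [Finset.mem_filter, upTo_some] at hi ⊢
    exact ⟨hi.1, hi.2.trans hxy⟩).trans h

theorem Low.of_upTo {X : Option α} {x : α} (h : Low d Pop t X) (hx : UpTo X x) :
    Low d Pop t (some x) :=
  (Finset.card_le_card fun i hi => by
    simp only [Finset.mem_filter, upTo_some] at hi ⊢
    exact ⟨hi.1, hx.mono hi.2⟩).trans h

theorem upTo_of_low_of_not_low {X : Option α} {x : α} (h : ¬ Low d Pop t X)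
    (hx : Low d Pop t (some x)) : UpTo X x := by
  cases X with
  | none => trivial
  | some y =>
    by_contra hc
    exact h (hx.anti (le_of_not_ge hc))

theorem open'_mono {U V : Finset ι} (h : U ⊆ V) : open' d Pop t U ≤ open' d Pop t V :=
  Finset.card_le_card (Finset.filter_subset_filter _ h)

theorem cand_subset (U : Finset ι) (X : Option α) : cand d U X ⊆ U := Finset.filter_subset _ _

theorem cand_sdiff (U R : Finset ι) (X : Option α) : cand d (U \ R) X = cand d U X \ R := by
  ext i; simp only [cand, mem_filter, mem_sdiff]; tauto

theorem surplus_mono {U V : Finset ι} (h : U ⊆ V) (st : List α) :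
    surplus d Pop t U st ≤ surplus d Pop t V st :=
  Finset.card_le_card (Finset.filter_subset_filter _ h)

/-- The surplus refers to the lowest threshold that is too high, which a low threshold on top of it
does not affect. -/
theorem surplus_cons_of_low {v : α} (hv : Low d Pop t (some v)) (U : Finset ι) (st : List α) :
    surplus d Pop t U (v :: st) = surplus d Pop t U st := by
  simp [surplus, hv]

theorem surplus_cons_of_not_low {v : α} (hv : ¬ Low d Pop t (some v)) (U : Finset ι)
    (st : List α) : surplus d Pop t U (v :: st) =
      #(U.filter fun i => ¬ Low d Pop t (some (d i)) ∧ d i ≤ v) := by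
  simp [surplus, hv]

theorem find?_of_not_low_head {st : List α} (h : ¬ Low d Pop t st.head?) :
    (st.find? fun x => ¬ Low d Pop t (some x)) = st.head? := by
  cases st with
  | nil => rfl
  | cons x st =>
    simp only [List.head?_cons] at h
    simp [h]

theorem disc_nonneg (U : Finset ι) (st : List α) : 0 ≤ disc d Pop t U st := by
  unfold disc
  split_ifs
  · have := harm_mono (Nat.sub_le (open' d Pop t U) #(cand d U st.head?))
    have := bigA_pos
    apply mul_nonneg <;> linarith
  · exact le_rfl

theorem start_le_base (U : Finset ι) (st : List α) : start d Pop t U st ≤ base d Pop t U st :=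
  sub_le_self _ (disc_nonneg U st)

theorem base_mono {U V : Finset ι} (h : U ⊆ V) (st : List α) :
    base d Pop t U st ≤ base d Pop t V st := by
  have h1 := harm_mono (open'_mono (d := d) (Pop := Pop) (t := t) h)
  have h2 := harm_mono (surplus_mono (d := d) (Pop := Pop) (t := t) h st)
  have := bigA_pos
  unfold base
  gcongr

theorem base_tail_le (U : Finset ι) (st : List α) (h : Low d Pop t st.head?) :
    base d Pop t U st.tail ≤ base d Pop t U st := by
  cases st with
  | nil => simp
  | cons x st =>
    simp only [List.head?_cons] at h
    simp [base, surplus_cons_of_low h, h]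

/-- A low pivot costs the constant `4` for one more low threshold. A pivot that is not low can only
arise under a high threshold and replaces it in the definition of the surplus, which therefore does
not grow. -/
theorem base_cons_le {U : Finset ι} {st : List α} {v : ι} (hv : v ∈ cand d U st.head?)
    {V : Finset ι} (hV : V ⊆ U) : base d Pop t V (d v :: st) ≤ base d Pop t U st + 4 := by
  have h1 := harm_mono (open'_mono (d := d) (Pop := Pop) (t := t) hV)
  have h2 : surplus d Pop t V (d v :: st) ≤ surplus d Pop t U st := by
    by_cases hl : Low d Pop t (some (d v))
    · rw [surplus_cons_of_low hl]
      exact surplus_mono hV _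
    · have hh : ¬ Low d Pop t st.head? := fun h => hl (h.of_upTo (mem_filter.1 hv).2)
      rw [surplus_cons_of_not_low hl, surplus, find?_of_not_low_head hh]
      refine card_le_card fun i hi => ?_
      simp only [mem_filter] at hi ⊢
      exact ⟨hV hi.1, hi.2.1, (mem_filter.1 hv).2.mono hi.2.2⟩
  have h3 := harm_mono h2
  have h4 : ((d v :: st).countP fun x => Low d Pop t (some x)) ≤
      (st.countP fun x => Low d Pop t (some x)) + 1 := by
    rw [List.countP_cons]; split_ifs <;> omega
  have h4' : (((d v :: st).countP fun x => Low d Pop t (some x) : ℕ) : ℝ) ≤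
      (st.countP fun x => Low d Pop t (some x) : ℕ) + 1 := by exact_mod_cast h4
  have := bigA_pos
  unfold base
  have e1 := mul_le_mul_of_nonneg_left h1 this.le
  have e2 := mul_le_mul_of_nonneg_left h3 this.le
  linarith

theorem exists_push_eq {R : Finset ι} (h : R.Nonempty) (st : List α) :
    ∃ v ∈ R, push (R.image d) st = d v :: st := by
  have h' : (R.image d).Nonempty := h.image d
  obtain ⟨v, hv, e⟩ := mem_image.1 ((R.image d).min'_mem h')
  exact ⟨v, hv, by rw [push, dif_pos h', e]⟩

theorem start_push_le {U R : Finset ι} {st : List α} (hR : R ⊆ cand d U st.head?)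
    (hne : R.Nonempty) :
    start d Pop t (U \ R) (push (R.image d) st) ≤ base d Pop t U st + 4 := by
  obtain ⟨v, hv, e⟩ := exists_push_eq (d := d) hne st
  rw [e]
  exact (start_le_base _ _).trans (base_cons_le (hR hv) sdiff_subset)

/-- All low members are up to the largest one of them, which is low itself. -/
theorem card_low_le : #(Pop.filter fun i => Low d Pop t (some (d i))) ≤ t := by
  rcases (Pop.filter fun i => Low d Pop t (some (d i))).eq_empty_or_nonempty with h | h
  · simp [h]
  · obtain ⟨i, hi, hm⟩ := exists_max_image _ d h
    refine le_trans (card_le_card fun j hj => ?_) (mem_filter.1 hi).2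
    simp only [mem_filter, upTo_some]
    exact ⟨(mem_filter.1 hj).1, hm j hj⟩

theorem open'_le (U : Finset ι) (hU : U ⊆ Pop) : open' d Pop t U ≤ t :=
  (open'_mono hU).trans card_low_le

/-- Members up to a low threshold that have replied are low too. Together with the silent low
members they number at most `t`. -/
theorem open'_le_need {U : Finset ι} (hU : U ⊆ Pop) {X : Option α} (hX : Low d Pop t X) :
    open' d Pop t U ≤ need d Pop t U X := by
  have h : #((Pop \ U).filter fun i => UpTo X (d i)) + open' d Pop t U ≤ t := by
    refine le_trans (le_of_eq (card_union_of_disjoint ?_).symm)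
      ((card_le_card (?_ : _ ⊆ Pop.filter fun i => Low d Pop t (some (d i)))).trans card_low_le)
    · rw [disjoint_left]
      intro i hi hj
      simp only [mem_filter, mem_sdiff] at hi hj
      exact hi.1.2 hj.1
    · intro i hi
      simp only [mem_union, mem_filter, mem_sdiff] at hi ⊢
      rcases hi with hi | hi
      · exact ⟨hi.1.1, hX.of_upTo hi.2⟩
      · exact ⟨hU hi.1, hi.2⟩
  unfold need
  omega

theorem card_cand_add {U : Finset ι} (hU : U ⊆ Pop) (X : Option α) :
    #(cand d U X) + #((Pop \ U).filter fun i => UpTo X (d i)) =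
      #(Pop.filter fun i => UpTo X (d i)) := by
  rw [cand, ← card_union_of_disjoint]
  · congr 1
    ext i
    simp only [mem_union, mem_filter, mem_sdiff]
    constructor
    · rintro (h | h)
      · exact ⟨hU h.1, h.2⟩
      · exact ⟨h.1.1, h.2⟩
    · rintro h
      by_cases hi : i ∈ U
      · exact Or.inl ⟨hi, h.2⟩
      · exact Or.inr ⟨⟨h.1, hi⟩, h.2⟩
  · rw [disjoint_left]
    intro i hi hj
    simp only [mem_filter, mem_sdiff] at hi hj
    exact hj.1.2 hi.1

theorem need_le_card_cand {U : Finset ι} (hU : U ⊆ Pop) {X : Option α}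
    (hX : ¬ Low d Pop t X) : need d Pop t U X ≤ #(cand d U X) := by
  have := card_cand_add (d := d) hU X
  unfold Low at hX
  unfold need
  omega

/-- A test of a high threshold that runs through to exponent `0` ends the search: all of the more
than `t` members up to it are known then. -/
theorem final_of_not_low {U : Finset ι} (hU : U ⊆ Pop) {X : Option α} (hX : ¬ Low d Pop t X) :
    Final d Pop t (U \ cand d U X) X := by
  right
  have := card_cand_add (d := d) (sdiff_subset.trans hU : U \ cand d U X ⊆ Pop) X
  rw [cand_sdiff, Finset.sdiff_self] at this
  unfold Low at hX
  simp only [card_empty] at this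
  omega

/-- Under a low threshold no reply is superfluous. -/
theorem filter_not_low_eq_empty {U R : Finset ι} {X : Option α} (hX : Low d Pop t X)
    (hR : R ⊆ cand d U X) : (R.filter fun i => ¬ Low d Pop t (some (d i))) = ∅ := by
  refine filter_eq_empty_iff.2 fun i hi => not_not.2 ?_
  exact hX.of_upTo (mem_filter.1 (hR hi)).2

theorem open'_sdiff_add {U R : Finset ι} (hR : R ⊆ U) :
    open' d Pop t (U \ R) + #(R.filter fun i => Low d Pop t (some (d i))) = open' d Pop t U := by
  rw [open', ← card_union_of_disjoint]
  · congr 1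
    ext i
    simp only [mem_union, mem_filter, mem_sdiff]
    constructor
    · rintro (h | h)
      · exact ⟨h.1.1, h.2⟩
      · exact ⟨hR h.1, h.2⟩
    · rintro h
      by_cases hi : i ∈ R
      · exact Or.inr ⟨hi, h.2⟩
      · exact Or.inl ⟨⟨h.1, hi⟩, h.2⟩
  · rw [disjoint_left]
    intro i hi hj
    simp only [mem_filter, mem_sdiff] at hi hj
    exact hi.1.2 hj.1

theorem open'_sdiff_of_low {U R : Finset ι} {X : Option α} (hX : Low d Pop t X)
    (hR : R ⊆ cand d U X) : open' d Pop t (U \ R) + #R = open' d Pop t U := by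
  rw [← open'_sdiff_add (hR.trans (cand_subset _ _))]
  congr 1
  rw [filter_true_of_mem]
  intro i hi
  exact hX.of_upTo (mem_filter.1 (hR hi)).2

theorem card_cand_sdiff {U R : Finset ι} {X : Option α} (hR : R ⊆ cand d U X) :
    #(cand d (U \ R) X) + #R = #(cand d U X) := by
  rw [cand_sdiff, card_sdiff_of_subset hR]
  have := card_le_card hR
  omega

/-- Every new reply reduces what is needed by at most one, so the need of a likely threshold stays
large during its test. -/
theorem need_sdiff {U R : Finset ι} (hU : U ⊆ Pop) {X : Option α} (hR : R ⊆ cand d U X) :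
    need d Pop t U X ≤ need d Pop t (U \ R) X + #R := by
  have h1 := card_cand_add (d := d) hU X
  have h2 := card_cand_add (d := d) (sdiff_subset.trans hU : U \ R ⊆ Pop) X
  have h3 := card_cand_sdiff hR
  unfold need
  omega

/-- A bound for the probability that a test of a likely threshold is aborted, where `y` is the
expected number of replies needed. -/
def abortBound (y : ℝ) : ℝ := if 64 ≤ y then 3 / y else 1 / 8 + (64 - y) / 1024

theorem abortBound_nonneg {y : ℝ} (_ : 0 ≤ y) : 0 ≤ abortBound y := by
  unfold abortBound
  split_ifs with h
  · positivity
  · have : 0 ≤ 64 - y := by linarith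
    positivity

theorem abortBound_le {y : ℝ} (_ : 0 ≤ y) : abortBound y ≤ 1 / 4 := by
  unfold abortBound
  split_ifs with h
  · rw [div_le_iff₀ (by linarith)]; linarith
  · linarith

/-- One round of a union bound over the rounds of a test; `y` doubles from round to round. Below
`64` the probabilities `y / 2048` from Markov's inequality add up to the linear term, above `64` the
values `3 / (2 * y)` form a geometric series with sum `3 / y`. -/
theorem abortBound_rec {y P : ℝ} (hy : 0 ≤ y) (h1 : P ≤ y / 2048)
    (h2 : 64 ≤ y → P ≤ 3 / (2 * y)) : P + abortBound (2 * y) ≤ abortBound y := by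
  unfold abortBound
  split_ifs with h h' h'
  · have := h2 h'
    have e : 3 / y = 3 / (2 * y) + 3 / (2 * y) := by field_simp; norm_num
    linarith
  · have : 3 / (2 * y) ≤ 3 / 64 := div_le_div_of_nonneg_left (by norm_num) (by norm_num) h
    linarith
  · linarith
  · linarith

/-- An abort needs at least one reply, and at least `y / 4` replies, while only `y / 2048` are
expected. The first fact gives the bound for small `y`, the second one together with a Chernoff
bound the one for large `y`. -/
theorem avg_abort_le {U : Finset ι} {X : Option α} {e : ℕ} {q : ℕ}
    (hc : 2048 * #(cand d U X) ≤ q) (hq : q ≤ 2 * need d Pop t U X) :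
    avg ((1 / 2) ^ e) (cand d U X) (fun R => if Abort d Pop t U X e R then 1 else 0) +
      abortBound (2 * (q / 2 ^ e)) ≤ abortBound (q / 2 ^ e) := by
  have h0 : (0 : ℝ) ≤ (1 / 2) ^ e := by positivity
  have h1 : ((1 : ℝ) / 2) ^ e ≤ 1 := pow_le_one₀ (by norm_num) (by norm_num)
  have hp : ((1 : ℝ) / 2) ^ e = 1 / 2 ^ e := by rw [one_div_pow]
  have hcR : 2048 * (#(cand d U X) : ℝ) ≤ q := by exact_mod_cast hc
  have hqR : (q : ℝ) ≤ 2 * need d Pop t U X := by exact_mod_cast hq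
  have hpos : (0 : ℝ) < 2 ^ e := by positivity
  refine abortBound_rec (by positivity) ?_ fun hy => ?_
  · calc avg ((1 / 2) ^ e) (cand d U X) (fun R => if Abort d Pop t U X e R then 1 else 0)
        ≤ avg ((1 / 2) ^ e) (cand d U X) (fun R => (#(R.filter fun _ => True) : ℝ)) := by
          refine avg_mono h0 h1 fun R _ => ?_
          split_ifs with h
          · have := h.1.card_pos
            simp only [filter_true]
            exact_mod_cast this
          · positivity
      _ ≤ _ := by
          rw [avg_card_filter, hp, filter_true]
          rw [div_div, div_mul_eq_mul_div, div_le_div_iff₀ hpos (by positivity)]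
          nlinarith
  · set y : ℝ := q / 2 ^ e with hydef
    have hE := avg_ite_le (C := cand d U X) h0 h1 (Real.exp_pos 1).le
      (fun R => Abort d Pop t U X e R) (Real.exp (-(y / 4)))
      (fun R hR hA => by
        rw [← Real.exp_nat_mul, ← Real.exp_add]
        refine Real.one_le_exp ?_
        have : (need d Pop t U X : ℝ) ≤ 2 * #R * 2 ^ e := by exact_mod_cast hA.2
        have : y ≤ 4 * #R := by
          rw [hydef, div_le_iff₀ hpos]; linarith
        linarith) (Real.exp_pos _).le
    refine hE.trans ((mul_le_mul_of_nonneg_left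
      (mul_add_one_sub_pow_le_exp h0 h1 (Real.exp_pos 1).le _) (Real.exp_pos _).le).trans ?_)
    rw [← Real.exp_add]
    have hexp : Real.exp 1 - 1 ≤ 2 := by have := Real.exp_one_lt_d9; linarith
    have hexp0 : 0 ≤ Real.exp 1 - 1 := by have := Real.add_one_le_exp (1 : ℝ); linarith
    have hcy : (#(cand d U X) : ℝ) * (1 / 2) ^ e ≤ y / 2048 := by
      rw [hp, hydef, div_div, mul_one_div, div_le_div_iff₀ hpos (by positivity)]
      nlinarith
    -- The loss from the expected replies is at most `y / 1024`, which the step from `y / 4` to `y /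
    -- 5` absorbs.
    have h3 : -(y / 4) + #(cand d U X) * (1 / 2) ^ e * (Real.exp 1 - 1) ≤ -(y / 5) := by
      have : (#(cand d U X) : ℝ) * (1 / 2) ^ e * (Real.exp 1 - 1) ≤ y / 2048 * 2 :=
        mul_le_mul hcy hexp hexp0 (by positivity)
      linarith
    refine (Real.exp_le_exp.2 h3).trans ?_
    rw [Real.exp_neg, inv_le_comm₀ (Real.exp_pos _) (by positivity), inv_div]
    have := Real.quadratic_le_exp_of_nonneg (show 0 ≤ y / 5 by linarith)
    nlinarith

/-- Unless the test is aborted, all candidates become known and the number of open output members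
falls to `r`. An abort costs at most `8 + bigA * (harm M - harm r)` more, and its probability is at
most `abortBound`. The fixed numbers `q`, `M`, `s`, `ρ` refer to the beginning of the test, while
`U` shrinks. -/
theorem mid_le_of_likely {τ : ℝ} (hτ : 0 ≤ τ) {st : List α}
    (hX : Low d Pop t st.head?) {q r M s ρ : ℕ} (hρ : 2048 * ρ ≤ q) (hrM : r ≤ M) :
    ∀ (e : ℕ) (U : Finset ι), U ⊆ Pop → open' d Pop t U = r + #(cand d U st.head?) →
      open' d Pop t U ≤ M → surplus d Pop t U st ≤ s → #(cand d U st.head?) ≤ ρ →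
      q + #(cand d U st.head?) ≤ need d Pop t U st.head? + ρ →
      mid d Pop t τ st e U ≤ (e + 1) * τ + (bigA * harm r + bigA * harm s +
          4 * (st.countP fun x => Low d Pop t (some x))) +
        abortBound (q / 2 ^ e) * (8 + bigA * (harm M - harm r)) := by
  have hA := bigA_pos
  have hrM' := harm_mono hrM
  have hG : 0 ≤ 8 + bigA * (harm M - harm r) := by
    have : 0 ≤ bigA * (harm M - harm r) := mul_nonneg hA.le (by linarith)
    linarith
  have hr0 : 0 ≤ bigA * harm r := mul_nonneg hA.le (harm_nonneg _)
  have hs0 : 0 ≤ bigA * harm s := mul_nonneg hA.le (harm_nonneg _)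
  intro e
  induction e with
  | zero =>
    intro U hU ho hM hs hc hq
    rw [mid, filter_not_low_eq_empty hX Subset.rfl]
    have hab := abortBound_nonneg (show (0 : ℝ) ≤ q / 2 ^ 0 by positivity)
    have hab2 := mul_nonneg hab hG
    split_ifs with hf
    · simp only [card_empty, Nat.cast_zero, zero_add, one_mul, add_zero]
      have : (0 : ℝ) ≤ 4 * (st.countP fun x => Low d Pop t (some x)) := by positivity
      linarith
    -- Popping a low threshold releases `4`: it pays `1` for announcing the next one and `3` for the
    -- constant in `base`.
    · have h1 : start d Pop t (U \ cand d U st.head?) st.tail + 1 ≤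
          bigA * harm r + bigA * harm s + 4 * (st.countP fun x => Low d Pop t (some x)) := by
        cases st with
        | nil => exact absurd (Or.inl rfl) hf
        | cons x st =>
          refine (add_le_add_left (start_le_base _ _) 1).trans ?_
          have h2 := open'_sdiff_of_low hX (Subset.refl (cand d U (x :: st).head?))
          have h3 : open' d Pop t (U \ cand d U (x :: st).head?) = r := by omega
          have h4 := surplus_mono (d := d) (Pop := Pop) (t := t)
            (sdiff_subset : U \ cand d U (x :: st).head? ⊆ U) st
          rw [surplus_cons_of_low hX] at hs
          have h5 := mul_le_mul_of_nonneg_left (harm_mono (h4.trans hs)) hA.le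
          have hx : Low d Pop t (some x) := hX
          simp only [base, h3, List.tail_cons, List.countP_cons, hx, decide_true, if_true]
          push_cast
          linarith
      simp only [card_empty, Nat.cast_zero, zero_add, one_mul, add_zero]
      linarith
  | succ e ih =>
    intro U hU ho hM hs hc hq
    have h0 : (0 : ℝ) ≤ (1 / 2) ^ (e + 1) := by positivity
    have h1 : ((1 : ℝ) / 2) ^ (e + 1) ≤ 1 := pow_le_one₀ (by norm_num) (by norm_num)
    have hab := avg_abort_le (d := d) (Pop := Pop) (t := t) (U := U) (X := st.head?) (e := e + 1)
      (q := q) (by omega) (by omega)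
    rw [mid]
    set Y : ℝ := bigA * harm r + bigA * harm s +
          4 * (st.countP fun x => Low d Pop t (some x)) with hY
    set G : ℝ := 8 + bigA * (harm M - harm r) with hGdef
    calc _ ≤ avg ((1 / 2) ^ (e + 1)) (cand d U st.head?) (fun R =>
          ((e + 1 + 1) * τ + Y + abortBound (q / 2 ^ e) * G) +
            G * if Abort d Pop t U st.head? (e + 1) R then 1 else 0) := by
          refine avg_mono h0 h1 fun R hR => ?_
          have hb := mul_nonneg
            (abortBound_nonneg (show (0 : ℝ) ≤ q / 2 ^ e by positivity)) hG
          rw [filter_not_low_eq_empty hX hR]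
          have he : (0 : ℝ) ≤ (e + 1) * τ := by positivity
          split_ifs with hAb
          -- The `8` consists of `4` for the new low threshold, `1` for its announcement and the
          -- constant `3` in `base`.
          · have h2 := start_push_le (Pop := Pop) (t := t) hR hAb.1
            have h3 : base d Pop t U st ≤ Y + bigA * (harm M - harm r) + 3 := by
              have e1 := mul_le_mul_of_nonneg_left (harm_mono hM) hA.le
              have e2 := mul_le_mul_of_nonneg_left (harm_mono hs) hA.le
              unfold base
              rw [hY]
              linarith
            simp only [card_empty, Nat.cast_zero, mul_one]
            linarith
          · have h2 := open'_sdiff_of_low hX hR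
            have h3 := card_cand_sdiff hR
            have h4 := need_sdiff (t := t) hU hR
            have h5 := surplus_mono (d := d) (Pop := Pop) (t := t)
              (sdiff_subset : U \ R ⊆ U) st
            have := ih (U \ R) (sdiff_subset.trans hU) (by omega) (by omega) (by omega)
              (by omega) (by omega)
            simp only [card_empty, Nat.cast_zero, mul_zero]
            linarith
      _ ≤ _ := by
          rw [avg_add, avg_const, avg_const_mul]
          have e1 : (q : ℝ) / 2 ^ e = 2 * (q / 2 ^ (e + 1)) := by rw [pow_succ]; field_simp
          rw [e1]
          have := mul_le_mul_of_nonneg_right hab hG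
          push_cast
          linarith

end test

end Monitoring

end

noncomputable section

namespace Monitoring

open Finset

/-! ### Bounds for arbitrary thresholds, and the gain from a single reply -/

section test

set_option linter.unusedSectionVars false

variable {α : Type*} [LinearOrder α] {ι : Type*} [DecidableEq ι]
  {d : ι → α} {Pop : Finset ι} {t : ℕ}

/-- Bound for the number of superfluous replies in the rounds that remain. -/
def extra (d : ι → α) (Pop : Finset ι) (t : ℕ) (X : Option α) (e : ℕ) (U : Finset ι) : ℝ :=
  if Low d Pop t X then 0 else #(cand d U X) / 2 ^ e + 14

/-- Under a high threshold there are at least as many candidates as needed. Without an abort at most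
half of the expected number replied, and a Chernoff bound with `z = 1 / 2` gives the rate `(1 - log
2) / 2 > 0.15`. -/
theorem avg_not_abort_le {U : Finset ι} (hU : U ⊆ Pop) {X : Option α} (hX : ¬ Low d Pop t X)
    (e : ℕ) :
    avg ((1 / 2) ^ e) (cand d U X) (fun R => if Abort d Pop t U X e R then 0 else 1) ≤
      Real.exp (-(0.15 * (#(cand d U X) / 2 ^ e))) := by
  have h0 : (0 : ℝ) ≤ (1 / 2) ^ e := by positivity
  have h1 : ((1 : ℝ) / 2) ^ e ≤ 1 := pow_le_one₀ (by norm_num) (by norm_num)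
  have hp : ((1 : ℝ) / 2) ^ e = 1 / 2 ^ e := by rw [one_div_pow]
  have hpos : (0 : ℝ) < 2 ^ e := by positivity
  have hlog := Real.log_two_lt_d9
  have hlog0 := Real.log_two_gt_d9
  set y : ℝ := #(cand d U X) / 2 ^ e with hy
  have hy0 : 0 ≤ y := by positivity
  have hE := avg_ite_le (C := cand d U X) h0 h1 (z := 1 / 2) (by norm_num)
    (fun R => ¬ Abort d Pop t U X e R) (Real.exp (Real.log 2 * (y / 2)))
    (fun R hR hA => by
      have hz : ((1 : ℝ) / 2) ^ #R = Real.exp (-(Real.log 2 * #R)) := by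
        rw [Real.exp_neg, mul_comm, Real.exp_nat_mul, Real.exp_log (by norm_num), one_div,
          inv_pow]
      rw [hz, ← Real.exp_add]
      refine Real.one_le_exp ?_
      have : (#R : ℝ) ≤ y / 2 := by
        rcases R.eq_empty_or_nonempty with rfl | hne
        · simp; positivity
        · have h2 : 2 * #R * 2 ^ e < need d Pop t U X := by
            by_contra hc
            exact hA ⟨hne, not_lt.1 hc⟩
          have h3 := h2.le.trans (need_le_card_cand hU hX)
          have h3' : 2 * (#R : ℝ) * 2 ^ e ≤ #(cand d U X) := by exact_mod_cast h3
          rw [hy, div_div, le_div_iff₀ (by positivity)]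
          linarith
      nlinarith) (Real.exp_pos _).le
  simp only [ite_not] at hE
  refine hE.trans ((mul_le_mul_of_nonneg_left
    (mul_add_one_sub_pow_le_exp h0 h1 (by norm_num) _) (Real.exp_pos _).le).trans ?_)
  rw [← Real.exp_add, Real.exp_le_exp]
  have : (#(cand d U X) : ℝ) * (1 / 2) ^ e = y := by rw [hp, hy]; ring
  rw [this]
  nlinarith

/-- Upper bound for `mid` which does not use that pivots make progress. -/
def crude (d : ι → α) (Pop : Finset ι) (t : ℕ) (τ : ℝ) (st : List α) (e : ℕ) (U : Finset ι) : ℝ :=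
  base d Pop t U st + 5 + (e + 1) * τ + extra d Pop t st.head? e U

/-- The bound on one round used in the induction. -/
def roundBound (d : ι → α) (Pop : Finset ι) (t : ℕ) (τ : ℝ) (st : List α) (e : ℕ) (U R : Finset ι) :
    ℝ :=
  base d Pop t U st + 5 + (e + 1 + 1) * τ + (#(R.filter fun i => ¬ Low d Pop t (some (d i))) +
    (if Low d Pop t st.head? then (0 : ℝ) else 2 * ((#(cand d U st.head?) : ℝ) / 2 ^ (e + 1)) + 14) *
      if Abort d Pop t U st.head? (e + 1) R then 0 else 1)

/-- With `x` replies expected, the current round wastes at most `x` of them. The later rounds can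
waste `2 * x + 14` in expectation, but they take place only if there is no abort, which is
exponentially unlikely in `x`. Hence the constant `14` reproduces itself. -/
theorem avg_roundBound_le {τ : ℝ} {st : List α} {U : Finset ι} (hU : U ⊆ Pop) (e : ℕ) :
    avg ((1 / 2) ^ (e + 1)) (cand d U st.head?) (roundBound d Pop t τ st e U) ≤
      crude d Pop t τ st (e + 1) U := by
  have h0 : (0 : ℝ) ≤ (1 / 2) ^ (e + 1) := by positivity
  have hp : ((1 : ℝ) / 2) ^ (e + 1) = 1 / 2 ^ (e + 1) := by rw [one_div_pow]
  have heq : avg ((1 / 2) ^ (e + 1)) (cand d U st.head?) (roundBound d Pop t τ st e U) =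
      base d Pop t U st + 5 + (e + 1 + 1) * τ + ((1 / 2) ^ (e + 1) *
        #((cand d U st.head?).filter fun i => ¬ Low d Pop t (some (d i))) +
      (if Low d Pop t st.head? then (0 : ℝ) else 2 * ((#(cand d U st.head?) : ℝ) / 2 ^ (e + 1)) + 14) *
        avg ((1 / 2) ^ (e + 1)) (cand d U st.head?)
          (fun R => if Abort d Pop t U st.head? (e + 1) R then 0 else 1)) := by
    unfold roundBound
    rw [avg_add, avg_const, avg_add, avg_const_mul, avg_card_filter]
  rw [heq, crude, extra]
  push_cast
  split_ifs with hX
  · rw [filter_not_low_eq_empty hX Subset.rfl]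
    simp
  · have h1 := avg_not_abort_le hU hX (e + 1)
    set x : ℝ := #(cand d U st.head?) / 2 ^ (e + 1) with hx
    have hx0 : 0 ≤ x := by positivity
    have h2 : (1 / 2 : ℝ) ^ (e + 1) *
        #((cand d U st.head?).filter fun i => ¬ Low d Pop t (some (d i))) ≤ x := by
      rw [hp, hx, one_div_mul_eq_div]
      gcongr
      exact filter_subset _ _
    -- From `1 + 0.15 * x ≤ exp (0.15 * x)` and `14 * 0.15 ≥ 2`.
    have h3 : (2 * x + 14) * Real.exp (-(0.15 * x)) ≤ 14 := by
      rw [Real.exp_neg, ← div_eq_mul_inv, div_le_iff₀ (Real.exp_pos _)]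
      have := Real.add_one_le_exp (0.15 * x)
      nlinarith
    have h4 := mul_le_mul_of_nonneg_left h1 (show 0 ≤ 2 * x + 14 by linarith)
    linarith

theorem mid_zero_le {τ : ℝ} (st : List α) (U : Finset ι) (hU : U ⊆ Pop) :
    mid d Pop t τ st 0 U ≤ crude d Pop t τ st 0 U := by
  have hA := bigA_pos
  have hb : 0 ≤ base d Pop t U st := by
    have := mul_nonneg hA.le (harm_nonneg (open' d Pop t U))
    have := mul_nonneg hA.le (harm_nonneg (surplus d Pop t U st))
    unfold base; positivity
  rw [mid, crude, extra]
  by_cases hX : Low d Pop t st.head?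
  · rw [filter_not_low_eq_empty hX Subset.rfl, if_pos hX]
    split_ifs
    · simp; linarith
    · have := (start_le_base (d := d) (Pop := Pop) (t := t)
        (U \ cand d U st.head?) st.tail).trans ((base_mono sdiff_subset _).trans
          (base_tail_le U st hX))
      simp; linarith
  · rw [if_pos (final_of_not_low hU hX), if_neg hX]
    have : (#((cand d U st.head?).filter fun i => ¬ Low d Pop t (some (d i))) : ℝ) ≤
        #(cand d U st.head?) := by exact_mod_cast card_filter_le _ _
    simp; linarith

theorem roundBound_of_abort {τ : ℝ} (hτ : 0 ≤ τ) {st : List α} {U R : Finset ι} {e : ℕ}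
    (hA : Abort d Pop t U st.head? (e + 1) R) :
    base d Pop t U st + 5 + τ + #(R.filter fun i => ¬ Low d Pop t (some (d i))) ≤
      roundBound d Pop t τ st e U R := by
  rw [roundBound, if_pos hA]
  have : 0 ≤ (e + 1 : ℝ) * τ := by positivity
  linarith

theorem roundBound_of_not_abort {τ : ℝ} {st : List α} {U R : Finset ι} {e : ℕ}
    (hA : ¬ Abort d Pop t U st.head? (e + 1) R) :
    crude d Pop t τ st e (U \ R) + τ + #(R.filter fun i => ¬ Low d Pop t (some (d i))) ≤
      roundBound d Pop t τ st e U R := by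
  rw [roundBound, if_neg hA, crude, extra]
  have h1 := base_mono (d := d) (Pop := Pop) (t := t) (sdiff_subset : U \ R ⊆ U) st
  split_ifs
  · linarith
  · have h2 : (#(cand d (U \ R) st.head?) : ℝ) ≤ #(cand d U st.head?) := by
      rw [cand_sdiff]
      exact_mod_cast card_le_card sdiff_subset
    have h3 : (#(cand d (U \ R) st.head?) : ℝ) / 2 ^ e ≤
        2 * (#(cand d U st.head?) / 2 ^ (e + 1)) := by
      have : 2 * ((#(cand d U st.head?) : ℝ) / 2 ^ (e + 1)) = #(cand d U st.head?) / 2 ^ e := by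
        rw [pow_succ]; field_simp
      rw [this]
      gcongr
    linarith

/-- Whatever the outcome, a test raises the potential by at most a constant: `4` for a new
threshold, `1` for its announcement, at most `(e + 1) * τ` for the rounds, and the superfluous
replies. The progress made by pivots has to compensate for this. -/
theorem mid_le_crude {τ : ℝ} (hτ : 0 ≤ τ) (st : List α) :
    ∀ (e : ℕ) (U : Finset ι), U ⊆ Pop → mid d Pop t τ st e U ≤ crude d Pop t τ st e U
  | 0, U, hU => mid_zero_le st U hU
  | e + 1, U, hU => by
    have h0 : (0 : ℝ) ≤ (1 / 2) ^ (e + 1) := by positivity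
    have h1 : ((1 : ℝ) / 2) ^ (e + 1) ≤ 1 := pow_le_one₀ (by norm_num) (by norm_num)
    rw [mid]
    refine (avg_mono h0 h1 fun R hR => ?_).trans (avg_roundBound_le hU e)
    split_ifs with hA
    · have h2 := start_push_le (Pop := Pop) (t := t) hR hA.1
      have := roundBound_of_abort hτ hA
      linarith
    · have h2 := mid_le_crude hτ st e (U \ R) (sdiff_subset.trans hU)
      have := roundBound_of_not_abort (τ := τ) hA
      linarith

/-- What is gained if `v` is the only member to reply. -/
def gain (d : ι → α) (Pop : Finset ι) (t : ℕ) (U : Finset ι) (st : List α) (v : ι) : ℝ :=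
  base d Pop t U st + 4 - start d Pop t (U \ {v}) (d v :: st)

theorem push_singleton (v : ι) (st : List α) : push (({v} : Finset ι).image d) st = d v :: st := by
  obtain ⟨w, hw, e⟩ := exists_push_eq (d := d) (singleton_nonempty v) st
  rw [e, mem_singleton.1 hw]

theorem gain_nonneg {U : Finset ι} {st : List α} {v : ι} (hv : v ∈ cand d U st.head?) :
    0 ≤ gain d Pop t U st v := by
  have := start_push_le (d := d) (Pop := Pop) (t := t) (singleton_subset_iff.2 hv)
    (singleton_nonempty v)
  rw [push_singleton] at this
  unfold gain
  linarith

/-- When so little is needed that one reply causes an abort, a lone reply makes a uniformly random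
candidate the pivot. -/
theorem mid_le_crude_sub_of_eq {τ : ℝ} (hτ : 0 ≤ τ) {st : List α} {e : ℕ} {U : Finset ι}
    (hU : U ⊆ Pop) (hq : need d Pop t U st.head? ≤ 2 * 2 ^ (e + 1)) :
    mid d Pop t τ st (e + 1) U ≤ crude d Pop t τ st (e + 1) U -
      (1 / 2) ^ (e + 1) * (1 - (1 / 2) ^ (e + 1)) ^ (#(cand d U st.head?) - 1) *
        ∑ v ∈ cand d U st.head?, gain d Pop t U st v := by
  have h0 : (0 : ℝ) ≤ (1 / 2) ^ (e + 1) := by positivity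
  have h1 : ((1 : ℝ) / 2) ^ (e + 1) ≤ 1 := pow_le_one₀ (by norm_num) (by norm_num)
  refine le_trans ?_ (sub_le_sub_right (avg_roundBound_le (t := t) (τ := τ) hU e) _)
  rw [mid]
  refine avg_le_sub_singleton h0 h1 _ (fun R hR => ?_) fun v hv => ?_
  · split_ifs with hA
    · have h2 := start_push_le (Pop := Pop) (t := t) hR hA.1
      have := roundBound_of_abort hτ hA
      linarith
    · have h2 := mid_le_crude (d := d) (Pop := Pop) (t := t) hτ st e (U \ R) (sdiff_subset.trans hU)
      have := roundBound_of_not_abort (τ := τ) hA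
      linarith
  · have hA : Abort d Pop t U st.head? (e + 1) {v} := ⟨singleton_nonempty v, by simpa using hq⟩
    rw [if_pos hA, push_singleton]
    have := roundBound_of_abort hτ hA
    unfold gain
    linarith

/-- The gain available at exponent `e₀` is kept if nobody replies at the larger exponents; by
Bernoulli's inequality in each round this has probability at least one minus `#(cand ..)` times the
sum of the reply probabilities. -/
theorem mid_le_crude_sub {τ : ℝ} (hτ : 0 ≤ τ) {st : List α} {e₀ : ℕ} {U : Finset ι}
    (hU : U ⊆ Pop) {Q : ℝ} (hQ : 0 ≤ Q)
    (h : mid d Pop t τ st e₀ U ≤ crude d Pop t τ st e₀ U - Q)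
    (hρ : #(cand d U st.head?) ≤ 2 ^ e₀) (e : ℕ) (he : e₀ ≤ e) :
    mid d Pop t τ st e U ≤ crude d Pop t τ st e U -
      (1 - #(cand d U st.head?) * ((1 / 2) ^ e₀ - (1 / 2) ^ e)) * Q := by
  induction e, he using Nat.le_induction with
  | base => simpa using h
  | succ e he ih =>
    have h0 : (0 : ℝ) ≤ (1 / 2) ^ (e + 1) := by positivity
    have h1 : ((1 : ℝ) / 2) ^ (e + 1) ≤ 1 := pow_le_one₀ (by norm_num) (by norm_num)
    set ρ := #(cand d U st.head?) with hρdef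
    have hge : ((1 : ℝ) / 2) ^ e ≤ (1 / 2) ^ e₀ :=
      pow_le_pow_of_le_one (by norm_num) (by norm_num) he
    -- Bernoulli's inequality for the probability of a silent round.
    have hpe : (1 : ℝ) - ρ * (1 / 2) ^ (e + 1) ≤ (1 - (1 / 2) ^ (e + 1)) ^ ρ := by
      have := one_add_mul_le_pow (show (-2 : ℝ) ≤ -(1 / 2) ^ (e + 1) by linarith) ρ
      simpa [sub_eq_add_neg] using this
    set a : ℝ := 1 - ρ * ((1 / 2) ^ e₀ - (1 / 2) ^ e) with ha
    have hρ1 : (ρ : ℝ) * (1 / 2) ^ e₀ ≤ 1 := by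
      rw [one_div_pow, mul_one_div, div_le_one (by positivity)]
      exact_mod_cast hρ
    have ha0 : 0 ≤ a := by
      have : 0 ≤ (ρ : ℝ) * (1 / 2) ^ e := by positivity
      rw [ha]; nlinarith
    have ha1 : a ≤ 1 := by
      have : 0 ≤ (ρ : ℝ) * ((1 / 2) ^ e₀ - (1 / 2) ^ e) :=
        mul_nonneg (by positivity) (by linarith)
      linarith
    have key : mid d Pop t τ st (e + 1) U ≤ crude d Pop t τ st (e + 1) U -
        (1 - (1 / 2) ^ (e + 1)) ^ ρ * (a * Q) := by
      refine le_trans ?_ (sub_le_sub_right (avg_roundBound_le (t := t) (τ := τ) hU e) _)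
      rw [mid]
      refine avg_le_sub_empty h0 h1 _ (fun R hR => ?_) ?_
      · split_ifs with hA
        · have h2 := start_push_le (Pop := Pop) (t := t) hR hA.1
          have := roundBound_of_abort hτ hA
          linarith
        · have h2 := mid_le_crude (d := d) (Pop := Pop) (t := t) hτ st e (U \ R) (sdiff_subset.trans hU)
          have := roundBound_of_not_abort (τ := τ) hA
          linarith
      · have hA : ¬ Abort d Pop t U st.head? (e + 1) ∅ := fun h => by simpa using h.1
        rw [if_neg hA]
        have := roundBound_of_not_abort (τ := τ) hA
        simp only [sdiff_empty] at this ⊢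
        linarith
    refine key.trans (sub_le_sub_left ?_ _)
    rw [← mul_assoc]
    refine mul_le_mul_of_nonneg_right ?_ hQ
    have h5 : (1 : ℝ) - ρ * (1 / 2) ^ (e + 1) ≥ 1 - 1 := by
      have : (ρ : ℝ) * (1 / 2) ^ (e + 1) ≤ ρ * (1 / 2) ^ e₀ := by
        gcongr ?_ * ?_
        exact pow_le_pow_of_le_one (by norm_num) (by norm_num) (by omega)
      linarith
    have h6 : (1 - (ρ : ℝ) * (1 / 2) ^ (e + 1)) * a ≤ (1 - (1 / 2) ^ (e + 1)) ^ ρ * a :=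
      mul_le_mul_of_nonneg_right hpe ha0
    have h7 : 0 ≤ (ρ : ℝ) * (1 / 2) ^ (e + 1) := by positivity
    have h8 : ((1 : ℝ) / 2) ^ e = 2 * (1 / 2) ^ (e + 1) := by rw [pow_succ]; ring
    have h9 : 1 - (ρ : ℝ) * ((1 / 2) ^ e₀ - (1 / 2) ^ (e + 1)) = a - ρ * (1 / 2) ^ (e + 1) := by
      rw [ha, h8]; ring
    rw [h9]
    nlinarith

/-- The exponent for which a single reply has constant probability and a second one, or an earlier
one, is unlikely. -/
theorem exists_exponent {ρ E : ℕ} (hρ : 0 < ρ) (hE : 4096 * ρ ≤ 2 ^ E) :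
    ∃ e, e + 1 ≤ E ∧ 2048 * ρ ≤ 2 ^ (e + 1) ∧ 2 ^ (e + 1) ≤ 4096 * ρ := by
  have h1 : 1 < 2048 * ρ := by omega
  have h2 := Nat.le_pow_clog (b := 2) (by norm_num) (2048 * ρ)
  have h3 : 2 ^ (Nat.clog 2 (2048 * ρ)).pred < 2048 * ρ :=
    Nat.pow_pred_clog_lt_self (by norm_num) h1
  have h4 : 0 < Nat.clog 2 (2048 * ρ) := Nat.clog_pos (by norm_num) h1
  obtain ⟨e, he⟩ : ∃ e, Nat.clog 2 (2048 * ρ) = e + 1 := ⟨_, (Nat.succ_pred_eq_of_pos h4).symm⟩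
  rw [he] at h2 h3
  simp only [Nat.pred_succ] at h3
  have h5 : 2 ^ (e + 1) ≤ 4096 * ρ := by rw [pow_succ]; omega
  refine ⟨e, ?_, h2, h5⟩
  by_contra hc
  have h6 : 2 ^ E ≤ 2 ^ e := Nat.pow_le_pow_right (by norm_num) (by omega)
  omega

/-- At the chosen exponent `p`, the product of reply probability and total gain is at least `2 ^ 18
/ 4096 = 64`. Silence before and silence of the others cost a factor of at least `3 / 4` each, so
that `36` remains, more than the at most `21` lost in `mid_le_crude`. -/
theorem mid_le_base_of_gain {τ : ℝ} (hτ : 0 ≤ τ) {st : List α} {U : Finset ι} {E : ℕ}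
    (hU : U ⊆ Pop) (hE : 4096 * #U ≤ 2 ^ E) (hτE : (E + 1) * τ ≤ 1)
    (hpos : 0 < #(cand d U st.head?))
    (hneed : need d Pop t U st.head? ≤ 2048 * #(cand d U st.head?))
    (hgain : 2 ^ 18 * (#(cand d U st.head?) : ℝ) ≤
      ∑ v ∈ cand d U st.head?, gain d Pop t U st v) :
    mid d Pop t τ st E U ≤ base d Pop t U st := by
  set ρ := #(cand d U st.head?) with hρ
  have hρU : ρ ≤ #U := card_le_card (cand_subset _ _)
  obtain ⟨e, he, he1, he2⟩ := exists_exponent hpos (hE.trans' (Nat.mul_le_mul_left _ hρU))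
  have h1 := mid_le_crude_sub_of_eq (d := d) (Pop := Pop) (t := t) hτ (e := e) hU (st := st)
    (hneed.trans (by omega))
  set p : ℝ := (1 / 2) ^ (e + 1) with hp
  have hp0 : 0 ≤ p := by positivity
  have hp1 : p ≤ 1 := pow_le_one₀ (by norm_num) (by norm_num)
  have hp' : p = 1 / 2 ^ (e + 1) := by rw [hp, one_div_pow]
  have hρp : (ρ : ℝ) * p ≤ 1 / 2048 := by
    have : (2048 * ρ : ℝ) ≤ 2 ^ (e + 1) := by exact_mod_cast he1
    rw [hp', mul_one_div, div_le_div_iff₀ (by positivity) (by norm_num)]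
    linarith
  have hpρ : 1 ≤ 4096 * ρ * p := by
    have : (2 : ℝ) ^ (e + 1) ≤ 4096 * ρ := by exact_mod_cast he2
    rw [hp', mul_one_div, le_div_iff₀ (by positivity)]
    linarith
  have hb : (3 : ℝ) / 4 ≤ (1 - p) ^ (ρ - 1) := by
    have h2 := one_add_mul_le_pow (show (-2 : ℝ) ≤ -p by linarith) (ρ - 1)
    have h3 : (((ρ - 1 : ℕ) : ℝ)) * p ≤ ρ * p := by
      gcongr
      omega
    rw [← sub_eq_add_neg] at h2
    linarith
  set S := ∑ v ∈ cand d U st.head?, gain d Pop t U st v with hS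
  have hS0 : 0 ≤ S := sum_nonneg fun v hv => gain_nonneg hv
  have hQ : 0 ≤ p * (1 - p) ^ (ρ - 1) * S :=
    mul_nonneg (mul_nonneg hp0 (pow_nonneg (by linarith) _)) hS0
  have h2 := mid_le_crude_sub hτ hU hQ h1 (hρ ▸ (by omega : ρ ≤ 2 ^ (e + 1))) E he
  have hEpos : (0 : ℝ) ≤ (1 / 2) ^ E := by positivity
  have hfac : (3 : ℝ) / 4 ≤ 1 - ρ * (p - (1 / 2) ^ E) := by
    have : 0 ≤ (ρ : ℝ) * (1 / 2) ^ E := by positivity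
    linarith
  -- The number `21` is `5` from `crude`, `1` for the rounds and `15` for superfluous replies.
  have h3 : (21 : ℝ) ≤ (1 - ρ * (p - (1 / 2) ^ E)) * (p * (1 - p) ^ (ρ - 1) * S) := by
    have e1 : 64 ≤ p * S := by
      have := mul_le_mul_of_nonneg_left hgain hp0
      linarith
    have e2 : 3 / 4 * 64 ≤ (1 - p) ^ (ρ - 1) * (p * S) :=
      mul_le_mul hb e1 (by norm_num) (by linarith)
    have e3 : p * (1 - p) ^ (ρ - 1) * S = (1 - p) ^ (ρ - 1) * (p * S) := by ring
    rw [e3]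
    have e4 : 3 / 4 * (3 / 4 * 64) ≤ (1 - ρ * (p - (1 / 2) ^ E)) * ((1 - p) ^ (ρ - 1) * (p * S)) :=
      mul_le_mul hfac e2 (by norm_num) (by linarith)
    linarith
  have h4 : extra d Pop t st.head? E U ≤ 15 := by
    unfold extra
    split_ifs
    · norm_num
    · have : (#(cand d U st.head?) : ℝ) / 2 ^ E ≤ 1 := by
        rw [div_le_one (by positivity)]
        have : ρ ≤ 2 ^ E := by omega
        exact_mod_cast this
      linarith
  have h5 : crude d Pop t τ st E U ≤ base d Pop t U st + 21 := by
    unfold crude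
    linarith
  linarith

end test

end Monitoring

end

noncomputable section

namespace Monitoring

open Finset

/-! ### Random pivots make progress: a test does not increase the potential -/

section test

set_option linter.unusedSectionVars false

variable {α : Type*} [LinearOrder α] {ι : Type*} [DecidableEq ι]
  {d : ι → α} {Pop : Finset ι} {t : ℕ}

/-- Lower bound for the gain if the only member to reply is to be output, where `r` members
have smaller items. -/
def lowGain (u r : ℕ) : ℝ := if 2048 * r + 1 ≤ u then bigA / 2 * ((r + 1) / u) else 0

theorem lowGain_nonneg (u r : ℕ) : 0 ≤ lowGain u r := by
  have := bigA_pos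
  unfold lowGain
  split_ifs <;> positivity

/-- About `u / 2048` positions `r` contribute `bigA / 2 * (r + 1) / u` each, in total at least `bigA
* u / 2 ^ 24`. This is where `bigA = 2 ^ 42` comes from. -/
theorem sum_lowGain_ge {u N : ℕ} (hN : u < 2048 * N + 1) :
    2 ^ 18 * (u : ℝ) ≤ ∑ r ∈ range N, lowGain u r := by
  rcases Nat.eq_zero_or_pos u with rfl | hu
  · simpa using sum_nonneg fun r _ => lowGain_nonneg 0 r
  -- The number of `r` with `2048 * r + 1 ≤ u`.
  set w := (u - 1) / 2048 + 1 with hw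
  have hwN : w ≤ N := by omega
  have hu' : (0 : ℝ) < u := by exact_mod_cast hu
  have h1 : ∑ r ∈ range w, lowGain u r ≤ ∑ r ∈ range N, lowGain u r :=
    sum_le_sum_of_subset_of_nonneg (range_mono hwN) fun r _ _ => lowGain_nonneg u r
  have h2 : ∑ r ∈ range w, lowGain u r = bigA / 2 / u * ∑ r ∈ range w, ((r : ℝ) + 1) := by
    rw [mul_sum]
    refine sum_congr rfl fun r hr => ?_
    have := mem_range.1 hr
    rw [lowGain, if_pos (by omega)]
    ring
  have h3 : ∀ k : ℕ, ∑ r ∈ range k, ((r : ℝ) + 1) = k * (k + 1) / 2 := by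
    intro k
    induction k with
    | zero => simp
    | succ k ih => rw [sum_range_succ, ih]; push_cast; ring
  have h4 : (u : ℝ) ≤ 2048 * w := by
    have : u ≤ 2048 * w := by omega
    exact_mod_cast this
  refine le_trans ?_ h1
  rw [h2, h3, bigA, div_div, div_mul_eq_mul_div, le_div_iff₀ (by positivity)]
  nlinarith

/-- A low pivot with few open members below it is a threshold that is likely to be passed and brings
a discount; its own reply moreover lowers the number of open members by one. Both together give a
harmonic difference over `r + 1` terms. -/
theorem gain_of_low (hd : Function.Injective d) {U : Finset ι} (hU : U ⊆ Pop) {st : List α}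
    {v : ι} (hv : v ∈ U) (hl : Low d Pop t (some (d v))) :
    lowGain (open' d Pop t U) #(U.filter fun w => d w < d v) ≤ gain d Pop t U st v := by
  have hA := bigA_pos
  set r := #(U.filter fun w => d w < d v) with hr
  have hUv : U \ {v} ⊆ Pop := sdiff_subset.trans hU
  have ho : open' d Pop t (U \ {v}) + 1 = open' d Pop t U := by
    rw [← open'_sdiff_add (singleton_subset_iff.2 hv), filter_singleton, if_pos hl, card_singleton]
  have hs := harm_mono (surplus_mono (d := d) (Pop := Pop) (t := t)
    (sdiff_subset : U \ {v} ⊆ U) st)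
  have hc : #(cand d (U \ {v}) (some (d v))) = r := by
    rw [hr]
    congr 1
    ext i
    simp only [cand, mem_filter, mem_sdiff, mem_singleton, upTo_some]
    constructor
    · rintro ⟨⟨h1, h2⟩, h3⟩
      exact ⟨h1, lt_of_le_of_ne h3 fun h => h2 (hd h)⟩
    · rintro ⟨h1, h2⟩
      exact ⟨⟨h1, by rintro rfl; exact lt_irrefl _ h2⟩, h2.le⟩
  have hn := open'_le_need hUv hl
  set u := open' d Pop t U with hu
  have hu1 : open' d Pop t (U \ {v}) = u - 1 := by omega
  rw [hu1] at hn
  have hstep := harm_mono (Nat.sub_le u 1)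
  have hs' := mul_le_mul_of_nonneg_left hs hA.le
  have hgain : bigA * (harm u - harm (u - 1)) + disc d Pop t (U \ {v}) (d v :: st) ≤
      gain d Pop t U st v := by
    unfold gain start base
    rw [surplus_cons_of_low hl, hu1, List.countP_cons]
    simp only [hl, decide_true, if_true]
    push_cast
    linarith
  refine le_trans ?_ hgain
  have hdisc := disc_nonneg (d := d) (Pop := Pop) (t := t) (U \ {v}) (d v :: st)
  unfold lowGain
  split_ifs with hcond
  -- The discount applies since the need at a low threshold is at least the number of open members.
  · have hdisc' : disc d Pop t (U \ {v}) (d v :: st) =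
        bigA / 2 * (harm (u - 1) - harm (u - 1 - r)) := by
      unfold disc
      rw [if_pos, List.head?_cons, hc, hu1]
      rw [List.head?_cons, hc]
      exact ⟨hl, by omega⟩
    have h1 := harm_sub_ge (show u - 1 - r ≤ u by omega)
    have h2 : ((u : ℝ) - (u - 1 - r : ℕ)) = r + 1 := by
      rw [Nat.cast_sub (by omega), Nat.cast_sub (by omega)]
      push_cast; ring
    rw [h2] at h1
    have h3 := mul_le_mul_of_nonneg_left h1 (show 0 ≤ bigA / 2 by linarith)
    have h4 := mul_le_mul_of_nonneg_left hstep hA.le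
    rw [hdisc']
    linarith
  · have := mul_le_mul_of_nonneg_left hstep hA.le
    linarith

/-- A superfluous pivot in the lower half of the surplus leaves less than half of it, which lowers
its harmonic number by at least `1 / 2`. -/
theorem gain_of_not_low (hd : Function.Injective d) {U : Finset ι} {st : List α}
    (hX : ¬ Low d Pop t st.head?) {v : ι} (hv : v ∈ cand d U st.head?)
    (hl : ¬ Low d Pop t (some (d v))) :
    (if 2 * #(((cand d U st.head?).filter fun i => ¬ Low d Pop t (some (d i))).filter
        fun w => d w < d v) + 1 ≤
          #((cand d U st.head?).filter fun i => ¬ Low d Pop t (some (d i)))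
      then bigA / 2 else 0) ≤ gain d Pop t U st v := by
  have hA := bigA_pos
  split_ifs with hcond
  swap
  · exact gain_nonneg hv
  set N := (cand d U st.head?).filter fun i => ¬ Low d Pop t (some (d i)) with hN
  set r := #(N.filter fun w => d w < d v) with hr
  have hb : surplus d Pop t U st = #N := by
    rw [surplus, find?_of_not_low_head hX, hN, cand, filter_filter]
    congr 1
    ext i
    simp only [mem_filter]
    tauto
  have hb' : surplus d Pop t (U \ {v}) (d v :: st) = r := by
    rw [surplus_cons_of_not_low hl, hr, hN]
    congr 1
    ext i
    simp only [cand, mem_filter, mem_sdiff, mem_singleton]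
    constructor
    · rintro ⟨⟨h1, h2⟩, h3, h4⟩
      exact ⟨⟨⟨h1, (mem_filter.1 hv).2.mono h4⟩, h3⟩, lt_of_le_of_ne h4 fun h => h2 (hd h)⟩
    · rintro ⟨⟨⟨h1, _⟩, h3⟩, h4⟩
      exact ⟨⟨h1, by rintro rfl; exact lt_irrefl _ h4⟩, h3, h4.le⟩
  have h1 := harm_mono (open'_mono (d := d) (Pop := Pop) (t := t) (sdiff_subset : U \ {v} ⊆ U))
  have h2 := harm_sub_ge (show r ≤ #N by omega)
  have h3 : (1 : ℝ) / 2 ≤ ((#N : ℝ) - r) / #N := by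
    have : 2 * (r : ℝ) + 1 ≤ #N := by exact_mod_cast hcond
    have h0 : (0 : ℝ) ≤ r := Nat.cast_nonneg r
    rw [le_div_iff₀ (by linarith)]
    linarith
  have h4 := mul_le_mul_of_nonneg_left (h3.trans h2) hA.le
  have h5 := mul_le_mul_of_nonneg_left h1 hA.le
  have hdisc := disc_nonneg (d := d) (Pop := Pop) (t := t) (U \ {v}) (d v :: st)
  unfold gain start base
  rw [hb, hb', List.countP_cons]
  simp only [hl, decide_false, Bool.false_eq_true, if_false]
  push_cast
  linarith

theorem sum_half_ge (b : ℕ) :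
    bigA / 4 * b ≤ ∑ r ∈ range b, if 2 * r + 1 ≤ b then bigA / 2 else 0 := by
  have hA := bigA_pos
  rw [← sum_filter, sum_const, nsmul_eq_mul]
  have h : range ((b + 1) / 2) ⊆ (range b).filter fun r => 2 * r + 1 ≤ b := by
    intro r hr
    have := mem_range.1 hr
    simp only [mem_filter, mem_range]
    omega
  have h1 := card_le_card h
  rw [card_range] at h1
  have h2 : b ≤ 2 * #((range b).filter fun r => 2 * r + 1 ≤ b) := by omega
  have h3 : (b : ℝ) ≤ 2 * #((range b).filter fun r => 2 * r + 1 ≤ b) := by exact_mod_cast h2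
  nlinarith

/-- All candidates are low, and fewer than `2048` times their number are needed. Since the open
members number at most the need, enough positions at the bottom of the order get the full `lowGain`.
-/
theorem sum_gain_of_low (hd : Function.Injective d) {U : Finset ι} (hU : U ⊆ Pop) {st : List α}
    (hX : Low d Pop t st.head?)
    (hc : need d Pop t U st.head? < 2048 * #(cand d U st.head?)) :
    2 ^ 18 * (#(cand d U st.head?) : ℝ) ≤ ∑ v ∈ cand d U st.head?, gain d Pop t U st v := by
  have h1 := open'_le_need hU hX
  have h2 : #(cand d U st.head?) ≤ open' d Pop t U := by
    have := open'_sdiff_of_low hX (Subset.refl (cand d U st.head?))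
    omega
  have h3 : (#(cand d U st.head?) : ℝ) ≤ open' d Pop t U := by exact_mod_cast h2
  have h4 := sum_lowGain_ge (u := open' d Pop t U) (N := #(cand d U st.head?)) (by omega)
  rw [← sum_card_filter_lt d hd (lowGain (open' d Pop t U))] at h4
  refine (by linarith : _ ≤ _).trans (h4.trans (sum_le_sum fun v hv => ?_))
  have hv' := mem_filter.1 hv
  refine le_trans (le_of_eq ?_) (gain_of_low hd hU hv'.1 (hX.of_upTo hv'.2))
  congr 2
  ext w
  simp only [cand, mem_filter]
  exact ⟨fun h => ⟨h.1.1, h.2⟩, fun h => ⟨⟨h.1, hv'.2.mono h.2.le⟩, h.2⟩⟩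

/-- Under a high threshold the candidates consist of all open members and of the whole surplus; each
of the two parts brings its own gain. -/
theorem sum_gain_of_not_low (hd : Function.Injective d) {U : Finset ι} (hU : U ⊆ Pop)
    {st : List α} (hX : ¬ Low d Pop t st.head?) :
    2 ^ 18 * (#(cand d U st.head?) : ℝ) ≤ ∑ v ∈ cand d U st.head?, gain d Pop t U st v := by
  set L := (cand d U st.head?).filter fun i => Low d Pop t (some (d i)) with hL
  set N := (cand d U st.head?).filter fun i => ¬ Low d Pop t (some (d i)) with hN
  have hu : open' d Pop t U = #L := by
    rw [open', hL, cand, filter_filter]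
    congr 1
    ext i
    simp only [mem_filter]
    exact ⟨fun h => ⟨h.1, upTo_of_low_of_not_low hX h.2, h.2⟩, fun h => ⟨h.1, h.2.2⟩⟩
  have hcard : #(cand d U st.head?) = #L + #N :=
    (card_filter_add_card_filter_not fun i => Low d Pop t (some (d i))).symm
  rw [← sum_filter_add_sum_filter_not (cand d U st.head?)
    (fun i => Low d Pop t (some (d i))), ← hL, ← hN, hcard]
  have h1 := sum_lowGain_ge (u := #L) (N := #L) (by omega)
  rw [← sum_card_filter_lt d hd (lowGain #L)] at h1
  have h2 := sum_half_ge #N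
  rw [← sum_card_filter_lt d hd (fun r => if 2 * r + 1 ≤ #N then bigA / 2 else 0)] at h2
  have h3 : ∑ v ∈ L, lowGain #L #(L.filter fun w => d w < d v) ≤
      ∑ v ∈ L, gain d Pop t U st v := by
    refine sum_le_sum fun v hv => ?_
    have hv' := mem_filter.1 hv
    have := gain_of_low hd hU (st := st) (cand_subset _ _ hv'.1) hv'.2
    rw [hu] at this
    refine le_trans (le_of_eq ?_) this
    congr 2
    ext w
    simp only [hL, cand, mem_filter]
    constructor
    · exact fun h => ⟨h.1.1.1, h.2⟩
    · exact fun h => ⟨⟨⟨h.1, (mem_filter.1 hv'.1).2.mono h.2.le⟩, hv'.2.anti h.2.le⟩, h.2⟩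
  have h4 : ∑ v ∈ N, (if 2 * #(N.filter fun w => d w < d v) + 1 ≤ #N then bigA / 2 else 0) ≤
      ∑ v ∈ N, gain d Pop t U st v := by
    refine sum_le_sum fun v hv => ?_
    have hv' := mem_filter.1 hv
    exact gain_of_not_low hd hX hv'.1 hv'.2
  have h5 : 2 ^ 18 * (#N : ℝ) ≤ bigA / 4 * #N := by
    unfold bigA
    have : (0 : ℝ) ≤ #N := Nat.cast_nonneg _
    nlinarith
  push_cast
  linarith

/-- Without candidates there is no pivot and no gain, but under a high threshold the search then
ends after silent rounds. -/
theorem mid_of_cand_eq_empty {τ : ℝ} {st : List α} {U : Finset ι} (hU : U ⊆ Pop)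
    (hX : ¬ Low d Pop t st.head?) (hc : cand d U st.head? = ∅) :
    ∀ e : ℕ, mid d Pop t τ st e U = (e + 1) * τ
  | 0 => by
    rw [mid, if_pos (final_of_not_low hU hX), hc]
    simp
  | e + 1 => by
    rw [mid, hc, avg_empty, if_neg (fun h => by simpa using h.1), sdiff_empty,
      mid_of_cand_eq_empty hU hX hc e]
    simp only [filter_empty, card_empty, Nat.cast_zero]
    push_cast
    ring

/-- One test does not increase the potential in expectation. -/
theorem mid_le_start (hd : Function.Injective d) {τ : ℝ} (hτ : 0 ≤ τ) {st : List α}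
    {U : Finset ι} {E : ℕ} (hU : U ⊆ Pop) (hE : 4096 * #U ≤ 2 ^ E) (hτE : (E + 1) * τ ≤ 1) :
    mid d Pop t τ st E U ≤ start d Pop t U st := by
  have hA := bigA_pos
  by_cases hX : Low d Pop t st.head?
  · by_cases hc : 2048 * #(cand d U st.head?) ≤ need d Pop t U st.head?
    · have ho := open'_sdiff_of_low hX (Subset.refl (cand d U st.head?))
      set u := open' d Pop t U with hu
      set ρ := #(cand d U st.head?) with hρ
      have h1 := mid_le_of_likely hτ hX (q := need d Pop t U st.head?) (r := u - ρ) (M := u)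
        (s := surplus d Pop t U st) (ρ := ρ) hc (by omega) E U hU (by omega) le_rfl le_rfl le_rfl
        le_rfl
      -- An abort loses at most a quarter of `8 + bigA * (harm u - harm (u - ρ))`. The discount has
      -- taken only half of the harmonic difference in advance, and `2` for the aborts and `1` for
      -- the rounds are covered by the constant `3` in `base`.
      have h2 := abortBound_le (show (0 : ℝ) ≤ (need d Pop t U st.head? : ℝ) / 2 ^ E by positivity)
      have h3 := harm_mono (Nat.sub_le u ρ)
      have h4 : 0 ≤ bigA * (harm u - harm (u - ρ)) := mul_nonneg hA.le (by linarith)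
      have h5 := mul_le_mul_of_nonneg_right h2
        (show 0 ≤ 8 + bigA * (harm u - harm (u - ρ)) by linarith)
      unfold start disc base
      rw [if_pos ⟨hX, hc⟩]
      linarith
    -- Here no discount has been given, so the potential is `base`, and the pivots have to pay.
    · have hc' := not_le.1 hc
      have := mid_le_base_of_gain hτ hU hE hτE (by omega) hc'.le (sum_gain_of_low hd hU hX hc')
      unfold start disc
      rw [if_neg fun h => hc h.2]
      linarith
  · have hdisc : disc d Pop t U st = 0 := if_neg fun h => hX h.1
    unfold start
    rw [hdisc, sub_zero]
    rcases Nat.eq_zero_or_pos #(cand d U st.head?) with h0 | hpos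
    · rw [mid_of_cand_eq_empty hU hX (card_eq_zero.1 h0)]
      have := mul_nonneg hA.le (harm_nonneg (open' d Pop t U))
      have := mul_nonneg hA.le (harm_nonneg (surplus d Pop t U st))
      have : (0 : ℝ) ≤ 4 * (st.countP fun x => Low d Pop t (some x)) := by positivity
      unfold base
      linarith
    · have := need_le_card_cand (d := d) (t := t) hU hX
      exact mid_le_base_of_gain hτ hU hE hτE hpos (by omega) (sum_gain_of_not_low hd hU hX)

/-- The discount is at most half of the first term of `base`. -/
theorem start_nonneg (U : Finset ι) (st : List α) : 0 ≤ start d Pop t U st := by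
  have hA := bigA_pos
  have h1 := mul_nonneg hA.le (harm_nonneg (open' d Pop t U))
  have h2 := mul_nonneg hA.le (harm_nonneg (surplus d Pop t U st))
  have h3 : (0 : ℝ) ≤ 4 * (st.countP fun x => Low d Pop t (some x)) := by positivity
  have h4 := mul_nonneg hA.le (harm_nonneg (open' d Pop t U - #(cand d U st.head?)))
  unfold start base disc
  split_ifs <;> linarith

theorem mid_nonneg {τ : ℝ} (hτ : 0 ≤ τ) (st : List α) :
    ∀ (e : ℕ) (U : Finset ι), 0 ≤ mid d Pop t τ st e U
  | 0, U => by
    have := start_nonneg (d := d) (Pop := Pop) (t := t) (U \ cand d U st.head?) st.tail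
    rw [mid]
    split_ifs <;> positivity
  | e + 1, U => by
    have h0 : (0 : ℝ) ≤ (1 / 2) ^ (e + 1) := by positivity
    have h1 : ((1 : ℝ) / 2) ^ (e + 1) ≤ 1 := pow_le_one₀ (by norm_num) (by norm_num)
    rw [mid, ← avg_const ((1 / 2) ^ (e + 1)) (cand d U st.head?) 0]
    refine avg_mono h0 h1 fun R _ => ?_
    have := start_nonneg (d := d) (Pop := Pop) (t := t) (U \ R) (push (R.image d) st)
    have := mid_nonneg hτ st e (U \ R)
    split_ifs <;> positivity

/-- The next potential in a test, after the members of `R` replied. -/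
def midNext (d : ι → α) (Pop : Finset ι) (t : ℕ) (τ : ℝ) (st : List α) (U : Finset ι) :
    ℕ → Finset ι → ℝ
  | 0, R => if Final d Pop t (U \ R) st.head? then 0 else 1 + start d Pop t (U \ R) st.tail
  | e + 1, R =>
      if Abort d Pop t U st.head? (e + 1) R then 1 + start d Pop t (U \ R) (push (R.image d) st)
      else mid d Pop t τ st e (U \ R)

theorem midNext_nonneg {τ : ℝ} (hτ : 0 ≤ τ) (st : List α) (U : Finset ι) (e : ℕ)
    (R : Finset ι) : 0 ≤ midNext d Pop t τ st U e R := by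
  have h1 := start_nonneg (d := d) (Pop := Pop) (t := t) (U \ R) (push (R.image d) st)
  have h2 := start_nonneg (d := d) (Pop := Pop) (t := t) (U \ R) st.tail
  cases e with
  | zero => rw [midNext]; split_ifs <;> linarith
  | succ e =>
    have := mid_nonneg (d := d) (Pop := Pop) (t := t) hτ st e (U \ R)
    rw [midNext]; split_ifs <;> linarith

/-- Brings exponent `0`, where everybody replies, and the other exponents into one form that fits to
a round of the protocol. -/
theorem mid_eq_avg {τ : ℝ} (st : List α) (e : ℕ) (U : Finset ι) :
    mid d Pop t τ st e U = avg ((1 / 2) ^ e) (cand d U st.head?) fun R =>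
      τ + #(R.filter fun i => ¬ Low d Pop t (some (d i))) + midNext d Pop t τ st U e R := by
  cases e with
  | zero => rw [pow_zero, avg_one, mid, midNext]
  | succ e => rw [mid]; rfl

/-- The potential of every reset state is at most logarithmic. -/
theorem start_nil_le (U : Finset ι) :
    start d Pop t U [] ≤ 2 * bigA * harm #U + 3 := by
  have hA := bigA_pos
  have h1 := mul_le_mul_of_nonneg_left (harm_mono (card_filter_le U
    fun i => Low d Pop t (some (d i)))) hA.le
  have h2 := mul_le_mul_of_nonneg_left (harm_mono (card_filter_le U
    fun i => ¬ Low d Pop t (some (d i)) ∧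
      UpTo (([] : List α).find? fun x => ¬ Low d Pop t (some x)) (d i))) hA.le
  refine (start_le_base _ _).trans ?_
  unfold base open' surplus
  simp only [List.countP_nil, Nat.cast_zero]
  linarith

end test

end Monitoring

end

noncomputable section

namespace Monitoring

open Finset

/-! ### The protocol -/

/-- The parameters of the protocol: number of lower copies of the sketch, maximal height, top
exponent of a test, length and number of phases, number of rounds, approximate logarithm. -/
structure Params where
  B : ℕ
  m : ℕ
  E : ℕ
  N : ℕ
  ph : ℕ
  R : ℕ
  L : ℕ

/-- Truncated geometric distribution on `{0, …, m}`. -/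
def geom : ℕ → PMF ℕ
  | 0 => PMF.pure 0
  | m + 1 => (flip (1 / 2)).bind fun b => if b then (geom m).map (· + 1) else PMF.pure 0

section order

variable {α : Type u}

open Classical in
/-- The least element of a set, if there is one. -/
def pick [LinearOrder α] (S : Set α) : Option α :=
  if h : ∃ x, IsLeast S x then some h.choose else none

/-- `a` is smaller than the threshold, where `none` stands for `∞`. -/
def Under [LinearOrder α] : Option α → α → Prop
  | none, _ => True
  | some x, a => a < x

instance [LinearOrder α] (X : Option α) (a : α) : Decidable (Under X a) :=
  match X with
  | none => isTrue trivial
  | some x => inferInstanceAs (Decidable (a < x))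

/-- The opposite order. -/
abbrev dualOrder (α : Type u) [LinearOrder α] : LinearOrder α :=
  inferInstanceAs (LinearOrder αᵒᵈ)

/-- The order used by a copy of the sketch: the last copy uses the opposite order. -/
abbrev side (α : Type u) [LinearOrder α] (B : ℕ) (c : Fin (B + 1)) : LinearOrder α :=
  if c = Fin.last B then dualOrder α else inferInstance

/-- The least item of a node whose height is at least `l`. -/
def best [LinearOrder α] {n : ℕ} (g : Fin n → ℕ) (d : Fin n → α) (l : ℕ) : Option α :=
  pick {x | ∃ i, l ≤ g i ∧ d i = x}

/-- The `t` smallest elements. -/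
def smallest [LinearOrder α] (t : ℕ) (S : Finset α) : Finset α :=
  S.filter fun x => #(S.filter fun y => y ≤ x) ≤ t

end order

/-- What all nodes know about the running operation. -/
inductive Mode (α : Type u) (B : ℕ) : Type u
  | rest
  | cold (c : Fin (B + 1)) (h : ℕ)
  | hot (c : Fin (B + 1))
  | test (X : Option α) (e : ℕ)

/-- The memory of a node. -/
structure Node (α : Type u) (B : ℕ) : Type u where
  ht : Fin (B + 1) → ℕ
  dirty : Bool
  flag : Fin (B + 1) → Bool
  act : Bool
  mode : Mode α B

/-- The state of the server during a search. -/
structure Core (α : Type u) : Type u where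
  t : ℕ
  known : Finset α
  st : List α
  e : ℕ
  fresh : Bool
  i : ℕ
  ph : ℕ

/-- The stage of the running operation. -/
inductive Stage (α : Type u) (B : ℕ) : Type u
  | idle (out : Option (Finset α))
  | draw
  | cold (c : Fin (B + 1)) (cs : List (Fin (B + 1))) (h : ℕ) (first : Bool)
  | hot (c : Fin (B + 1)) (cs : List (Fin (B + 1))) (l : ℕ)
  | fin
  | ask (q : Query)
  | asked (k : Core α)
  | test (k : Core α)

/-- The memory of the server. -/
structure Server (α : Type u) (B : ℕ) : Type u where
  T : Fin (B + 1) → ℕ → Option α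
  stage : Stage α B

/-- The broadcasts of the server. -/
inductive Cmd (α : Type u) (B : ℕ) : Type u
  | draw
  | cold (c : Fin (B + 1))
  | hot (l : ℕ) (T : Option α)
  | fin
  | all
  | part (j : ℕ)
  | test (e : ℕ) (X : Option α)

namespace Params

variable (p : Params) {α : Type u}

/-- The number of values of the second component of a control word. -/
def X : ℕ := p.B + p.m + p.E + 2

/-- A control word. -/
def word (tag : Fin 8) (x : ℕ) : Fin (8 * p.X) :=
  finProdFinEquiv (tag, ⟨x % p.X, Nat.mod_lt _ (by unfold X; omega)⟩)

/-- The message for a command. -/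
def encode : Cmd α p.B → Msg α (8 * p.X)
  | .draw => (p.word 0 0, none)
  | .cold c => (p.word 1 c, none)
  | .hot l T => (p.word 2 l, T)
  | .fin => (p.word 3 0, none)
  | .all => (p.word 4 0, none)
  | .part j => (p.word 5 j, none)
  | .test e X => (p.word 6 e, X)

/-- The command of a message. -/
def decode (a : Msg α (8 * p.X)) : Cmd α p.B :=
  let w := finProdFinEquiv.symm a.1
  if w.1 = 0 then .draw
  else if w.1 = 1 then .cold (Fin.ofNat (p.B + 1) w.2)
  else if w.1 = 2 then .hot w.2 a.2
  else if w.1 = 3 then .fin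
  else if w.1 = 4 then .all
  else if w.1 = 5 then .part w.2
  else .test w.2 a.2

/-- The commands which fit into a message. -/
def Fits : Cmd α p.B → Prop
  | .hot l _ => l ≤ p.m + 1
  | .part j => j ≤ p.m
  | .test e _ => e ≤ p.E
  | _ => True

/-- The number in a control word is reduced modulo `p.X`, hence the restriction to commands that
fit. -/
theorem decode_encode {c : Cmd α p.B} (h : p.Fits c) : p.decode (p.encode c) = c := by
  cases c with
  | draw => simp [decode, encode, word]
  | cold c =>
    have h2 : (c : ℕ) % p.X = c := Nat.mod_eq_of_lt (by unfold X; omega)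
    simp [decode, encode, word, h2]
  | hot l T =>
    have h2 : l % p.X = l := Nat.mod_eq_of_lt (by unfold X Fits at *; omega)
    simp [decode, encode, word, h2]
  | fin => simp [decode, encode, word]
  | all => simp [decode, encode, word]
  | part j =>
    have h2 : j % p.X = j := Nat.mod_eq_of_lt (by unfold X Fits at *; omega)
    simp [decode, encode, word, h2]
  | test e X =>
    have h2 : e % p.X = e := Nat.mod_eq_of_lt (by unfold Params.X Fits at *; omega)
    simp [decode, encode, word, h2]

variable [LinearOrder α]

/-- Silent round, or first round, of a copy: changed nodes of height `h` reply. -/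
def coldStep (v : Node α p.B) (c : Fin (p.B + 1)) (h : ℕ) : Node α p.B × Bool :=
  ({ v with mode := .cold c (h - 1) }, v.dirty && decide (v.ht c = h))

/-- The copy to which a mode belongs. -/
def copyOf : Mode α p.B → Fin (p.B + 1)
  | .cold c _ => c
  | .hot c => c
  | _ => Fin.last p.B

open Classical in
/-- The least item of height at least `l` is announced; nodes of the next smaller height
with smaller items reply. -/
def hotStep (v : Node α p.B) (a : α) (c : Fin (p.B + 1)) (l : ℕ) (T : Option α) :
    Node α p.B × Bool :=
  ({ v with
      flag := fun c' => if c' = c ∧ v.ht c = l then decide (T = some a) else v.flag c'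
      mode := .hot c },
    decide (v.ht c + 1 = l ∧ @Under α (side α p.B c) T a))

/-- The mode after a round of a test. -/
def testMode (X : Option α) : ℕ → Mode α p.B
  | 0 => .rest
  | e + 1 => .test X e

/-- A round of a test: active nodes up to the threshold reply with probability `2 ^ (-e)`. -/
def testStep (v : Node α p.B) (a : α) (X : Option α) (e : ℕ) : PMF (Node α p.B × Bool) :=
  (if v.act = true ∧ UpTo X a then flip ((1 / 2) ^ e) else PMF.pure false).map
    fun b => ({ v with act := v.act && !b, mode := p.testMode X e }, b)

/-- What a node does in a round, and whether it replies. -/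
def nodeStep (v : Node α p.B) (a : α) : Option (Cmd α p.B) → PMF (Node α p.B × Bool)
  | some .draw => (independent (p.B + 1) fun _ => geom p.m).map fun g =>
      ({ v with ht := g, dirty := true, flag := fun _ => false, mode := .rest }, false)
  | some (.cold c) => PMF.pure (p.coldStep v c p.m)
  | some (.hot l T) => PMF.pure (p.hotStep v a (p.copyOf v.mode) l T)
  | some .fin => PMF.pure ({ v with dirty := false, mode := .rest }, false)
  | some .all =>
      PMF.pure ({ v with act := decide (∀ c, v.flag c = false), mode := .rest }, false)
  | some (.part j) => (flip ((1 / 2) ^ j)).map fun b => ({ v with act := b, mode := .rest }, false)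
  | some (.test e X) => p.testStep v a X e
  | none => match v.mode with
    | .rest => PMF.pure (v, false)
    | .hot _ => PMF.pure (v, false)
    | .cold c h => PMF.pure (p.coldStep v c h)
    | .test X e => p.testStep v a X e

/-- The stage in which the next copy is treated. -/
def nextCopy : List (Fin (p.B + 1)) → Stage α p.B
  | [] => .fin
  | c :: cs => .cold c cs p.m true

/-- Count the rounds of a phase; start the next phase. -/
def tick (k : Core α) : Core α :=
  match k.ph, k.i with
  | 0, _ => k
  | _, i + 1 => { k with i := i }
  | 1, 0 => { k with st := [], e := 0, fresh := true, ph := 0 }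
  | ph + 1, 0 => { k with st := [], e := p.E, fresh := true, i := p.N, ph := ph }

/-- Threshold and exponent for the next round. -/
def control (k : Core α) (I : Finset α) : Core α :=
  match k.e with
  | 0 => { k with known := k.known ∪ I, st := k.st.tail, e := p.E, fresh := true }
  | e + 1 =>
    if I.Nonempty ∧ k.t - #(k.known.filter (UpTo k.st.head?)) ≤ 2 * #I * 2 ^ (e + 1) then
      { k with known := k.known ∪ I, st := push I k.st, e := p.E, fresh := true }
    else { k with known := k.known ∪ I, e := e, fresh := false }

/-- The search ends. -/
def Done (k : Core α) (I : Finset α) : Prop :=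
  k.e = 0 ∧ (k.st.head? = none ∨ k.t ≤ #((k.known ∪ I).filter (UpTo k.st.head?)))

instance (k : Core α) (I : Finset α) : Decidable (Done k I) :=
  inferInstanceAs (Decidable (_ ∧ _))

/-- The server evaluates the replies in a test. -/
def coreNext (k : Core α) (I : Finset α) : Stage α p.B :=
  if Done k I then .idle (some (smallest k.t (k.known ∪ I))) else .test (p.tick (p.control k I))

/-- The server reads the items that the nodes sent. -/
def absorb (s : Server α p.B) (I : Finset α) : Server α p.B :=
  match s.stage with
  | .idle o => { s with stage := .idle o }
  | .draw => { s with stage := p.nextCopy (List.finRange (p.B + 1)) }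
  | .cold c cs 0 _ => ⟨s.T, if I.Nonempty then .hot c cs 1 else p.nextCopy cs⟩
  | .cold c cs (h + 1) _ => ⟨s.T, if I.Nonempty then .hot c cs (h + 2) else .cold c cs h false⟩
  | .hot _ cs 0 => { s with stage := p.nextCopy cs }
  | .hot c cs (l + 1) =>
    { T := fun c' l' => if c' = c ∧ l' = l then
          @pick α (side α p.B c) {x | s.T c (l + 1) = some x ∨ x ∈ I} else s.T c' l'
      stage := .hot c cs l }
  | .fin => { s with stage := .idle none }
  | .ask q => { s with stage := .ask q }
  | .asked k => { s with stage := .test k }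
  | .test k => { s with stage := p.coreNext k I }

/-- The level of the sketch that is used for rank `k`. -/
def lev (k : ℕ) : ℕ := Nat.clog 2 (16 * k * p.L ^ 2)

/-- The search state at the beginning. -/
def core (T : Fin (p.B + 1) → ℕ → Option α) (k t : ℕ) (known : Finset α) : Core α :=
  { t := t, known := known, st := (T 0 (p.lev k)).toList, e := p.E, fresh := true, i := p.N,
    ph := p.ph }

/-- The items that the server knows from the sketch. -/
def sketch (T : Fin (p.B + 1) → ℕ → Option α) : Finset α :=
  (univ ×ˢ range (p.m + 1)).biUnion fun x => (T x.1 x.2).toFinset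

end Params

/-- The sample size for given accuracy. -/
def sampleSize (ε δ : ℝ) : ℝ := 16 * Real.log (2 / δ) / ε ^ 2

/-- The error probability that is aimed at. -/
def errProb (δ : ℝ) : ℝ := min δ (1 / 2)

/-- The probability with which the server reacts at all. -/
def reactProb (δ : ℝ) : ℝ := if δ ≤ 1 / 2 then 1 else 2 * (1 - δ)

open Classical in
/-- The exponent of the sampling rate. -/
def rateExp (m k : ℕ) (ε δ : ℝ) : ℕ :=
  Nat.findGreatest (fun j => sampleSize ε δ * 2 ^ j ≤ k) m

/-- The rank of the answer within the sample. -/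
def sampleRank (k j : ℕ) (ε : ℝ) : ℕ := if j = 0 then k else ⌈(1 - ε / 2) * (k / 2 ^ j)⌉₊

namespace Params

variable (p : Params) {α : Type u} [LinearOrder α]

/-- The server's broadcast. -/
def speak (s : Server α p.B) : PMF (Server α p.B × Option (Cmd α p.B)) :=
  match s.stage with
  | .idle o => PMF.pure ({ s with stage := .idle o }, none)
  | .draw => PMF.pure (s, some .draw)
  | .cold c _ _ first => PMF.pure (s, if first then some (.cold c) else none)
  | .hot c _ l => PMF.pure (s, some (.hot l (s.T c l)))
  | .fin => PMF.pure (s, some .fin)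
  | .ask (.topK k) =>
      PMF.pure ({ s with stage := .asked (p.core s.T k k (p.sketch s.T)) }, some .all)
  | .ask (.select k ε δ) => (flip (reactProb δ)).map fun b =>
      if b then
        ({ s with stage := .asked (p.core s.T k
            (sampleRank k (rateExp p.m k ε (errProb δ)) ε) ∅) },
          some (.part (rateExp p.m k ε (errProb δ))))
      else ({ s with stage := .idle none }, none)
  | .asked _ => PMF.pure (s, none)
  | .test k => PMF.pure (s, if k.fresh then some (.test k.e k.st.head?) else none)

/-- The items in a family of messages. -/
def itemsOf {n W : ℕ} (r : Fin n → Option (Msg α W)) : Finset α :=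
  univ.biUnion fun i => ((r i).bind fun a => a.2).toFinset

/-- The protocol. -/
def protocol (n : ℕ) : Protocol α n where
  W := 8 * p.X
  R := p.R
  Srv := Server α p.B
  Mem := Node α p.B
  srv₀ := ⟨fun _ _ => none, .idle none⟩
  mem₀ _ := ⟨fun _ => 0, true, fun _ => false, false, .rest⟩
  accept s o := { s with stage := match o with
    | .setUp => .draw
    | .refresh => p.nextCopy (List.finRange (p.B + 1))
    | .answer q => .ask q }
  send s := (p.speak s).map fun r =>
    (r.1, { broadcast := r.2.map p.encode, single := fun _ => none })
  node _ v a b _ := (p.nodeStep v a (b.map p.decode)).map fun r =>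
    (r.1, if r.2 then some (p.word 7 0, some a) else none)
  recv s r := p.absorb s (itemsOf r)
  upd _ v _ _ := PMF.pure ({ v with dirty := true }, none)
  outTopK s := match s.stage with
    | .idle o => o
    | _ => none
  outSelect s := match s.stage with
    | .idle (some S) => if h : S.Nonempty then some (S.max' h) else none
    | _ => none
  roughRank s k := (s.T 0 (p.lev k)).or (s.T (Fin.last p.B) 0)

end Params

end Monitoring

end

noncomputable section

namespace Monitoring

open Finset

/-! ### Executing rounds -/

theorem bind_congr_support {β γ : Type*} {q : PMF β} {f f' : β → PMF γ}
    (h : ∀ b ∈ q.support, f b = f' b) : q.bind f = q.bind f' := by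
  ext x
  simp only [PMF.bind_apply]
  refine tsum_congr fun b => ?_
  by_cases hb : b ∈ q.support
  · rw [h b hb]
  · rw [PMF.mem_support_iff, not_not] at hb
    simp [hb]

section rounds

variable {α : Type u} {n : ℕ} (P : Protocol α n)

theorem rounds_add (a b : ℕ) (s : P.Config) :
    P.rounds (a + b) s = (P.rounds a s).bind (P.rounds b) := by
  induction a generalizing s with
  | zero => simp [Protocol.rounds]
  | succ a ih =>
    rw [Nat.succ_add]
    simp only [Protocol.rounds, PMF.bind_bind]
    exact congrArg _ (funext fun s' => ih s')

/-- Operations take a fixed number of rounds; this handles the idle rounds at the end. -/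
theorem rounds_fixed {s : P.Config} (h : P.round s = PMF.pure s) (a : ℕ) :
    P.rounds a s = PMF.pure s := by
  induction a with
  | zero => rfl
  | succ a ih => rw [Protocol.rounds, h, PMF.pure_bind, ih]

theorem rounds_pure_trans {s s' : P.Config} {a b : ℕ} (h : P.rounds a s = PMF.pure s') :
    P.rounds (a + b) s = P.rounds b s' := by
  rw [rounds_add, h, PMF.pure_bind]

theorem rounds_one_add {s s' : P.Config} (h : P.round s = PMF.pure s') (a : ℕ) :
    P.rounds (1 + a) s = P.rounds a s' := by
  rw [add_comm, Protocol.rounds, h, PMF.pure_bind]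

theorem round_of_send {A : Type u} {s : P.Config} {q : PMF A} {F : A → P.Srv × Downlink α P.W n}
    (h : P.send s.server = q.map F) :
    P.round s = q.bind fun r => (independent n fun i =>
      P.node i (s.mem i) (s.item i) (F r).2.broadcast ((F r).2.single i)).map fun x =>
        { server := P.recv (F r).1 fun i => (x i).2
          mem := fun i => (x i).1
          item := s.item
          msgs := s.msgs + (F r).2.cost + countMsgs fun i => (x i).2 } := by
  unfold Protocol.round
  rw [h, PMF.bind_map]
  rfl

theorem map_of_independent {β γ δ : Type*} {n : ℕ} {q : Fin n → PMF β} {q' : Fin n → PMF γ}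
    {g : Fin n → β → γ} (h : ∀ i, q' i = (q i).map (g i)) {f : (Fin n → γ) → δ} :
    (independent n q').map f = (independent n q).map fun x => f fun i => g i (x i) := by
  rw [show q' = fun i => (q i).map (g i) from funext h, independent_map, PMF.map_comp]
  rfl

end rounds

namespace Params

variable (p : Params) {α : Type u} [LinearOrder α] {n : ℕ}

/-- The state after a round in which the server is in state `s` after having sent the command
`c`, and the nodes act as described by `x`. -/
def after (s : Server α p.B) (c : Option (Cmd α p.B)) (d : Fin n → α) (k : ℕ)
    (x : Fin n → Node α p.B × Bool) : (p.protocol (α := α) n).Config where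
  server := p.absorb s ((univ.filter fun i => (x i).2 = true).image d)
  mem := fun i => (x i).1
  item := d
  msgs := k + (if c.isSome = true then 1 else 0) + #(univ.filter fun i => (x i).2 = true)

/-- Translates a round with encoded messages into commands, a set of nodes that reply, and the
images of that set under the items. All later work is done at this level. -/
theorem round_eq (s : (p.protocol (α := α) n).Config)
    (hs : ∀ r ∈ (p.speak s.server).support, ∀ c, r.2 = some c → p.Fits c) :
    (p.protocol n).round s = (p.speak s.server).bind fun r =>
      (independent n fun i => p.nodeStep (s.mem i) (s.item i) r.2).map
        (p.after r.1 r.2 s.item s.msgs) := by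
  refine (round_of_send (P := p.protocol n) (q := p.speak s.server) rfl).trans ?_
  refine bind_congr_support fun r hr => ?_
  have h2 : ((r.2.map p.encode).map p.decode) = r.2 := by
    cases h : r.2 with
    | none => rfl
    | some c => simp [p.decode_encode (hs r hr c h)]
  refine (map_of_independent (q := fun i => p.nodeStep (s.mem i) (s.item i) r.2)
    (g := fun i x => (x.1,
        if x.2 then (some (p.word 7 0, some (s.item i)) : Option (Msg α (8 * p.X))) else none))
    (fun i => ?_)).trans ?_
  · change (p.nodeStep (s.mem i) (s.item i) ((r.2.map p.encode).map p.decode)).map _ = _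
    rw [h2]
  congr 1
  funext x
  have h5 : itemsOf (fun i => if (x i).2 then
      (some (p.word 7 0, some (s.item i)) : Option (Msg α (8 * p.X))) else none) =
      (univ.filter fun i => (x i).2 = true).image s.item := by
    ext a
    simp only [itemsOf, mem_biUnion, mem_univ, true_and, mem_image, mem_filter,
      Option.mem_toFinset]
    refine exists_congr fun i => ?_
    by_cases h : (x i).2 <;> simp [h, eq_comm]
  refine Protocol.Config.mk.injEq .. |>.mpr ⟨congrArg (p.absorb r.1) h5, rfl, rfl, ?_⟩
  congr 1
  · refine congrArg (s.msgs + ·) ?_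
    unfold Downlink.cost countMsgs
    cases r.2 with
    | none =>
      refine (Nat.add_eq_left).2 (card_eq_zero.2 (filter_eq_empty_iff.2 fun i _ => ?_))
      exact Bool.false_ne_true
    | some c =>
      simp only [Option.map_some, Option.isSome_some, if_true]
      refine (Nat.add_eq_left).2 (card_eq_zero.2 (filter_eq_empty_iff.2 fun i _ => ?_))
      exact Bool.false_ne_true
  · unfold countMsgs
    refine congrArg _ (filter_congr fun i _ => ?_)
    change (if (x i).2 = true then (some (p.word 7 0, some (s.item i)) :
      Option (Msg α (8 * p.X))) else none).isSome = true ↔ _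
    generalize (x i).2 = b
    cases b
    · exact iff_of_false Bool.false_ne_true Bool.false_ne_true
    · exact iff_of_true rfl rfl

theorem round_det {s : (p.protocol (α := α) n).Config} {srv : Server α p.B}
    {c : Option (Cmd α p.B)} {f : Fin n → Node α p.B × Bool}
    (h1 : p.speak s.server = PMF.pure (srv, c)) (h2 : ∀ c', c = some c' → p.Fits c')
    (h3 : ∀ i, p.nodeStep (s.mem i) (s.item i) c = PMF.pure (f i)) :
    (p.protocol n).round s = PMF.pure (p.after srv c s.item s.msgs f) := by
  rw [round_eq, h1, PMF.pure_bind]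
  · simp only [h3]
    rw [independent_pure, PMF.pure_map]
  · intro r hr c' hc'
    rw [h1, PMF.support_pure, Set.mem_singleton_iff] at hr
    subst hr
    exact h2 c' hc'

/-- A configuration in which all nodes are in the same mode. -/
def conf (T : Fin (p.B + 1) → ℕ → Option α) (stage : Stage α p.B) (g : Fin n → Fin (p.B + 1) → ℕ)
    (dirty : Fin n → Bool) (flag : Fin n → Fin (p.B + 1) → Bool) (act : Fin n → Bool)
    (mode : Mode α p.B) (d : Fin n → α) (k : ℕ) : (p.protocol (α := α) n).Config where
  server := ⟨T, stage⟩
  mem := fun i => ⟨g i, dirty i, flag i, act i, mode⟩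
  item := d
  msgs := k

theorem round_idle {T : Fin (p.B + 1) → ℕ → Option α} {o : Option (Finset α)}
    {g : Fin n → Fin (p.B + 1) → ℕ} {dirty : Fin n → Bool} {flag : Fin n → Fin (p.B + 1) → Bool}
    {act : Fin n → Bool} {d : Fin n → α} {k : ℕ} :
    (p.protocol n).round (p.conf T (.idle o) g dirty flag act .rest d k) =
      PMF.pure (p.conf T (.idle o) g dirty flag act .rest d k) := by
  rw [p.round_det (srv := ⟨T, .idle o⟩) (c := none)
    (f := fun i => (⟨g i, dirty i, flag i, act i, .rest⟩, false)) rfl (by simp) (fun i => rfl)]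
  simp [after, conf, absorb]

end Params

end Monitoring

end

noncomputable section

namespace Monitoring

open Finset

/-! ### Refreshing the sketch -/

section best

variable {α : Type u} [LinearOrder α] {n : ℕ}

theorem pick_eq_some_iff {S : Set α} {x : α} : pick S = some x ↔ IsLeast S x := by
  unfold pick
  split_ifs with h
  · rw [Option.some_inj]
    exact ⟨fun h' => h' ▸ h.choose_spec, fun h' => h.choose_spec.unique h'⟩
  · exact iff_of_false (by simp) fun h' => h ⟨x, h'⟩

theorem pick_congr {S S' : Set α} (h : ∀ x, IsLeast S x ↔ IsLeast S' x) : pick S = pick S' := by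
  ext x
  rw [pick_eq_some_iff, pick_eq_some_iff, h]

theorem best_eq_some_iff {g : Fin n → ℕ} {d : Fin n → α} {l : ℕ} {x : α} :
    best g d l = some x ↔ (∃ i, l ≤ g i ∧ d i = x) ∧ ∀ i, l ≤ g i → x ≤ d i := by
  rw [best, pick_eq_some_iff]
  refine and_congr Iff.rfl ⟨fun h i hi => h ⟨i, hi, rfl⟩, ?_⟩
  rintro h _ ⟨i, hi, rfl⟩
  exact h i hi

theorem exists_best_le {g : Fin n → ℕ} {d : Fin n → α} {l : ℕ} {i : Fin n} (h : l ≤ g i) :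
    ∃ x, best g d l = some x ∧ x ≤ d i := by
  obtain ⟨j, hj, hm⟩ := exists_min_image (univ.filter fun j => l ≤ g j) d ⟨i, by simpa using h⟩
  have : best g d l = some (d j) := best_eq_some_iff.2
    ⟨⟨j, by simpa using hj, rfl⟩, fun i' hi' => hm i' (by simpa using hi')⟩
  exact ⟨d j, this, (best_eq_some_iff.1 this).2 i h⟩

theorem best_eq_none_iff {g : Fin n → ℕ} {d : Fin n → α} {l : ℕ} :
    best g d l = none ↔ ∀ i, g i < l := by
  constructor
  · intro h i
    by_contra! hi
    obtain ⟨x, hx, -⟩ := exists_best_le (d := d) hi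
    simp [h] at hx
  · intro h
    by_contra h'
    obtain ⟨x, hx⟩ := Option.ne_none_iff_exists'.1 h'
    obtain ⟨⟨i, hi, -⟩, -⟩ := best_eq_some_iff.1 hx
    exact absurd (h i) (by omega)

theorem best_congr {g : Fin n → ℕ} {d d' : Fin n → α} {l : ℕ}
    (h : ∀ i, l ≤ g i → d i = d' i) : best g d l = best g d' l := by
  unfold best
  congr 1
  ext x
  exact exists_congr fun i => and_congr_right fun hi => by rw [h i hi]

/-- Why it suffices that nodes of height exactly `l` with items below the minimum of level `l + 1`
reply: all other items of height at least `l` are not smaller than that minimum. -/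
theorem best_eq_pick (g : Fin n → ℕ) (d : Fin n → α) (l : ℕ) :
    best g d l = pick {x | best g d (l + 1) = some x ∨
      ∃ i, (g i + 1 = l + 1 ∧ Under (best g d (l + 1)) (d i)) ∧ d i = x} := by
  have h1 : ∀ x ∈ {x | best g d (l + 1) = some x ∨
      ∃ i, (g i + 1 = l + 1 ∧ Under (best g d (l + 1)) (d i)) ∧ d i = x},
      x ∈ {x | ∃ i, l ≤ g i ∧ d i = x} := by
    rintro x (h | ⟨i, ⟨hi, -⟩, rfl⟩)
    · obtain ⟨⟨i, hi, rfl⟩, -⟩ := best_eq_some_iff.1 h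
      exact ⟨i, by omega, rfl⟩
    · exact ⟨i, by omega, rfl⟩
  have h2 : ∀ x ∈ {x | ∃ i, l ≤ g i ∧ d i = x}, ∃ y ∈ {x | best g d (l + 1) = some x ∨
      ∃ i, (g i + 1 = l + 1 ∧ Under (best g d (l + 1)) (d i)) ∧ d i = x}, y ≤ x := by
    rintro _ ⟨i, hi, rfl⟩
    by_cases h : l + 1 ≤ g i
    · obtain ⟨x, hx, hx'⟩ := exists_best_le (d := d) h
      exact ⟨x, Or.inl hx, hx'⟩
    · by_cases hu : Under (best g d (l + 1)) (d i)
      · exact ⟨d i, Or.inr ⟨i, ⟨by omega, hu⟩, rfl⟩, le_rfl⟩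
      · cases hb : best g d (l + 1) with
        | none => rw [hb] at hu; exact absurd trivial hu
        | some y =>
          rw [hb] at hu
          exact ⟨y, Or.inl rfl, not_lt.1 hu⟩
  refine pick_congr fun x => ⟨fun h => ?_, fun h => ⟨h1 x h.1, fun y hy => ?_⟩⟩
  · obtain ⟨y, hy, hyx⟩ := h2 x h.1
    obtain rfl : x = y := le_antisymm (h.2 (h1 y hy)) hyx
    exact ⟨hy, fun z hz => h.2 (h1 z hz)⟩
  · obtain ⟨z, hz, hzy⟩ := h2 y hy
    exact (h.2 hz).trans hzy

end best

namespace Params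

variable (p : Params) {α : Type u} [LinearOrder α] {n : ℕ}

/-- The content of the sketch for given heights and items. -/
def top (g : Fin n → Fin (p.B + 1) → ℕ) (d : Fin n → α) (c : Fin (p.B + 1)) (l : ℕ) : Option α :=
  @best α (side α p.B c) n (fun i => g i c) d l

open Classical in
/-- The nodes that reply in a round. -/
def repliers (g : Fin n → Fin (p.B + 1) → ℕ) (d : Fin n → α) (c : Fin (p.B + 1)) (l : ℕ) :
    Finset (Fin n) :=
  univ.filter fun i => g i c + 1 = l ∧ @Under α (side α p.B c) (p.top g d c l) (d i)

/-- Sketch and flags of a copy are correct above level `l`. -/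
def GoodAbove (T : Fin (p.B + 1) → ℕ → Option α) (g : Fin n → Fin (p.B + 1) → ℕ)
    (flag : Fin n → Fin (p.B + 1) → Bool) (d : Fin n → α) (A : ℕ → Prop) (c : Fin (p.B + 1)) :
    Prop :=
  (∀ l ≤ p.m + 1, A l → T c l = p.top g d c l) ∧
    ∀ i, A (g i c) → (flag i c = true ↔ p.top g d c (g i c) = some (d i))

/-- Sketch and flags of a copy are correct. -/
def Good (T : Fin (p.B + 1) → ℕ → Option α) (g : Fin n → Fin (p.B + 1) → ℕ)
    (flag : Fin n → Fin (p.B + 1) → Bool) (d : Fin n → α) (c : Fin (p.B + 1)) : Prop :=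
  p.GoodAbove T g flag d (fun _ => True) c

/-- Sketch and flags of a copy are correct above the heights of changed nodes. -/
def AlmostGood (T : Fin (p.B + 1) → ℕ → Option α) (g : Fin n → Fin (p.B + 1) → ℕ)
    (dirty : Fin n → Bool) (flag : Fin n → Fin (p.B + 1) → Bool) (d : Fin n → α)
    (c : Fin (p.B + 1)) : Prop :=
  p.GoodAbove T g flag d (fun l => ∀ i, dirty i = true → g i c < l) c

/-- The number of messages in the second part of the treatment of a copy. -/
def hotCost (g : Fin n → Fin (p.B + 1) → ℕ) (d : Fin n → α) (c : Fin (p.B + 1)) (l : ℕ) : ℕ :=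
  ∑ l' ∈ range (l + 1), (1 + #(p.repliers g d c l'))

-- The recursion `best_eq_pick` is carried out downwards from a level with correct entry. A node
-- sets its flag when the minimum of its own height is announced; hence level `0` is announced as
-- well, although it has no repliers.
open Classical in
theorem rounds_hot {g : Fin n → Fin (p.B + 1) → ℕ} {dirty : Fin n → Bool} {act : Fin n → Bool}
    {d : Fin n → α} {c : Fin (p.B + 1)} {cs : List (Fin (p.B + 1))} :
    ∀ (l : ℕ) (T : Fin (p.B + 1) → ℕ → Option α) (flag : Fin n → Fin (p.B + 1) → Bool)
      (mode : Mode α p.B) (k : ℕ), l ≤ p.m + 1 → T c l = p.top g d c l → p.copyOf mode = c →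
      (p.protocol n).rounds (l + 1) (p.conf T (.hot c cs l) g dirty flag act mode d k) =
        PMF.pure (p.conf (fun c' l' => if c' = c ∧ l' < l then p.top g d c l' else T c' l')
          (p.nextCopy cs) g dirty
          (fun i c' => if c' = c ∧ g i c ≤ l then decide (p.top g d c (g i c) = some (d i))
            else flag i c') act (.hot c) d (k + p.hotCost g d c l)) := by
  intro l
  induction l with
  | zero =>
    intro T flag mode k hl hT hm
    rw [Protocol.rounds, p.round_det (srv := ⟨T, .hot c cs 0⟩) (c := some (.hot 0 (T c 0)))
      (f := fun i => p.hotStep ⟨g i, dirty i, flag i, act i, mode⟩ (d i) c 0 (T c 0)) rfl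
      (by rintro c' ⟨⟩; exact hl) (fun i => by rw [← hm]; rfl), PMF.pure_bind, Protocol.rounds]
    congr 1
    refine Protocol.Config.mk.injEq .. |>.mpr ⟨?_, ?_, rfl, ?_⟩
    · simp [absorb]
      rfl
    · funext i
      refine Node.mk.injEq .. |>.mpr ⟨rfl, rfl, ?_, rfl, rfl⟩
      funext c'
      simp only [Nat.le_zero]
      by_cases h : c' = c ∧ g i c = 0
      · simp [h, hT]
      · simp [h]
    · simp [hotCost, repliers, conf, hotStep, hT]
  | succ l ih =>
    intro T flag mode k hl hT hm
    rw [Protocol.rounds, p.round_det (srv := ⟨T, .hot c cs (l + 1)⟩)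
      (c := some (.hot (l + 1) (T c (l + 1))))
      (f := fun i => p.hotStep ⟨g i, dirty i, flag i, act i, mode⟩ (d i) c (l + 1) (T c (l + 1)))
      rfl (by rintro c' ⟨⟩; exact hl) (fun i => by rw [← hm]; rfl), PMF.pure_bind]
    have h1 : p.after (⟨T, .hot c cs (l + 1)⟩ : Server α p.B)
        (some (.hot (l + 1) (T c (l + 1)))) d k
        (fun i => p.hotStep ⟨g i, dirty i, flag i, act i, mode⟩ (d i) c (l + 1) (T c (l + 1))) =
        p.conf (fun c' l' => if c' = c ∧ l' = l then p.top g d c l else T c' l') (.hot c cs l)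
          g dirty (fun i c' => if c' = c ∧ g i c = l + 1 then
            decide (p.top g d c (g i c) = some (d i)) else flag i c') act (.hot c) d
          (k + (1 + #(p.repliers g d c (l + 1)))) := by
      refine Protocol.Config.mk.injEq .. |>.mpr ⟨?_, ?_, rfl, ?_⟩
      · refine Server.mk.injEq .. |>.mpr ⟨?_, rfl⟩
        funext c' l'
        refine if_congr Iff.rfl ?_ rfl
        have := @best_eq_pick α (side α p.B c) n (fun i => g i c) d l
        unfold top
        rw [this]
        congr 1
        ext x
        simp only [hT, hotStep, top, mem_image, mem_filter, mem_univ, true_and, decide_eq_true_eq,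
          Set.mem_ofPred_eq]
      · funext i
        refine Node.mk.injEq .. |>.mpr ⟨rfl, rfl, ?_, rfl, rfl⟩
        funext c'
        refine if_ctx_congr Iff.rfl (fun h => ?_) fun _ => rfl
        rw [hT, h.2]
      · simp [repliers, hotStep, hT, add_assoc]
    change (p.protocol n).rounds (l + 1) (p.after (⟨T, .hot c cs (l + 1)⟩ : Server α p.B)
        (some (.hot (l + 1) (T c (l + 1)))) d k _) = _
    rw [h1, ih _ _ _ _ (by omega) (by simp) rfl]
    congr 1
    refine Protocol.Config.mk.injEq .. |>.mpr ⟨?_, ?_, rfl, ?_⟩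
    · refine Server.mk.injEq .. |>.mpr ⟨?_, rfl⟩
      funext c' l'
      by_cases h : c' = c
      · rcases lt_trichotomy l' l with h' | h' | h'
        · simp [h, h', Nat.lt_succ_of_lt h']
        · simp [h, h']
        · simp [h, show ¬ l' < l by omega, show ¬ l' < l + 1 by omega, show l' ≠ l by omega]
      · simp [h]
    · funext i
      refine Node.mk.injEq .. |>.mpr ⟨rfl, rfl, ?_, rfl, rfl⟩
      funext c'
      by_cases h : c' = c
      · rcases lt_trichotomy (g i c) (l + 1) with h' | h' | h'
        · simp [h, show g i c ≤ l by omega, show g i c ≤ l + 1 by omega]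
        · simp [h, h']
        · simp [h, show ¬ g i c ≤ l by omega, show ¬ g i c ≤ l + 1 by omega,
            show g i c ≠ l + 1 by omega]
      · simp [h]
    · rw [hotCost, hotCost, sum_range_succ _ (l + 1)]
      ring

/-- The changed nodes of height `h` in a copy. -/
def pingers (g : Fin n → Fin (p.B + 1) → ℕ) (dirty : Fin n → Bool) (c : Fin (p.B + 1)) (h : ℕ) :
    Finset (Fin n) :=
  univ.filter fun i => dirty i = true ∧ g i c = h

/-- A bound for the number of messages in the treatment of a copy whose changed nodes have heights
at most `h`, apart from the first one. -/
def copyCost (g : Fin n → Fin (p.B + 1) → ℕ) (dirty : Fin n → Bool) (d : Fin n → α)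
    (c : Fin (p.B + 1)) (h : ℕ) : ℕ :=
  (∑ h' ∈ range (h + 1), if ∀ i, dirty i = true → g i c ≤ h' then #(p.pingers g dirty c h') else 0)
    + ∑ l ∈ range (h + 2), if ∃ i, dirty i = true ∧ l ≤ g i c + 1 then
      1 + #(p.repliers g d c l) else 0

theorem copyCost_succ_ge {g : Fin n → Fin (p.B + 1) → ℕ} {dirty : Fin n → Bool} {d : Fin n → α}
    {c : Fin (p.B + 1)} {h h' : ℕ} (hh : h ≤ h') :
    p.copyCost g dirty d c h ≤ p.copyCost g dirty d c h' :=
  add_le_add (sum_le_sum_of_subset (range_subset_range.2 (by omega)))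
    (sum_le_sum_of_subset (range_subset_range.2 (by omega)))

/-- The round in which changed nodes of height `h` reply. -/
theorem round_cold {g : Fin n → Fin (p.B + 1) → ℕ} {dirty : Fin n → Bool} {act : Fin n → Bool}
    {d : Fin n → α} {c : Fin (p.B + 1)} {cs : List (Fin (p.B + 1))}
    {T : Fin (p.B + 1) → ℕ → Option α} {flag : Fin n → Fin (p.B + 1) → Bool}
    {h : ℕ} {first : Bool} {mode : Mode α p.B} {k : ℕ}
    (hf : first = true ∧ h = p.m ∨ first = false ∧ mode = .cold c h) :
    (p.protocol n).round (p.conf T (.cold c cs h first) g dirty flag act mode d k) =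
      PMF.pure (p.conf T (if (p.pingers g dirty c h).Nonempty then .hot c cs (h + 1) else
        if h = 0 then p.nextCopy cs else .cold c cs (h - 1) false) g dirty flag act
          (.cold c (h - 1)) d (k + (if first = true then 1 else 0) + #(p.pingers g dirty c h))) := by
  rw [p.round_det (srv := (⟨T, .cold c cs h first⟩ : Server α p.B))
    (c := if first then some (.cold c) else none)
    (f := fun i => p.coldStep ⟨g i, dirty i, flag i, act i, mode⟩ c h) rfl
    (fun c' hc' => ?_) fun i => ?_]
  · congr 1
    refine Protocol.Config.mk.injEq .. |>.mpr ⟨?_, rfl, rfl, ?_⟩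
    · cases h <;> simp [absorb, coldStep, pingers, filter_nonempty_iff] <;> rfl
    · cases first <;> simp [coldStep, pingers, conf]
  · cases first <;> simp at hc'
    subst hc'
    trivial
  · rcases hf with ⟨rfl, h0⟩ | ⟨rfl, rfl⟩
    · change PMF.pure (p.coldStep _ c p.m) = _
      rw [← h0]
      rfl
    · rfl

/-- Rounds in which no changed node replies are free. The first replies reveal the largest height
`h` of a changed node, and the entry of level `h + 1`, being unaffected by the changes, is a correct
starting point for `rounds_hot`. If nobody replies, nothing has to be repaired. -/
theorem rounds_cold {g : Fin n → Fin (p.B + 1) → ℕ} {dirty : Fin n → Bool} {act : Fin n → Bool}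
    {d : Fin n → α} {c : Fin (p.B + 1)} {cs : List (Fin (p.B + 1))}
    {T : Fin (p.B + 1) → ℕ → Option α} {flag : Fin n → Fin (p.B + 1) → Bool}
    (hgood : p.AlmostGood T g dirty flag d c) :
    ∀ (h : ℕ) (first : Bool) (mode : Mode α p.B) (k : ℕ), h ≤ p.m →
      (∀ i, dirty i = true → g i c ≤ h) →
      (first = true ∧ h = p.m ∨ first = false ∧ mode = .cold c h) →
      ∃ r ≤ 2 * h + 3, ∃ T' flag' mode' k',
        (p.protocol n).rounds r (p.conf T (.cold c cs h first) g dirty flag act mode d k) =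
          PMF.pure (p.conf T' (p.nextCopy cs) g dirty flag' act mode' d k') ∧
        p.Good T' g flag' d c ∧ (∀ c', c' ≠ c → T' c' = T c' ∧ ∀ i, flag' i c' = flag i c') ∧
        k' ≤ k + (if first = true then 1 else 0) + p.copyCost g dirty d c h := by
  intro h
  induction h using Nat.strong_induction_on with
  | _ h ih =>
  intro first mode k hm hd hf
  have h1 := p.round_cold (d := d) (cs := cs) (T := T) (flag := flag) (act := act) (k := k)
    (g := g) (dirty := dirty) hf
  by_cases hp : (p.pingers g dirty c h).Nonempty
  · rw [if_pos hp] at h1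
    have h2 := p.rounds_hot (g := g) (dirty := dirty) (act := act) (d := d) (cs := cs) (c := c)
      (h + 1) T flag (.cold c (h - 1))
      (k + (if first = true then 1 else 0) + #(p.pingers g dirty c h)) (by omega)
      (hgood.1 _ (by omega) fun i hi => Nat.lt_succ_of_le (hd i hi)) rfl
    have h3 := (rounds_one_add _ h1 _).trans h2
    refine ⟨1 + (h + 2), by omega, _, _, _, _, h3, ⟨?_, ?_⟩, ?_, ?_⟩
    · intro l hl _
      by_cases h' : l < h + 1
      · simp [h']
      · simp only [h', and_false, if_false]
        exact hgood.1 _ hl fun i hi => by have := hd i hi; omega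
    · intro i _
      by_cases h' : g i c ≤ h + 1
      · simp [h']
      · simp only [h', and_false, if_false]
        exact hgood.2 i fun j hj => by have := hd j hj; omega
    · intro c' hc'
      simp [hc']
    · rw [add_assoc _ _ (p.hotCost g d c (h + 1))]
      refine Nat.add_le_add_left (add_le_add ?_ ?_) _
      -- Only the summand for the largest height of a changed node is nonzero for certain; it is
      -- exactly the number of replies received.
      · refine le_trans ?_ (single_le_sum (fun _ _ => Nat.zero_le _) (self_mem_range_succ h))
        rw [if_pos hd]
      · obtain ⟨i, hi⟩ := hp
        rw [pingers, mem_filter] at hi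
        refine sum_le_sum fun l hl => ?_
        rw [if_pos ⟨i, hi.2.1, by rw [mem_range] at hl; omega⟩]
  · rw [if_neg hp] at h1
    have hlt : ∀ i, dirty i = true → g i c < h := fun i hi =>
      lt_of_le_of_ne (hd i hi) fun he => hp ⟨i, mem_filter.2 ⟨mem_univ _, hi, he⟩⟩
    rw [not_nonempty_iff_eq_empty] at hp
    rw [hp, card_empty, add_zero] at h1
    by_cases h0 : h = 0
    · subst h0
      rw [if_pos rfl] at h1
      have h3 := rounds_one_add _ h1 0
      refine ⟨1, by omega, T, flag, _, _, h3, ⟨?_, ?_⟩, fun _ _ => ⟨rfl, fun _ => rfl⟩,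
        Nat.le_add_right _ _⟩
      · intro l hl _
        exact hgood.1 l hl fun i hi => absurd (hlt i hi) (by omega)
      · intro i _
        exact hgood.2 i fun i hi => absurd (hlt i hi) (by omega)
    · rw [if_neg h0] at h1
      obtain ⟨r, hr, T', flag', mode', k', h2, h3, h4, h5⟩ := ih (h - 1) (by omega) false
        (.cold c (h - 1)) (k + if first = true then 1 else 0) (by omega)
        (fun i hi => by have := hlt i hi; omega) (Or.inr ⟨rfl, rfl⟩)
      refine ⟨1 + r, by omega, T', flag', mode', k', ?_, h3, h4, h5.trans ?_⟩
      · rw [rounds_add, Protocol.rounds, h1, PMF.pure_bind, Protocol.rounds, PMF.pure_bind]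
        exact h2
      · simpa using p.copyCost_succ_ge (by omega)

/-- Treating one copy does not touch sketch and flags of the others, so their state is preserved
until their turn. -/
theorem rounds_nextCopy {g : Fin n → Fin (p.B + 1) → ℕ} {dirty : Fin n → Bool}
    {act : Fin n → Bool} {d : Fin n → α} (hg : ∀ i c, g i c ≤ p.m) :
    ∀ (cs : List (Fin (p.B + 1))) (T : Fin (p.B + 1) → ℕ → Option α)
      (flag : Fin n → Fin (p.B + 1) → Bool) (mode : Mode α p.B) (k : ℕ), cs.Nodup →
      (∀ c ∈ cs, p.AlmostGood T g dirty flag d c) →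
      ∃ r ≤ cs.length * (2 * p.m + 3), ∃ T' flag' mode' k',
        (p.protocol n).rounds r (p.conf T (p.nextCopy cs) g dirty flag act mode d k) =
          PMF.pure (p.conf T' .fin g dirty flag' act mode' d k') ∧
        (∀ c ∈ cs, p.Good T' g flag' d c) ∧
        (∀ c, c ∉ cs → T' c = T c ∧ ∀ i, flag' i c = flag i c) ∧
        k' ≤ k + (cs.map fun c => 1 + p.copyCost g dirty d c p.m).sum := by
  intro cs
  induction cs with
  | nil =>
    intro T flag mode k _ _
    exact ⟨0, by simp, T, flag, mode, k, rfl, by simp, fun _ _ => ⟨rfl, fun _ => rfl⟩, by simp⟩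
  | cons c cs ih =>
    intro T flag mode k hn hgood
    rw [List.nodup_cons] at hn
    obtain ⟨r, hr, T', flag', mode', k', h2, h3, h4, h5⟩ := p.rounds_cold (act := act) (cs := cs)
      (hgood c (by simp)) p.m true mode k le_rfl (fun i _ => hg i c) (Or.inl ⟨rfl, rfl⟩)
    have h6 : ∀ c' ∈ cs, p.AlmostGood T' g dirty flag' d c' := by
      intro c' hc'
      obtain ⟨h7, h8⟩ := h4 c' fun h => hn.1 (h ▸ hc')
      have h9 := hgood c' (by simp [hc'])
      refine ⟨fun l hl hA => ?_, fun i hi => ?_⟩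
      · rw [h7]
        exact h9.1 l hl hA
      · rw [h8]
        exact h9.2 i hi
    obtain ⟨r', hr', T'', flag'', mode'', k'', g2, g3, g4, g5⟩ := ih T' flag' mode' k' hn.2 h6
    refine ⟨r + r', ?_, T'', flag'', mode'', k'', ?_, ?_, ?_, ?_⟩
    · rw [List.length_cons, add_mul, one_mul]
      omega
    · exact (rounds_pure_trans _ h2).trans g2
    · intro c' hc'
      rcases List.mem_cons.1 hc' with rfl | hc'
      · obtain ⟨h7, h8⟩ := g4 c' hn.1
        refine ⟨fun l hl hA => ?_, fun i hi => ?_⟩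
        · rw [h7]
          exact h3.1 l hl hA
        · rw [h8]
          exact h3.2 i hi
      · exact g3 c' hc'
    · intro c' hc'
      rw [List.mem_cons, not_or] at hc'
      refine ⟨(g4 c' hc'.2).1.trans (h4 c' hc'.1).1, fun i => ?_⟩
      rw [(g4 c' hc'.2).2, (h4 c' hc'.1).2]
    · rw [List.map_cons, List.sum_cons]
      simp only [if_true] at h5
      omega

/-- A bound for the number of messages of a REFRESH. -/
def refreshCost (g : Fin n → Fin (p.B + 1) → ℕ) (dirty : Fin n → Bool) (d : Fin n → α) : ℕ :=
  1 + ∑ c, (1 + p.copyCost g dirty d c p.m)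

/-- After a REFRESH, the sketch is correct. -/
theorem rounds_refresh {g : Fin n → Fin (p.B + 1) → ℕ} {dirty : Fin n → Bool}
    {act : Fin n → Bool} {d : Fin n → α} (hg : ∀ i c, g i c ≤ p.m)
    {T : Fin (p.B + 1) → ℕ → Option α} {flag : Fin n → Fin (p.B + 1) → Bool} {mode : Mode α p.B}
    {k R : ℕ} (hgood : ∀ c, p.AlmostGood T g dirty flag d c)
    (hR : (p.B + 1) * (2 * p.m + 3) + 1 ≤ R) :
    ∃ T' flag' k',
      (p.protocol n).rounds R (p.conf T (p.nextCopy (List.finRange (p.B + 1))) g dirty flag act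
          mode d k) =
        PMF.pure (p.conf T' (.idle none) g (fun _ => false) flag' act .rest d k') ∧
      (∀ c, p.Good T' g flag' d c) ∧ k' ≤ k + p.refreshCost g dirty d := by
  obtain ⟨r, hr, T', flag', mode', k', h2, h3, -, h5⟩ := p.rounds_nextCopy (act := act) hg
    (List.finRange (p.B + 1)) T flag mode k (List.nodup_finRange _) fun c _ => hgood c
  rw [List.length_finRange] at hr
  have h6 : (p.protocol n).round (p.conf T' .fin g dirty flag' act mode' d k') =
      PMF.pure (p.conf T' (.idle none) g (fun _ => false) flag' act .rest d (k' + 1)) := by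
    rw [p.round_det (srv := (⟨T', .fin⟩ : Server α p.B)) (c := some .fin)
      (f := fun i => (⟨g i, false, flag' i, act i, .rest⟩, false)) rfl
      (fun c' hc' => by cases hc'; trivial) fun i => rfl]
    simp [after, conf, absorb]
  refine ⟨T', flag', k' + 1, ?_, fun c => h3 c (List.mem_finRange c), ?_⟩
  -- One round for the final broadcast, which resets the marks of changed nodes; the remaining `q`
  -- rounds are idle.
  · obtain ⟨q, rfl⟩ : ∃ q, R = r + (1 + q) := ⟨R - r - 1, by omega⟩
    rw [rounds_pure_trans _ h2, rounds_add, Protocol.rounds, h6, PMF.pure_bind, Protocol.rounds,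
      PMF.pure_bind, rounds_fixed _ p.round_idle]
  · have h7 : ((List.finRange (p.B + 1)).map fun c => 1 + p.copyCost g dirty d c p.m).sum =
        ∑ c, (1 + p.copyCost g dirty d c p.m) := (Fin.sum_univ_def _).symm
    rw [refreshCost, ← h7]
    omega

end Params

end Monitoring

end

noncomputable section

namespace Monitoring

open Finset

/-! ### The law of the states between operations -/

theorem le_of_mem_support_geom {m h : ℕ} (hh : h ∈ (geom m).support) : h ≤ m := by
  induction m generalizing h with
  | zero =>
    rw [geom, PMF.support_pure, Set.mem_singleton_iff] at hh
    omega
  | succ m ih =>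
    rw [geom, PMF.mem_support_bind_iff] at hh
    obtain ⟨b, -, hb⟩ := hh
    cases b
    · simp at hb
      omega
    · simp only [if_true, PMF.support_map, Set.mem_image] at hb
      obtain ⟨a, ha, rfl⟩ := hb
      exact Nat.succ_le_succ (ih ha)

/-- The nodes whose items have been replaced. -/
def changed {α : Type u} {n : ℕ} (ws : List (Fin n × α)) (i : Fin n) : Bool := decide (i ∈ ws.map Prod.fst)

theorem itemsAfter_eq_of_not_changed {α : Type u} {n : ℕ} {i : Fin n} :
    ∀ (ws : List (Fin n × α)) (d : Fin n → α), changed ws i = false → itemsAfter d ws i = d i := by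
  intro ws
  induction ws with
  | nil => intro d _; rfl
  | cons w ws ih =>
    intro d h
    simp only [changed, List.map_cons, List.mem_cons, decide_eq_false_iff_not, not_or] at h
    change itemsAfter (Function.update d w.1 w.2) ws i = _
    rw [ih _ (by simpa [changed] using h.2), Function.update_of_ne h.1]

namespace Params

variable (p : Params) {α : Type u} [LinearOrder α] {n : ℕ}

/-- The law of the heights. -/
def heights (n : ℕ) : PMF (Fin n → Fin (p.B + 1) → ℕ) :=
  independent n fun _ => independent (p.B + 1) fun _ => geom p.m

theorem le_of_mem_support_heights {g : Fin n → Fin (p.B + 1) → ℕ}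
    (hg : g ∈ (p.heights n).support) (i : Fin n) (c : Fin (p.B + 1)) : g i c ≤ p.m := by
  rw [heights, mem_support_independent] at hg
  have := hg i
  rw [mem_support_independent] at this
  exact le_of_mem_support_geom (this c)

/-- A state between two operations. -/
def Resting (g : Fin n → Fin (p.B + 1) → ℕ) (d : Fin n → α) (s : (p.protocol (α := α) n).Config) :
    Prop :=
  ∃ T o flag act k, s = p.conf T (.idle o) g (fun _ => false) flag act .rest d k ∧
    ∀ c, p.Good T g flag d c

/-- UPDATEs are deterministic and silent: only items and marks change. -/
theorem updates_conf {T : Fin (p.B + 1) → ℕ → Option α} {stage : Stage α p.B}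
    {g : Fin n → Fin (p.B + 1) → ℕ} {flag : Fin n → Fin (p.B + 1) → Bool} {act : Fin n → Bool}
    {mode : Mode α p.B} {k : ℕ} :
    ∀ (ws : List (Fin n × α)) (dirty : Fin n → Bool) (d : Fin n → α),
      (p.protocol n).updates ws (p.conf T stage g dirty flag act mode d k) =
        PMF.pure (p.conf T stage g (fun i => dirty i || changed ws i) flag act mode
          (itemsAfter d ws) k) := by
  intro ws
  induction ws with
  | nil =>
    intro dirty d
    simp [Protocol.updates, changed, itemsAfter]
  | cons w ws ih =>
    intro dirty d
    have h1 : (p.protocol n).update (p.conf T stage g dirty flag act mode d k) w =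
        PMF.pure (p.conf T stage g (Function.update dirty w.1 true) flag act mode
          (Function.update d w.1 w.2) k) := by
      refine (PMF.pure_bind _ _).trans ?_
      congr 1
      refine Protocol.Config.mk.injEq .. |>.mpr ⟨rfl, ?_, rfl, rfl⟩
      funext i
      by_cases h : i = w.1
      · subst h
        simp only [conf, Function.update_self]
        exact Function.update_self ..
      · simp only [conf, Function.update_of_ne h]
        exact Function.update_of_ne h ..
    rw [Protocol.updates, h1, PMF.pure_bind, ih]
    congr 2
    funext i
    by_cases h : i = w.1
    · subst h
      simp [changed]
    · simp only [Function.update_of_ne h, changed, List.map_cons, List.mem_cons, h, false_or]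

/-- Changing the items of some nodes does not affect the sketch above their heights. -/
theorem Good.almostGood {T : Fin (p.B + 1) → ℕ → Option α} {g : Fin n → Fin (p.B + 1) → ℕ}
    {dirty : Fin n → Bool} {flag : Fin n → Fin (p.B + 1) → Bool} {d d' : Fin n → α}
    {c : Fin (p.B + 1)} (h : p.Good T g flag d c) (hd : ∀ i, dirty i = false → d' i = d i) :
    p.AlmostGood T g dirty flag d' c := by
  have h1 : ∀ l, (∀ i, dirty i = true → g i c < l) → p.top g d' c l = p.top g d c l := by
    intro l hl
    refine @best_congr α (side α p.B c) n _ _ _ _ fun i hi => hd i ?_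
    by_contra h'
    exact absurd (hl i (by simpa using h')) (by omega)
  refine ⟨fun l hl hA => ?_, fun i hi => ?_⟩
  · rw [h1 l hA]
    exact h.1 l hl trivial
  · rw [h1 _ hi, hd i, ← h.2 i trivial]
    by_contra h'
    exact absurd (hi i (by simpa using h')) (lt_irrefl _)

theorem runOp_eq {o : Op} {T : Fin (p.B + 1) → ℕ → Option α} {stage : Stage α p.B}
    {g : Fin n → Fin (p.B + 1) → ℕ} {dirty : Fin n → Bool} {flag : Fin n → Fin (p.B + 1) → Bool}
    {act : Fin n → Bool} {mode : Mode α p.B} {d : Fin n → α} {k : ℕ} :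
    (p.protocol n).runOp o (p.conf T stage g dirty flag act mode d k) =
      (p.protocol n).rounds p.R (p.conf T (match o with
        | .setUp => .draw
        | .refresh => p.nextCopy (List.finRange (p.B + 1))
        | .answer q => .ask q) g dirty flag act mode d k) := rfl

theorem untilRefresh_eq (hR : (p.B + 1) * (2 * p.m + 3) + 1 ≤ p.R)
    {g : Fin n → Fin (p.B + 1) → ℕ} (hg : ∀ i c, g i c ≤ p.m) {d : Fin n → α}
    {s : (p.protocol (α := α) n).Config} (hs : p.Resting g d s) (e : Epoch α n) :
    ∃ T flag act k, (p.protocol n).untilRefresh e s =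
        PMF.pure (p.conf T (.idle none) g (fun _ => false) flag act .rest (itemsAfter d e.ups) k) ∧
      (∀ c, p.Good T g flag (itemsAfter d e.ups) c) ∧
      k ≤ p.refreshCost g (changed e.ups) (itemsAfter d e.ups) := by
  obtain ⟨T, o, flag, act, k, rfl, hgood⟩ := hs
  obtain ⟨T', flag', k', h1, h2, h3⟩ := p.rounds_refresh (act := act) (k := 0) hg (mode := .rest)
    (fun c => Good.almostGood p (hgood c) (dirty := changed e.ups) (d' := itemsAfter d e.ups)
      fun i hi => itemsAfter_eq_of_not_changed _ _ hi) hR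
  refine ⟨T', flag', act, k', ?_, h2, by simpa using h3⟩
  rw [Protocol.untilRefresh]
  have h4 := p.updates_conf (T := T) (stage := .idle o) (g := g) (flag := flag) (act := act)
    (mode := .rest) (k := 0) e.ups (fun _ => false) d
  refine (congrArg (fun q => PMF.bind q _) h4).trans ?_
  rw [PMF.pure_bind]
  refine Eq.trans ?_ h1
  simp only [Bool.false_or]
  rfl

/-- INITIALIZE. -/
theorem start_eq (hR : (p.B + 1) * (2 * p.m + 3) + 2 ≤ p.R) (d : Fin n → α) :
    ∃ F : (Fin n → Fin (p.B + 1) → ℕ) → (p.protocol (α := α) n).Config,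
      (p.protocol n).start d = (p.heights n).map F ∧ ∀ g ∈ (p.heights n).support,
        p.Resting g d (F g) ∧ (F g).msgs ≤ 1 + p.refreshCost g (fun _ => true) d := by
  have h1 : ∀ g : Fin n → Fin (p.B + 1) → ℕ, (∀ i c, g i c ≤ p.m) → ∃ T' flag' k',
      (p.protocol n).rounds (p.R - 1) (p.conf (fun _ _ => none)
        (p.nextCopy (List.finRange (p.B + 1))) g (fun _ => true) (fun _ _ => false)
          (fun _ => false) .rest d 1) = PMF.pure (p.conf T' (.idle none) g (fun _ => false) flag'
          (fun _ => false) .rest d k') ∧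
      (∀ c, p.Good T' g flag' d c) ∧ k' ≤ 1 + p.refreshCost g (fun _ => true) d := by
    intro g hg
    -- INITIALIZE is a REFRESH in which every node counts as changed: the empty sketch is correct
    -- above all heights.
    refine p.rounds_refresh hg (fun c => ⟨fun l hl hA => ?_, fun i hi => ?_⟩) (by omega)
    · exact ((@best_eq_none_iff α (side α p.B c) n _ _ _).2 fun i => hA i rfl).symm
    · exact absurd (hi i rfl) (lt_irrefl _)
  choose! T' flag' k' h2 h3 h4 using h1
  refine ⟨fun g => p.conf (T' g) (.idle none) g (fun _ => false) (flag' g) (fun _ => false) .rest d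
    (k' g), ?_, fun g hg => ⟨⟨_, _, _, _, _, rfl, h3 g (p.le_of_mem_support_heights hg)⟩,
      h4 g (p.le_of_mem_support_heights hg)⟩⟩
  have h5 : (p.protocol n).round (p.conf (fun _ _ => none) .draw (fun _ _ => 0) (fun _ => true)
      (fun _ _ => false) (fun _ => false) .rest d 0) = (p.heights n).map fun g =>
      p.conf (fun _ _ => none) (p.nextCopy (List.finRange (p.B + 1))) g (fun _ => true)
        (fun _ _ => false) (fun _ => false) .rest d 1 := by
    rw [p.round_eq]
    · change (PMF.pure _).bind _ = _
      rw [PMF.pure_bind]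
      refine (map_of_independent (q := fun _ => independent (p.B + 1) fun _ => geom p.m)
        (fun i => rfl)).trans ?_
      unfold heights
      congr 1
      funext g
      simp [after, conf, absorb]
    · intro r hr c hc
      change r ∈ (PMF.pure _).support at hr
      rw [PMF.support_pure, Set.mem_singleton_iff] at hr
      subst hr
      cases hc
      trivial
  have h6 : (p.protocol n).start d = (p.protocol n).rounds (p.R - 1 + 1)
      (p.conf (fun _ _ => none) .draw (fun _ _ => 0) (fun _ => true)
      (fun _ _ => false) (fun _ => false) .rest d 0) := by
    rw [Nat.sub_add_cancel (by omega)]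
    rfl
  rw [h6, Protocol.rounds, h5, PMF.bind_map]
  refine bind_congr_support fun g hg => ?_
  exact h2 g (p.le_of_mem_support_heights hg)

end Params

end Monitoring

end

noncomputable section

namespace Monitoring

open Finset

/-! ### The search -/

section smallest

variable {α : Type u} [LinearOrder α]

/-- The smallest elements can be read off from a subset that contains everything up to a
threshold, if it is large enough. -/
theorem smallest_eq_of_subset {t : ℕ} {S P : Finset α} {X : Option α} (hS : S ⊆ P)
    (hX : ∀ x ∈ P, UpTo X x → x ∈ S) (ht : X = none ∨ t ≤ #(S.filter (UpTo X))) :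
    smallest t S = smallest t P := by
  have h1 : ∀ x ∈ P, UpTo X x → (S.filter fun y => y ≤ x) = P.filter fun y => y ≤ x := by
    intro x _ hx
    ext y
    simp only [mem_filter]
    exact ⟨fun h => ⟨hS h.1, h.2⟩, fun h => ⟨hX y h.1 (hx.mono h.2), h.2⟩⟩
  have h2 : ∀ x ∈ P, ¬ UpTo X x → t < #((insert x S).filter fun y => y ≤ x) := by
    intro x hx hn
    cases X with
    | none => exact absurd trivial hn
    | some z =>
      simp only [upTo_some, not_le] at hn
      rcases ht with ht | ht
      · cases ht
      · have h3 : insert x (S.filter (UpTo (some z))) ⊆ (insert x S).filter fun y => y ≤ x := by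
          intro y hy
          rw [mem_insert, mem_filter, upTo_some] at hy
          rcases hy with rfl | hy
          · simp
          · exact mem_filter.2 ⟨mem_insert_of_mem hy.1, hy.2.trans hn.le⟩
        have h4 := card_le_card h3
        rw [card_insert_of_notMem (by simp [hn])] at h4
        omega
  ext x
  simp only [smallest, mem_filter]
  constructor
  · rintro ⟨hx, hc⟩
    refine ⟨hS hx, ?_⟩
    by_cases hu : UpTo X x
    · rwa [← h1 x (hS hx) hu]
    · have := h2 x (hS hx) hu
      rw [insert_eq_of_mem hx] at this
      omega
  · rintro ⟨hx, hc⟩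
    by_cases hu : UpTo X x
    · exact ⟨hX x hx hu, by rwa [h1 x hx hu]⟩
    · have h3 := h2 x hx hu
      have h4 := card_le_card (filter_subset_filter (fun y => y ≤ x) (insert_subset hx hS))
      omega

end smallest

namespace Params

variable (p : Params) {α : Type u} [LinearOrder α] {n : ℕ}

/-- The members that reply become inactive. -/
theorem round_test {T : Fin (p.B + 1) → ℕ → Option α} {k : Core α}
    {g : Fin n → Fin (p.B + 1) → ℕ} {dirty : Fin n → Bool} {flag : Fin n → Fin (p.B + 1) → Bool}
    {U : Finset (Fin n)} {mode : Mode α p.B} {d : Fin n → α} {c : ℕ} (he : k.e ≤ p.E)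
    (hm : k.fresh = false → mode = .test k.st.head? k.e) :
    (p.protocol n).round (p.conf T (.test k) g dirty flag (fun i => decide (i ∈ U)) mode d c) =
      (sample ((1 / 2) ^ k.e) (cand d U k.st.head?)).map fun R =>
        p.conf T (p.coreNext k (R.image d)) g dirty flag (fun i => decide (i ∈ U \ R))
          (p.testMode k.st.head? k.e) d (c + (if k.fresh = true then 1 else 0) + #R) := by
  rw [p.round_eq]
  · change (PMF.pure _).bind _ = _
    rw [PMF.pure_bind]
    refine (map_of_independent (q := fun i => if i ∈ cand d U k.st.head? then
      flip ((1 / 2) ^ k.e) else PMF.pure false) (g := fun i b =>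
        ((⟨g i, dirty i, flag i, decide (i ∈ U) && !b, p.testMode k.st.head? k.e⟩ : Node α p.B), b))
      (fun i => ?_)).trans ?_
    · have h1 : p.nodeStep (⟨g i, dirty i, flag i, decide (i ∈ U), mode⟩ : Node α p.B) (d i)
          (if k.fresh then some (.test k.e k.st.head?) else none) =
          p.testStep ⟨g i, dirty i, flag i, decide (i ∈ U), mode⟩ (d i) k.st.head? k.e := by
        cases hf : k.fresh with
        | true => rfl
        | false =>
          rw [hm hf]
          rfl
      refine h1.trans ?_
      rw [testStep]
      congr 1
      refine if_congr ?_ rfl rfl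
      simp [cand]
    · rw [sample, PMF.map_comp]
      congr 1
      funext b
      simp only [Function.comp_apply, after]
      refine Protocol.Config.mk.injEq .. |>.mpr ⟨rfl, ?_, rfl, ?_⟩
      · funext i
        refine Node.mk.injEq .. |>.mpr ⟨rfl, rfl, rfl, ?_, rfl⟩
        by_cases h : i ∈ U <;> simp [h]
      · cases k.fresh <;> simp [conf]
  · intro r hr c' hc'
    change r ∈ (PMF.pure _).support at hr
    rw [PMF.support_pure, Set.mem_singleton_iff] at hr
    subst hr
    change (if k.fresh then some (Cmd.test k.e k.st.head?) else none) = some c' at hc'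
    cases hf : k.fresh <;> simp [hf] at hc'
    subst hc'
    exact he

/-- The state of the server fits to the set `U` of active nodes. -/
structure Fitting (d : Fin n → α) (Pop : Finset (Fin n)) (t : ℕ) (U : Finset (Fin n))
    (k : Core α) : Prop where
  subset : U ⊆ Pop
  known : k.known = (Pop \ U).image d
  t : k.t = t
  e : k.e ≤ p.E
  i : k.i ≤ p.N
  fresh : k.fresh = true → k.ph ≠ 0 → k.e = p.E
  last : k.ph = 0 → k.st = [] ∧ k.e = 0 ∧ k.fresh = true

variable {p} {d : Fin n → α} {Pop : Finset (Fin n)} {t : ℕ} {U R : Finset (Fin n)} {k : Core α}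

theorem card_filter_image (hd : Function.Injective d) (S : Finset (Fin n)) (X : Option α) :
    #((S.image d).filter (UpTo X)) = #(S.filter fun i => UpTo X (d i)) := by
  rw [filter_image, card_image_of_injective _ hd]

theorem Fitting.known_union (h : p.Fitting d Pop t U k) (hR : R ⊆ U) :
    k.known ∪ R.image d = (Pop \ (U \ R)).image d := by
  rw [h.known, ← image_union]
  congr 1
  ext i
  have h1 := @h.subset i
  have h2 := @hR i
  simp only [mem_union, mem_sdiff]
  tauto

/-- The server counts items and the analysis counts nodes; distinctness of the items makes the two
agree. -/
theorem Fitting.done_iff (hd : Function.Injective d) (h : p.Fitting d Pop t U k) (hR : R ⊆ U) :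
    Done k (R.image d) ↔ k.e = 0 ∧ Final d Pop t (U \ R) k.st.head? := by
  rw [Done, h.known_union hR, card_filter_image hd, h.t, Final]

theorem Fitting.abort_iff (hd : Function.Injective d) (h : p.Fitting d Pop t U k) (e : ℕ) :
    ((R.image d).Nonempty ∧
      k.t - #(k.known.filter (UpTo k.st.head?)) ≤ 2 * #(R.image d) * 2 ^ (e + 1)) ↔
      Abort d Pop t U k.st.head? (e + 1) R := by
  rw [h.known, card_filter_image hd, h.t, card_image_of_injective _ hd, Abort, need,
    image_nonempty]

end Params

end Monitoring

end

noncomputable section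

namespace Monitoring

open Finset

set_option linter.unusedSectionVars false

/-! ### Phases of a search, and the potential across restarts -/

namespace Params

variable (p : Params) {α : Type u} [LinearOrder α] {n : ℕ}

/-- The share of a round in the potential. -/
def tau : ℝ := 1 / (p.E + 1)

theorem tau_nonneg : 0 ≤ p.tau := by unfold tau; positivity

theorem tau_le : (p.E + 1) * p.tau ≤ 1 := by
  unfold tau
  rw [mul_one_div_cancel]
  positivity

/-- The potential of a search within a phase. -/
def potential (d : Fin n → α) (Pop : Finset (Fin n)) (t : ℕ) (U : Finset (Fin n)) (k : Core α) :
    ℝ :=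
  if k.fresh = true then 1 + start d Pop t U k.st else mid d Pop t p.tau k.st k.e U

/-- The weight of a phase. -/
def weight (n ph : ℕ) : ℝ := 1 + (n + 1) / 2 ^ ph

theorem one_le_weight (n ph : ℕ) : 1 ≤ weight n ph := by
  unfold weight
  have : (0 : ℝ) ≤ (n + 1) / 2 ^ ph := by positivity
  linarith

/-- The expected number of messages that are not accounted for by the output. -/
def future (d : Fin n → α) (Pop : Finset (Fin n)) (t : ℕ) (U : Finset (Fin n)) (k : Core α) : ℝ :=
  if k.ph = 0 then 1 + #(U.filter fun i => ¬ Low d Pop t (some (d i)))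
  else weight n k.ph * (p.potential d Pop t U k + (p.N - k.i) * p.tau)

/-- The number of remaining rounds. -/
def left (k : Core α) : ℕ := if k.ph = 0 then 1 else (k.ph - 1) * (p.N + 1) + k.i + 2

variable {p} {d : Fin n → α} {Pop : Finset (Fin n)} {t : ℕ} {U R : Finset (Fin n)} {k : Core α}

theorem potential_nonneg : 0 ≤ p.potential d Pop t U k := by
  unfold potential
  split_ifs
  · have := start_nonneg (d := d) (Pop := Pop) (t := t) U k.st
    linarith
  · exact mid_nonneg p.tau_nonneg _ _ _

theorem Fitting.future_nonneg (h : p.Fitting d Pop t U k) : 0 ≤ p.future d Pop t U k := by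
  unfold future
  split_ifs
  · positivity
  · have h1 := one_le_weight n k.ph
    have h2 := potential_nonneg (p := p) (d := d) (Pop := Pop) (t := t) (U := U) (k := k)
    have h3 : (k.i : ℝ) ≤ p.N := by exact_mod_cast h.i
    have h4 := p.tau_nonneg
    have h5 : 0 ≤ (p.N - k.i : ℝ) * p.tau := mul_nonneg (by linarith) h4
    exact mul_nonneg (by linarith) (by linarith)

theorem control_ph (k : Core α) (I : Finset α) : (p.control k I).ph = k.ph := by
  unfold control
  split
  · rfl
  · split_ifs <;> rfl

theorem control_i (k : Core α) (I : Finset α) : (p.control k I).i = k.i := by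
  unfold control
  split
  · rfl
  · split_ifs <;> rfl

theorem Fitting.control (h : p.Fitting d Pop t U k) (hR : R ⊆ U) (hph : k.ph ≠ 0) :
    p.Fitting d Pop t (U \ R) (p.control k (R.image d)) := by
  have h1 := h.known_union hR
  have h2 := h.e
  have h3 : U \ R ⊆ Pop := sdiff_subset.trans h.subset
  unfold Params.control
  split
  · exact ⟨h3, h1, h.t, le_rfl, h.i, fun _ _ => rfl, fun h' => absurd h' hph⟩
  · rename_i e he
    split_ifs
    · exact ⟨h3, h1, h.t, le_rfl, h.i, fun _ _ => rfl, fun h' => absurd h' hph⟩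
    · exact ⟨h3, h1, h.t, by simp only; omega, h.i, fun h' => absurd h' (by simp),
        fun h' => absurd h' hph⟩

theorem tick_succ {t : ℕ} {kn : Finset α} {st : List α} {e : ℕ} {f : Bool} {i ph : ℕ} :
    p.tick (⟨t, kn, st, e, f, i + 1, ph + 1⟩ : Core α) = ⟨t, kn, st, e, f, i, ph + 1⟩ := rfl

theorem tick_last {t : ℕ} {kn : Finset α} {st : List α} {e : ℕ} {f : Bool} :
    p.tick (⟨t, kn, st, e, f, 0, 1⟩ : Core α) = ⟨t, kn, [], 0, true, 0, 0⟩ := rfl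

theorem tick_next {t : ℕ} {kn : Finset α} {st : List α} {e : ℕ} {f : Bool} {ph : ℕ} :
    p.tick (⟨t, kn, st, e, f, 0, ph + 2⟩ : Core α) = ⟨t, kn, [], p.E, true, p.N, ph + 1⟩ := rfl

theorem Fitting.tick (h : p.Fitting d Pop t U k) (hph : k.ph ≠ 0) :
    p.Fitting d Pop t U (p.tick k) := by
  have hi := h.i
  obtain ⟨t', kn, st, e, f, i, ph⟩ := k
  match ph, i, hph with
  | ph + 1, i + 1, _ =>
    rw [tick_succ]
    exact ⟨h.subset, h.known, h.t, h.e, (Nat.le_succ i).trans hi, h.fresh, fun h' => by simp at h'⟩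
  | 1, 0, _ =>
    rw [tick_last]
    exact ⟨h.subset, h.known, h.t, Nat.zero_le _, Nat.zero_le _, fun _ h' => absurd rfl h',
      fun _ => ⟨rfl, rfl, rfl⟩⟩
  | ph + 2, 0, _ =>
    rw [tick_next]
    exact ⟨h.subset, h.known, h.t, le_rfl, le_rfl, fun _ _ => rfl, fun h' => by simp at h'⟩

theorem left_tick (hph : k.ph ≠ 0) : p.left (p.tick k) + 1 = p.left k := by
  obtain ⟨t, kn, st, e, f, i, ph⟩ := k
  match ph, i, hph with
  | ph + 1, i + 1, _ =>
    simp [tick_succ, left]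
    ring
  | 1, 0, _ => simp [tick_last, left]
  | ph + 2, 0, _ =>
    simp [tick_next, left]
    ring

/-- The decision of the server and the case distinction in `midNext` are the same; a new threshold
is charged `1` for its announcement. -/
theorem Fitting.potential_control (hd : Function.Injective d) (h : p.Fitting d Pop t U k)
    (hR : R ⊆ U) (hD : ¬ Done k (R.image d)) :
    p.potential d Pop t (U \ R) (p.control k (R.image d)) =
      midNext d Pop t p.tau k.st U k.e R := by
  rw [h.done_iff hd hR, not_and] at hD
  unfold Params.control
  split
  · rename_i he
    rw [he, midNext, if_neg (hD he)]
    simp [potential]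
  · rename_i e he
    rw [if_congr (h.abort_iff hd e) rfl rfl, he, midNext]
    split_ifs with hA
    · simp [potential]
    · simp [potential]

/-- Going to the next phase at most doubles the weight. -/
theorem weight_le (n ph : ℕ) : weight n ph ≤ 2 * weight n (ph + 1) := by
  unfold weight
  rw [pow_succ]
  have : ((n : ℝ) + 1) / 2 ^ ph = 2 * ((n + 1) / (2 ^ ph * 2)) := by field_simp
  linarith

theorem start_nil_le_of_card (U : Finset (Fin n)) :
    start d Pop t U [] ≤ 2 * bigA * harm n + 3 := by
  refine (start_nil_le U).trans ?_
  have h1 : harm #U ≤ harm n := harm_mono (by simpa using card_le_univ U)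
  have := bigA_pos
  gcongr

/-- The term `(p.N - k.i) * p.tau` is the credit of the rounds used in the current phase. When the
phase is exhausted, the credit is at least `p.N * p.tau`, enough for twice the potential of an empty
stack, hence for a restart at the next weight. -/
theorem Fitting.future_tick (h : p.Fitting d Pop t U k) (hph : k.ph ≠ 0)
    (hN : 2 * (2 * bigA * harm n + 4) ≤ p.N * p.tau) :
    p.future d Pop t U (p.tick k) ≤
      weight n k.ph * (p.potential d Pop t U k + (p.N - k.i) * p.tau + p.tau) := by
  have h2 := potential_nonneg (p := p) (d := d) (Pop := Pop) (t := t) (U := U) (k := k)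
  have h3 := p.tau_nonneg
  obtain ⟨t', kn, st, e, f, i, ph⟩ := k
  match ph, i, hph with
  | ph + 1, i + 1, _ =>
    refine le_of_eq ?_
    have h4 : p.potential d Pop t U ⟨t', kn, st, e, f, i, ph + 1⟩ =
        p.potential d Pop t U ⟨t', kn, st, e, f, i + 1, ph + 1⟩ := rfl
    rw [tick_succ, future, if_neg (Nat.succ_ne_zero ph), h4]
    push_cast
    ring
  -- In the last round at most `n` superfluous replies and one broadcast occur, and `weight n 1 * 2`
  -- exceeds `n + 1`.
  | 1, 0, _ =>
    simp only [tick_last, future, if_true]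
    have h1 : (#(U.filter fun i => ¬ Low d Pop t (some (d i))) : ℝ) ≤ n := by
      exact_mod_cast (card_le_univ _).trans (by simp)
    have h4 : 2 * (2 * bigA * 0 + 4) ≤ p.N * p.tau := by
      refine le_trans ?_ hN
      have := harm_nonneg n
      have := bigA_pos
      gcongr
    have h5 : weight n 1 * 2 ≤ weight n 1 * (p.potential d Pop t U ⟨t', kn, st, e, f, 0, 1⟩ +
        (p.N - (0 : ℕ)) * p.tau + p.tau) := by
      refine mul_le_mul_of_nonneg_left ?_ (by linarith [one_le_weight n 1])
      push_cast
      linarith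
    refine le_trans ?_ h5
    unfold weight
    linarith
  -- The factor `2` from `weight_le` is the one in the hypothesis on `p.N`.
  | ph + 2, 0, _ =>
    rw [tick_next, future, if_neg (Nat.succ_ne_zero ph)]
    rw [potential, if_pos rfl]
    have h4 := start_nil_le_of_card (d := d) (Pop := Pop) (t := t) U
    have h5 := weight_le n (ph + 1)
    have h6 := one_le_weight n (ph + 1 + 1)
    have h7 := start_nonneg (d := d) (Pop := Pop) (t := t) U []
    calc weight n (ph + 1) * (1 + start d Pop t U [] + (p.N - p.N : ℝ) * p.tau)
        ≤ 2 * weight n (ph + 1 + 1) * (1 + start d Pop t U [] + (p.N - p.N : ℝ) * p.tau) := by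
          refine mul_le_mul_of_nonneg_right h5 ?_
          simp only [sub_self, zero_mul]
          linarith
      _ = weight n (ph + 1 + 1) * (2 * (1 + start d Pop t U [])) := by ring
      _ ≤ _ := by
          refine mul_le_mul_of_nonneg_left ?_ (by linarith)
          push_cast
          linarith

end Params

end Monitoring

end

noncomputable section

namespace Monitoring

open Finset

set_option linter.unusedSectionVars false

/-! ### Correctness and expected cost of a complete search -/

namespace Params

variable {p : Params} {α : Type u} [LinearOrder α] {n : ℕ} {d : Fin n → α} {Pop : Finset (Fin n)}
  {t : ℕ} {U R : Finset (Fin n)} {k : Core α}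

/-- The expected potential does not increase by more than what is sent. -/
theorem Fitting.step (hd : Function.Injective d) (h : p.Fitting d Pop t U k)
    (hE : 4096 * n ≤ 2 ^ p.E) (hN : 2 * (2 * bigA * harm n + 4) ≤ p.N * p.tau) :
    avg ((1 / 2) ^ k.e) (cand d U k.st.head?) (fun R => (if k.fresh = true then 1 else 0) + #R +
      if Done k (R.image d) then 0 else open' d Pop t (U \ R) +
        p.future d Pop t (U \ R) (p.tick (p.control k (R.image d)))) ≤
      open' d Pop t U + p.future d Pop t U k := by
  -- After the last phase the threshold is infinite and the exponent is `0`, so all active members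
  -- reply and the search is over.
  by_cases hph : k.ph = 0
  · obtain ⟨h1, h2, h3⟩ := h.last hph
    have h4 : cand d U k.st.head? = U := by simp [h1, cand]
    rw [h2, pow_zero, avg_one, h4, if_pos h3, if_pos, future, if_pos hph, open']
    · have h5 : (#U : ℝ) = #(U.filter fun i => Low d Pop t (some (d i))) +
          #(U.filter fun i => ¬ Low d Pop t (some (d i))) := by
        exact_mod_cast (card_filter_add_card_filter_not _).symm
      linarith
    · rw [h.done_iff hd subset_rfl]
      exact ⟨h2, Or.inl (by simp [h1])⟩
  · have h0 : (0 : ℝ) ≤ (1 / 2) ^ k.e := by positivity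
    have h1 : ((1 : ℝ) / 2) ^ k.e ≤ 1 := pow_le_one₀ (by norm_num) (by norm_num)
    have hw := one_le_weight n k.ph
    have hi : (k.i : ℝ) ≤ p.N := by exact_mod_cast h.i
    have hτ := p.tau_nonneg
    have hi' : 0 ≤ (p.N - k.i : ℝ) * p.tau := mul_nonneg (by linarith) hτ
    -- Replies of output members are balanced by the decrease of `open'`. The superfluous ones,
    -- rounds and broadcasts are paid at the weight of the phase, which is at least one.
    have key : avg ((1 / 2) ^ k.e) (cand d U k.st.head?) (fun R =>
        (if k.fresh = true then 1 else 0) + #R +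
        if Done k (R.image d) then 0 else open' d Pop t (U \ R) +
          p.future d Pop t (U \ R) (p.tick (p.control k (R.image d)))) ≤
        avg ((1 / 2) ^ k.e) (cand d U k.st.head?) (fun R =>
          ((if k.fresh = true then 1 else 0) + open' d Pop t U +
            weight n k.ph * ((p.N - k.i : ℝ) * p.tau)) + weight n k.ph *
          (p.tau + #(R.filter fun i => ¬ Low d Pop t (some (d i))) +
            midNext d Pop t p.tau k.st U k.e R)) := by
      refine avg_mono h0 h1 fun R hR => ?_
      have hRU : R ⊆ U := hR.trans (cand_subset _ _)
      have h2 : (open' d Pop t (U \ R) : ℝ) + #R = open' d Pop t U +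
          #(R.filter fun i => ¬ Low d Pop t (some (d i))) := by
        have h3 := open'_sdiff_add (d := d) (Pop := Pop) (t := t) hRU
        have h4 : #R = #(R.filter fun i => Low d Pop t (some (d i))) +
          #(R.filter fun i => ¬ Low d Pop t (some (d i))) :=
          (card_filter_add_card_filter_not _).symm
        exact_mod_cast (by omega : open' d Pop t (U \ R) + #R = open' d Pop t U +
          #(R.filter fun i => ¬ Low d Pop t (some (d i))))
      have h5 : (#(R.filter fun i => ¬ Low d Pop t (some (d i))) : ℝ) ≤
          weight n k.ph * #(R.filter fun i => ¬ Low d Pop t (some (d i))) :=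
        le_mul_of_one_le_left (by positivity) hw
      have h6 : 0 ≤ weight n k.ph * p.tau := by positivity
      have h7 : 0 ≤ weight n k.ph * ((p.N - k.i : ℝ) * p.tau) := by positivity
      have h8 : 0 ≤ weight n k.ph * midNext d Pop t p.tau k.st U k.e R :=
        mul_nonneg (by linarith) (midNext_nonneg hτ _ _ _ _)
      split_ifs with hf hD hD
      · have : (0 : ℝ) ≤ open' d Pop t (U \ R) := by positivity
        linarith
      · have h9 := (h.control hRU hph).future_tick (by rwa [control_ph]) hN
        rw [h.potential_control hd hRU hD, control_ph, control_i] at h9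
        linarith
      · have : (0 : ℝ) ≤ open' d Pop t (U \ R) := by positivity
        linarith
      · have h9 := (h.control hRU hph).future_tick (by rwa [control_ph]) hN
        rw [h.potential_control hd hRU hD, control_ph, control_i] at h9
        linarith
    refine key.trans ?_
    rw [avg_add, avg_const, avg_const_mul, ← mid_eq_avg, future, if_neg hph, potential]
    split_ifs with hf
    -- At the start of a test the `1` in the potential pays for the broadcast, and `mid_le_start`
    -- passes to the potential within the test; in later rounds equality holds.
    · have h2 := mid_le_start (d := d) (t := t) hd hτ (st := k.st) h.subset
        (E := p.E) ((Nat.mul_le_mul_left _ (by simpa using card_le_univ U)).trans hE) p.tau_le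
      rw [h.fresh hf hph]
      have h3 := mul_le_mul_of_nonneg_left h2 (show 0 ≤ weight n k.ph by linarith)
      linarith
    · linarith

theorem round_idle' {T : Fin (p.B + 1) → ℕ → Option α} {o : Option (Finset α)}
    {g : Fin n → Fin (p.B + 1) → ℕ} {dirty : Fin n → Bool} {flag : Fin n → Fin (p.B + 1) → Bool}
    {act : Fin n → Bool} {c : ℕ} (r : ℕ) :
    (p.protocol n).rounds r (p.conf T (.idle o) g dirty flag act .rest d c) =
      PMF.pure (p.conf T (.idle o) g dirty flag act .rest d c) :=
  rounds_fixed _ p.round_idle r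

theorem testMode_of_done (hD : Done k (R.image d)) :
    p.testMode k.st.head? k.e = .rest := by
  rw [hD.1]
  rfl

theorem fresh_tick (h : (p.tick k).fresh = false) :
    (p.tick k).st = k.st ∧ (p.tick k).e = k.e ∧ k.fresh = false := by
  obtain ⟨t, kn, st, e, f, i, ph⟩ := k
  match ph, i with
  | 0, _ => exact ⟨rfl, rfl, h⟩
  | ph + 1, i + 1 => exact ⟨rfl, rfl, h⟩
  | 1, 0 => exact absurd h (by simp [tick_last])
  | ph + 2, 0 => exact absurd h (by simp [tick_next])

/-- Within a test nodes count the exponent down by themselves, so no broadcast is needed. This shows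
that they stay synchronized with the server. -/
theorem testMode_eq {I : Finset α} (h : (p.tick (p.control k I)).fresh = false) :
    p.testMode k.st.head? k.e = .test (p.tick (p.control k I)).st.head?
      (p.tick (p.control k I)).e := by
  obtain ⟨h1, h2, h3⟩ := fresh_tick h
  rw [h1, h2]
  unfold control at h3 ⊢
  split at h3
  · cases h3
  · rename_i e he
    simp only [he]
    split_ifs at h3 ⊢
    rfl

/-- The search finds the smallest members of the population. -/
theorem Fitting.support_rounds {T : Fin (p.B + 1) → ℕ → Option α}
    {g : Fin n → Fin (p.B + 1) → ℕ} {dirty : Fin n → Bool}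
    {flag : Fin n → Fin (p.B + 1) → Bool} :
    ∀ (r : ℕ) (U : Finset (Fin n)) (k : Core α) (mode : Mode α p.B) (c : ℕ),
      p.Fitting d Pop t U k → (k.fresh = false → mode = .test k.st.head? k.e) → p.left k ≤ r →
      ∀ s ∈ ((p.protocol n).rounds r (p.conf T (.test k) g dirty flag (fun i => decide (i ∈ U))
          mode d c)).support,
        ∃ act c', s = p.conf T (.idle (some (smallest t (Pop.image d)))) g dirty flag act .rest
          d c' := by
  intro r
  induction r with
  | zero =>
    intro U k mode c h hm hl
    unfold left at hl
    split_ifs at hl <;> omega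
  | succ r ih =>
    intro U k mode c h hm hl s hs
    rw [Protocol.rounds, p.round_test h.e hm, PMF.bind_map, PMF.mem_support_bind_iff] at hs
    obtain ⟨R, hR, hs⟩ := hs
    have hRc := subset_of_mem_support_sample hR
    have hRU : R ⊆ U := hRc.trans (cand_subset _ _)
    simp only [Function.comp_apply, coreNext] at hs
    by_cases hD : Done k (R.image d)
    · rw [if_pos hD, testMode_of_done hD, round_idle', PMF.support_pure,
        Set.mem_singleton_iff] at hs
      subst hs
      refine ⟨fun i => decide (i ∈ U \ R), c + (if k.fresh = true then 1 else 0) + #R, ?_⟩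
      rw [smallest_eq_of_subset (P := Pop.image d) (X := k.st.head?)]
      · rw [h.t]
      · rw [h.known_union hRU]
        exact image_subset_image sdiff_subset
      · rw [h.known_union hRU]
        -- The search ends only after a round with exponent `0`, in which every active member up to
        -- the threshold replies with certainty. Hence the server knows all items up to it.
        rw [hD.1, pow_zero] at hR
        rw [eq_of_mem_support_sample_one hR]
        rintro _ hx hu
        obtain ⟨i, hi, rfl⟩ := mem_image.1 hx
        refine mem_image_of_mem _ (mem_sdiff.2 ⟨hi, fun hi' => ?_⟩)
        exact (mem_sdiff.1 hi').2 (mem_filter.2 ⟨(mem_sdiff.1 hi').1, hu⟩)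
      · refine hD.2.imp (fun h' => ?_) fun h' => h'
        exact h'
    · rw [if_neg hD] at hs
      by_cases hph : k.ph = 0
      · refine absurd ?_ hD
        obtain ⟨h1, h2, h3⟩ := h.last hph
        exact ⟨h2, Or.inl (by simp [h1])⟩
      · refine ih _ _ _ _ ((h.control hRU hph).tick (by rwa [control_ph])) ?_ ?_ s hs
        · exact testMode_eq
        · have h1 := left_tick (p := p) (k := p.control k (R.image d)) (by rwa [control_ph])
          have h2 : p.left (p.control k (R.image d)) = p.left k := by
            simp only [left, control_ph, control_i]
          omega

/-- The expected number of messages of a search. -/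
theorem Fitting.mean_rounds_le (hd : Function.Injective d)
    (hE : 4096 * n ≤ 2 ^ p.E) (hN : 2 * (2 * bigA * harm n + 4) ≤ p.N * p.tau)
    {T : Fin (p.B + 1) → ℕ → Option α}
    {g : Fin n → Fin (p.B + 1) → ℕ} {dirty : Fin n → Bool}
    {flag : Fin n → Fin (p.B + 1) → Bool} :
    ∀ (r : ℕ) (U : Finset (Fin n)) (k : Core α) (mode : Mode α p.B) (c : ℕ),
      p.Fitting d Pop t U k → (k.fresh = false → mode = .test k.st.head? k.e) →
      mean ((p.protocol n).rounds r (p.conf T (.test k) g dirty flag (fun i => decide (i ∈ U))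
          mode d c)) (fun s => (s.msgs : ENNReal)) ≤
        ENNReal.ofReal (c + (open' d Pop t U + p.future d Pop t U k)) := by
  intro r
  induction r with
  | zero =>
    intro U k mode c h hm
    rw [Protocol.rounds, mean_pure]
    -- The bound holds for any number of rounds, since what is still expected is nonnegative.
    have := h.future_nonneg
    change (c : ENNReal) ≤ _
    rw [← ENNReal.ofReal_natCast]
    refine ENNReal.ofReal_le_ofReal ?_
    have : (0 : ℝ) ≤ open' d Pop t U := by positivity
    linarith
  | succ r ih =>
    intro U k mode c h hm
    rw [Protocol.rounds, p.round_test h.e hm, PMF.bind_map, mean_bind]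
    have h0 : (0 : ℝ) ≤ (1 / 2) ^ k.e := by positivity
    have h1 : ((1 : ℝ) / 2) ^ k.e ≤ 1 := pow_le_one₀ (by norm_num) (by norm_num)
    have hstep := h.step hd hE hN
    have hnext : ∀ R ⊆ U, ¬ Done k (R.image d) → k.ph ≠ 0 ∧
        p.Fitting d Pop t (U \ R) (p.tick (p.control k (R.image d))) := by
      intro R hRU hD
      have hph : k.ph ≠ 0 := by
        intro hph
        obtain ⟨h1, h2, h3⟩ := h.last hph
        exact hD ⟨h2, Or.inl (by simp [h1])⟩
      exact ⟨hph, (h.control hRU hph).tick (by rwa [control_ph])⟩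
    calc mean (sample ((1 / 2) ^ k.e) (cand d U k.st.head?)) _
        ≤ mean (sample ((1 / 2) ^ k.e) (cand d U k.st.head?)) fun R => ENNReal.ofReal
            (c + ((if k.fresh = true then 1 else 0) + #R +
              if Done k (R.image d) then 0 else open' d Pop t (U \ R) +
                p.future d Pop t (U \ R) (p.tick (p.control k (R.image d))))) := by
          refine mean_mono_support fun R hR => ?_
          have hRc := subset_of_mem_support_sample hR
          have hRU : R ⊆ U := hRc.trans (cand_subset _ _)
          simp only [Function.comp_apply, coreNext]
          by_cases hD : Done k (R.image d)
          · rw [if_pos hD, testMode_of_done hD, round_idle', mean_pure, if_pos hD]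
            change ((c + (if k.fresh = true then 1 else 0) + #R : ℕ) : ENNReal) ≤ _
            rw [← ENNReal.ofReal_natCast]
            refine ENNReal.ofReal_le_ofReal (le_of_eq ?_)
            push_cast
            ring
          · rw [if_neg hD, if_neg hD]
            refine (ih _ _ _ _ (hnext R hRU hD).2 ?_).trans (ENNReal.ofReal_le_ofReal ?_)
            · exact testMode_eq
            · refine le_of_eq ?_
              push_cast
              ring
      _ = ENNReal.ofReal (avg ((1 / 2) ^ k.e) (cand d U k.st.head?) _) := by
          refine mean_sample_ofReal h0 h1 _ _ ?_
          · intro R hR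
            have : 0 ≤ (if Done k (R.image d) then 0 else open' d Pop t (U \ R) +
                p.future d Pop t (U \ R) (p.tick (p.control k (R.image d)))) := by
              split_ifs with hD
              · exact le_rfl
              · have := (hnext R (hR.trans (cand_subset _ _)) hD).2.future_nonneg
                positivity
            positivity
      _ ≤ _ := ENNReal.ofReal_le_ofReal (by rw [avg_add, avg_const]; linarith)

end Params

end Monitoring

end

noncomputable section

namespace Monitoring

open Finset

set_option linter.unusedSectionVars false

/-! ### From queries to searches -/

theorem smallest_image_univ {α : Type u} [LinearOrder α] {n : ℕ} {d : Fin n → α}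
    (hd : Function.Injective d) (k : ℕ) : smallest k (univ.image d) = topKSet d k := by
  ext x
  have h : ∀ x, #((univ.image d).filter fun y => y ≤ x) = rank d x := by
    intro x
    rw [filter_image, card_image_of_injective _ hd]
    rfl
  simp only [smallest, topKSet, mem_filter, mem_image, mem_univ, true_and, h]
  constructor
  · rintro ⟨⟨i, rfl⟩, h⟩
    exact ⟨i, h, rfl⟩
  · rintro ⟨i, h, rfl⟩
    exact ⟨⟨i, rfl⟩, h⟩

namespace Params

variable {p : Params} {α : Type u} [LinearOrder α] {n : ℕ} {d : Fin n → α}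
  {T : Fin (p.B + 1) → ℕ → Option α} {g : Fin n → Fin (p.B + 1) → ℕ}
  {flag : Fin n → Fin (p.B + 1) → Bool}

variable (p) in
/-- The nodes whose items do not occur in the sketch. -/
def hidden (g : Fin n → Fin (p.B + 1) → ℕ) (d : Fin n → α) : Finset (Fin n) :=
  univ.filter fun i => ∀ c, p.top g d c (g i c) ≠ some (d i)

/-- An item that is minimal at some level is also minimal at the height of its node. Therefore one
flag per copy tells a node whether the server knows its item. -/
theorem top_eq_some {c : Fin (p.B + 1)} {l : ℕ} {x : α} (h : p.top g d c l = some x) :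
    ∃ i, d i = x ∧ l ≤ g i c ∧ p.top g d c (g i c) = some (d i) := by
  have h1 := (@best_eq_some_iff α (side α p.B c) n (fun i => g i c) d l x).1 h
  obtain ⟨⟨i, hi, rfl⟩, h2⟩ := h1
  exact ⟨i, rfl, hi, (@best_eq_some_iff α (side α p.B c) n (fun i => g i c) d (g i c) (d i)).2
    ⟨⟨i, le_rfl, rfl⟩, fun j hj => h2 j (hi.trans hj)⟩⟩

/-- What the server knows and what the unflagged nodes believe to be unknown are complementary, so
no item in the sketch is sent again. -/
theorem sketch_eq (hg : ∀ i c, g i c ≤ p.m) (hgood : ∀ c, p.Good T g flag d c) :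
    p.sketch T = (univ \ p.hidden g d).image d := by
  ext x
  simp only [sketch, mem_biUnion, mem_product, mem_univ, true_and, mem_range, Option.mem_toFinset,
    Prod.exists, mem_image, mem_sdiff, hidden, mem_filter, not_forall, not_not]
  constructor
  · rintro ⟨c, l, hl, hx⟩
    rw [Option.mem_def, (hgood c).1 l (by omega) trivial] at hx
    obtain ⟨i, rfl, -, h⟩ := top_eq_some hx
    exact ⟨i, ⟨c, h⟩, rfl⟩
  · rintro ⟨i, ⟨c, h⟩, rfl⟩
    refine ⟨c, g i c, Nat.lt_succ_of_le (hg i c), ?_⟩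
    rw [Option.mem_def, (hgood c).1 _ (Nat.le_succ_of_le (hg i c)) trivial, h]

theorem left_core (h : p.ph ≠ 0) (k t : ℕ) (known : Finset α) :
    p.left (p.core T k t known) = p.ph * (p.N + 1) + 1 := by
  obtain ⟨q, hq⟩ := Nat.exists_eq_succ_of_ne_zero h
  rw [left, if_neg (show (p.core T k t known).ph ≠ 0 from h)]
  simp only [core, hq]
  rw [Nat.succ_sub_one, Nat.succ_mul]
  ring

theorem fitting_core (h : p.ph ≠ 0) {Pop U : Finset (Fin n)} (hU : U ⊆ Pop) {k t : ℕ} :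
    p.Fitting d Pop t U (p.core T k t ((Pop \ U).image d)) :=
  ⟨hU, rfl, rfl, le_rfl, le_rfl, fun _ _ => rfl, fun h' => absurd h' h⟩

/-- With at least `log₂ (n + 1)` phases the weight of the first one is at most `2`. -/
theorem future_core_le (h : n + 1 ≤ 2 ^ p.ph) (hn : n ≠ 0) {Pop U : Finset (Fin n)} {k t : ℕ}
    {known : Finset α} :
    p.future d Pop t U (p.core T k t known) ≤
      2 * (1 + start d Pop t U (T 0 (p.lev k)).toList) := by
  have hph : p.ph ≠ 0 := by
    intro h'
    rw [h'] at h
    omega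
  rw [future, if_neg (show (p.core T k t known).ph ≠ 0 from hph), potential,
    if_pos (show (p.core T k t known).fresh = true from rfl)]
  have h1 : weight n (p.core T k t known).ph ≤ 2 := by
    change 1 + ((n : ℝ) + 1) / 2 ^ p.ph ≤ 2
    have h2 : ((n : ℝ) + 1) / 2 ^ p.ph ≤ 1 := by
      rw [div_le_one (by positivity)]
      exact_mod_cast h
    linarith
  change _ * (1 + start d Pop t U (T 0 (p.lev k)).toList + (p.N - p.N : ℝ) * p.tau) ≤ _
  rw [sub_self, zero_mul, add_zero]
  have := start_nonneg (d := d) (Pop := Pop) (t := t) U (T 0 (p.lev k)).toList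
  exact mul_le_mul_of_nonneg_right h1 (by linarith)

/-- The conditions on the parameters which ensure that searches succeed. -/
structure Suitable (p : Params) (n : ℕ) : Prop where
  n_ne : n ≠ 0
  ph : n + 1 ≤ 2 ^ p.ph
  E : 4096 * n ≤ 2 ^ p.E
  N : 2 * (2 * bigA * harm n + 4) ≤ p.N * p.tau
  lev : ∀ k ≤ n, p.lev k ≤ p.m
  R : p.ph * (p.N + 1) + 2 ≤ p.R
  R' : (p.B + 1) * (2 * p.m + 3) + 2 ≤ p.R

theorem Suitable.ph_ne (h : p.Suitable n) : p.ph ≠ 0 := by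
  intro h'
  have := h.ph
  rw [h'] at this
  have := h.n_ne
  omega

theorem round_ask_topK (hg : ∀ i c, g i c ≤ p.m) (hgood : ∀ c, p.Good T g flag d c)
    {act : Fin n → Bool} {c k : ℕ} :
    (p.protocol n).round (p.conf T (.ask (.topK k)) g (fun _ => false) flag act .rest d c) =
      PMF.pure (p.conf T (.test (p.core T k k ((univ \ p.hidden g d).image d))) g (fun _ => false)
        flag (fun i => decide (i ∈ p.hidden g d)) .rest d (c + 1)) := by
  rw [p.round_det (srv := (⟨T, .asked (p.core T k k (p.sketch T))⟩ : Server α p.B))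
    (c := some .all) (f := fun i => (⟨g i, false, flag i, decide (∀ c, flag i c = false), .rest⟩,
      false)) rfl (fun c' hc' => by cases hc'; trivial) fun i => rfl]
  congr 1
  refine Protocol.Config.mk.injEq .. |>.mpr ⟨?_, ?_, rfl, ?_⟩
  · rw [← sketch_eq hg hgood]
    rfl
  · funext i
    refine Node.mk.injEq .. |>.mpr ⟨rfl, rfl, rfl, ?_, rfl⟩
    refine decide_eq_decide.2 ?_
    simp only [hidden, mem_filter, mem_univ, true_and]
    refine forall_congr' fun c => ?_
    rw [ne_eq, ← (hgood c).2 i trivial, Bool.not_eq_true]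
  · simp [conf]

/-- After one broadcast the unflagged nodes are active, and the search begins with the threshold of
the sketch at level `p.lev k`. -/
theorem answer_topK (hp : p.Suitable n) (hg : ∀ i c, g i c ≤ p.m)
    (hgood : ∀ c, p.Good T g flag d c) (hd : Function.Injective d) {act : Fin n → Bool} {c : ℕ}
    {k : ℕ} (hk : k ≤ n) :
    (∀ s ∈ ((p.protocol n).runOp (.answer (.topK k))
        (p.conf T (.idle none) g (fun _ => false) flag act .rest d c)).support,
      ∃ act c', s = p.conf T (.idle (some (topKSet d k))) g (fun _ => false) flag act .rest d c') ∧
    mean ((p.protocol n).runOp (.answer (.topK k))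
        (p.conf T (.idle none) g (fun _ => false) flag act .rest d c))
        (fun s => (s.msgs : ENNReal)) ≤
      ENNReal.ofReal (c + 1 + (open' d univ k (p.hidden g d) + 2 * (1 + start d univ k
        (p.hidden g d) (p.top g d 0 (p.lev k)).toList))) := by
  have h1 : (p.protocol n).runOp (.answer (.topK k))
      (p.conf T (.idle none) g (fun _ => false) flag act .rest d c) =
      (p.protocol n).rounds (p.R - 1) (p.conf T (.test (p.core T k k
        ((univ \ p.hidden g d).image d))) g (fun _ => false)
        flag (fun i => decide (i ∈ p.hidden g d)) .rest d (c + 1)) := by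
    rw [runOp_eq, show p.R = 1 + (p.R - 1) by have := hp.R; omega]
    rw [rounds_one_add _ (round_ask_topK hg hgood), Nat.add_sub_cancel_left]
  have hf : p.Fitting d univ k (p.hidden g d) (p.core T k k ((univ \ p.hidden g d).image d)) :=
    fitting_core hp.ph_ne (subset_univ _)
  rw [h1]
  constructor
  · rw [← smallest_image_univ hd]
    refine hf.support_rounds _ _ _ _ _ (fun h => by cases h) ?_
    rw [left_core hp.ph_ne]
    have := hp.R
    omega
  · refine (hf.mean_rounds_le hd hp.E hp.N _ _ _ _ _ (fun h => by cases h)).trans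
      (ENNReal.ofReal_le_ofReal ?_)
    have h2 := future_core_le (T := T) (d := d) (Pop := univ) (U := p.hidden g d) (k := k) (t := k)
      (known := (univ \ p.hidden g d).image d) hp.ph hp.n_ne
    rw [(hgood 0).1 _ ((hp.lev k hk).trans (Nat.le_succ _)) trivial] at h2
    push_cast
    linarith

/-- The state in which a search in a random sample begins. -/
def searchConf (p : Params) (T : Fin (p.B + 1) → ℕ → Option α) (g : Fin n → Fin (p.B + 1) → ℕ)
    (flag : Fin n → Fin (p.B + 1) → Bool) (d : Fin n → α) (c k t : ℕ) (Pop : Finset (Fin n)) :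
    (p.protocol (α := α) n).Config :=
  p.conf T (.test (p.core T k t ∅)) g (fun _ => false) flag (fun i => decide (i ∈ Pop)) .rest d c

theorem round_ask_select {act : Fin n → Bool} {c k : ℕ} {ε δ : ℝ} :
    (p.protocol n).round (p.conf T (.ask (.select k ε δ)) g (fun _ => false) flag act .rest d c) =
      (flip (reactProb δ)).bind fun b => if b = true then
        (sample ((1 / 2) ^ rateExp p.m k ε (errProb δ)) univ).map (searchConf p T g flag d (c + 1) k
          (sampleRank k (rateExp p.m k ε (errProb δ)) ε))
      else PMF.pure (p.conf T (.idle none) g (fun _ => false) flag act .rest d c) := by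
  rw [p.round_eq]
  · refine (PMF.bind_map _ _ _).trans ?_
    refine bind_congr_support fun b _ => ?_
    simp only [Function.comp_apply]
    cases b
    · change PMF.map _ (independent n fun i => PMF.pure _) = _
      rw [independent_pure, PMF.pure_map]
      simp [after, conf, absorb]
    · simp only [if_true]
      refine (map_of_independent (q := fun i => if i ∈ (univ : Finset (Fin n)) then
        flip ((1 / 2) ^ rateExp p.m k ε (errProb δ)) else PMF.pure false) (g := fun i b =>
        ((⟨g i, false, flag i, b, .rest⟩ : Node α p.B), false))
        (fun i => by rw [if_pos (mem_univ i)]; rfl)).trans ?_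
      rw [sample, PMF.map_comp]
      congr 1
      funext b
      simp only [Function.comp_apply, after]
      refine Protocol.Config.mk.injEq .. |>.mpr ⟨?_, ?_, rfl, ?_⟩
      · rfl
      · funext i
        refine Node.mk.injEq .. |>.mpr ⟨rfl, rfl, rfl, ?_, rfl⟩
        simp
      · simp [conf]
  · intro r hr c' hc'
    change r ∈ (PMF.map _ (flip (reactProb δ))).support at hr
    rw [PMF.support_map] at hr
    obtain ⟨b, -, rfl⟩ := hr
    cases b
    · simp at hc'
    · simp only [if_true, Option.some.injEq] at hc'
      subst hc'
      exact Nat.findGreatest_le _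

/-- The server first decides whether to react. If so, one broadcast of the rate makes the nodes
sample themselves, and then the sample is searched with no known items, so that its law is that of
independent coins. -/
theorem answer_select (hp : p.Suitable n) (hgood : ∀ c, p.Good T g flag d c)
    (hd : Function.Injective d) {act : Fin n → Bool} {c : ℕ}
    {k : ℕ} {ε δ : ℝ} (hk : k ≤ n) :
    ∃ F : Finset (Fin n) → PMF (p.protocol (α := α) n).Config,
      (p.protocol n).runOp (.answer (.select k ε δ))
        (p.conf T (.idle none) g (fun _ => false) flag act .rest d c) =
        (flip (reactProb δ)).bind (fun b => if b = true then
          (sample ((1 / 2) ^ rateExp p.m k ε (errProb δ)) univ).bind F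
          else PMF.pure (p.conf T (.idle none) g (fun _ => false) flag act .rest d c)) ∧
      ∀ Pop, (∀ s ∈ (F Pop).support, ∃ act c', s = p.conf T (.idle (some
          (smallest (sampleRank k (rateExp p.m k ε (errProb δ)) ε) (Pop.image d)))) g
          (fun _ => false) flag act .rest d c') ∧
        mean (F Pop) (fun s => (s.msgs : ENNReal)) ≤ ENNReal.ofReal (c + 1 +
          (open' d Pop (sampleRank k (rateExp p.m k ε (errProb δ)) ε) Pop + 2 * (1 + start d Pop
            (sampleRank k (rateExp p.m k ε (errProb δ)) ε) Pop
            (p.top g d 0 (p.lev k)).toList))) := by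
  set t := sampleRank k (rateExp p.m k ε (errProb δ)) ε with ht
  refine ⟨fun Pop => (p.protocol n).rounds (p.R - 1) (searchConf p T g flag d (c + 1) k t Pop), ?_,
    fun Pop => ?_⟩
  · rw [runOp_eq, show p.R = (p.R - 1) + 1 by have := hp.R; omega]
    simp only [Protocol.rounds]
    rw [round_ask_select, PMF.bind_bind, Nat.add_sub_cancel]
    refine bind_congr_support fun b _ => ?_
    cases b
    · simp only [Bool.false_eq_true, if_false, PMF.pure_bind]
      exact round_idle' _
    · simp only [if_true]
      exact PMF.bind_map _ _ _
  · have hf : p.Fitting d Pop t Pop (p.core T k t ∅) := by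
      have := fitting_core (d := d) (T := T) (k := k) (t := t) hp.ph_ne (subset_refl Pop)
      rwa [Finset.sdiff_self, image_empty] at this
    constructor
    · refine hf.support_rounds _ _ _ _ _ (fun h => by cases h) ?_
      rw [left_core hp.ph_ne]
      have := hp.R
      omega
    · refine (hf.mean_rounds_le hd hp.E hp.N _ _ _ _ _ (fun h => by cases h)).trans
        (ENNReal.ofReal_le_ofReal ?_)
      have h2 := future_core_le (T := T) (d := d) (Pop := Pop) (U := Pop) (k := k) (t := t)
        (known := ∅) hp.ph hp.n_ne
      rw [(hgood 0).1 _ ((hp.lev k hk).trans (Nat.le_succ _)) trivial] at h2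
      push_cast
      linarith

end Params

end Monitoring

end

noncomputable section

namespace Monitoring

open Finset

set_option linter.unusedSectionVars false

/-! ### Probabilities for the heights in one copy -/

theorem half_ofReal : ENNReal.ofReal (1 / 2) = 1 / 2 := by
  rw [ENNReal.ofReal_div_of_pos two_pos]
  simp

theorem mean_geom_succ (m : ℕ) (f : ℕ → ENNReal) :
    mean (geom (m + 1)) f = 1 / 2 * mean (geom m) (fun h => f (h + 1)) + 1 / 2 * f 0 := by
  rw [geom, mean_bind, mean_flip (by norm_num) (by norm_num)]
  simp only [if_true, Bool.false_eq_true, if_false, mean_map, mean_pure]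
  rw [show (1 - 1 / 2 : ℝ) = 1 / 2 by norm_num, half_ofReal]

/-- The probability of a height of at least `l`. -/
theorem mean_geom_ge {m l : ℕ} (h : l ≤ m) :
    mean (geom m) (fun x => if l ≤ x then 1 else 0) = (1 / 2) ^ l := by
  induction m generalizing l with
  | zero =>
    obtain rfl : l = 0 := by omega
    rw [geom, mean_pure]
    simp
  | succ m ih =>
    rw [mean_geom_succ]
    cases l with
    | zero =>
      simp only [Nat.zero_le, if_true, mean_const, pow_zero, mul_one]
      exact ENNReal.add_halves 1
    | succ l =>
      simp only [Nat.succ_le_succ_iff, Nat.succ_ne_zero, nonpos_iff_eq_zero, if_false, mul_zero,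
        add_zero]
      rw [ih (by omega), pow_succ, mul_comm]

/-- Only below the truncation `m`; the height `m` itself collects the remaining mass, see
`mean_geom_top`. -/
theorem mean_geom_eq {m h : ℕ} (hh : h < m) :
    mean (geom m) (fun x => if x = h then 1 else 0) = (1 / 2) ^ (h + 1) := by
  induction m generalizing h with
  | zero => omega
  | succ m ih =>
    rw [mean_geom_succ]
    cases h with
    | zero => simp [mean_const]
    | succ h =>
      simp only [add_left_inj, (Nat.succ_ne_zero h).symm, if_false, mul_zero, add_zero]
      rw [ih (by omega), pow_succ _ (h + 1), mul_comm]

theorem mean_geom_top (m : ℕ) : mean (geom m) (fun x => if x = m then 1 else 0) = (1 / 2) ^ m := by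
  rw [← mean_geom_ge le_rfl]
  refine mean_congr_support fun x hx => ?_
  have := le_of_mem_support_geom hx
  exact if_congr (by omega) rfl rfl

theorem mean_geom_eq_le {m h : ℕ} (hh : h ≤ m) :
    mean (geom m) (fun x => if x = h then 1 else 0) ≤ (1 / 2) ^ h := by
  rw [← mean_geom_ge hh]
  refine mean_mono fun x => ?_
  split_ifs <;> first | omega | simp

/-- For an untruncated height, being equal to `h` and being larger than `h` are equally likely. This
makes the geometric sums below telescope. -/
theorem mean_geom_eq_add_lt {m h : ℕ} (hh : h < m) :
    mean (geom m) (fun x => if x = h then 1 else 0) +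
      mean (geom m) (fun x => if x ≤ h then 1 else 0) = 1 := by
  rw [mean_geom_eq hh, ← mean_geom_ge hh, add_comm]
  refine Eq.trans ?_ (mean_ite_add_ite_not (geom m) (fun x => x ≤ h))
  refine congrArg _ (mean_congr_support fun x _ => ?_)
  split_ifs <;> first | omega | rfl

theorem mean_ite_le_one {β : Type*} (q : PMF β) (A : β → Prop) [DecidablePred A] :
    mean q (fun b => if A b then 1 else 0) ≤ 1 := by
  rw [← mean_const q 1]
  refine mean_mono fun b => ?_
  split_ifs <;> simp

/-- Sum of a geometric progression. -/
theorem sum_geometric_le {a r : ENNReal} (h : a + r = 1) (n : ℕ) :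
    ∑ k ∈ range n, a * r ^ k ≤ 1 := by
  have : ∑ k ∈ range n, a * r ^ k + r ^ n = 1 := by
    induction n with
    | zero => simp
    | succ n ih =>
      rw [sum_range_succ, pow_succ, add_assoc, mul_comm (r ^ n) r, ← add_mul, h, one_mul, ih]
  rw [← this]
  exact le_self_add

/-- All terms of the geometric series up to `n` are at least the last one. -/
theorem card_mul_pow_le {a r : ENNReal} (h : a + r = 1) (n : ℕ) : n * (a * r ^ (n - 1)) ≤ 1 := by
  refine le_trans ?_ (sum_geometric_le h n)
  rw [← nsmul_eq_mul, ← card_range n, ← sum_const, card_range]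
  refine sum_le_sum fun k hk => ?_
  rw [mem_range] at hk
  have hr : r ≤ 1 := h ▸ le_add_self
  gcongr a * ?_
  exact pow_le_pow_of_le_one (zero_le) hr (by omega)

section copy

variable {n : ℕ} {β : Type u} (q : PMF β)

theorem mean_independent_finset (p : Fin n → PMF β) (S : Finset (Fin n))
    (f : Fin n → β → ENNReal) :
    mean (independent n p) (fun x => ∏ i ∈ S, f i (x i)) = ∏ i ∈ S, mean (p i) (f i) := by
  have h := mean_independent_prod n p fun i y => if i ∈ S then f i y else 1
  have h1 : ∀ i, mean (p i) (fun y => if i ∈ S then f i y else 1) =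
      if i ∈ S then mean (p i) (f i) else 1 := by
    intro i
    split_ifs
    · rfl
    · exact mean_const _ _
  simp only [h1] at h
  simpa [prod_ite_mem] using h

/-- Two nodes and a set of other nodes. -/
theorem mean_independent_pair {u v : Fin n} {S : Finset (Fin n)} (huv : u ≠ v) (hu : u ∉ S)
    (hv : v ∉ S) (a b c : β → ENNReal) :
    mean (independent n fun _ => q) (fun x => a (x u) * (b (x v) * ∏ i ∈ S, c (x i))) =
      mean q a * (mean q b * mean q c ^ #S) := by
  have h := mean_independent_finset (fun _ => q) (insert u (insert v S)) fun i =>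
    if i = u then a else if i = v then b else c
  have h1 : u ∉ insert v S := by simp [huv, hu]
  simp only [prod_insert h1, prod_insert hv] at h
  have h2 : ∀ i ∈ S, i ≠ u ∧ i ≠ v := fun i hi =>
    ⟨fun h' => hu (h' ▸ hi), fun h' => hv (h' ▸ hi)⟩
  have h3 : ∏ i ∈ S, mean q (if i = u then a else if i = v then b else c) = mean q c ^ #S := by
    rw [← prod_const]
    exact prod_congr rfl fun i hi => by rw [if_neg (h2 i hi).1, if_neg (h2 i hi).2]
  have h4 : ∀ x : Fin n → β, ∏ i ∈ S, (if i = u then a else if i = v then b else c) (x i) =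
      ∏ i ∈ S, c (x i) := fun x =>
    prod_congr rfl fun i hi => by rw [if_neg (h2 i hi).1, if_neg (h2 i hi).2]
  simpa only [h3, h4, if_true, if_neg huv.symm] using h

/-- One node and a set of other nodes. -/
theorem mean_independent_single {v : Fin n} {S : Finset (Fin n)}
    (hv : v ∉ S) (b c : β → ENNReal) :
    mean (independent n fun _ => q) (fun x => b (x v) * ∏ i ∈ S, c (x i)) =
      mean q b * mean q c ^ #S := by
  have h := mean_independent_finset (fun _ => q) (insert v S) fun i => if i = v then b else c
  have h2 : ∀ i ∈ S, i ≠ v := fun i hi h' => hv (h' ▸ hi)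
  have h3 : ∏ i ∈ S, mean q (if i = v then b else c) = mean q c ^ #S := by
    rw [← prod_const]
    exact prod_congr rfl fun i hi => by rw [if_neg (h2 i hi)]
  have h4 : ∀ x : Fin n → β, ∏ i ∈ S, (if i = v then b else c) (x i) = ∏ i ∈ S, c (x i) :=
    fun x => prod_congr rfl fun i hi => by rw [if_neg (h2 i hi)]
  simp only [prod_insert hv] at h
  simpa only [h3, h4, if_true] using h

theorem mean_independent_eval (v : Fin n) (b : β → ENNReal) :
    mean (independent n fun _ => q) (fun x => b (x v)) = mean q b := by
  have := mean_independent_single q (notMem_empty v) b fun _ => 1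
  simpa using this

theorem mean_independent_pow (S : Finset (Fin n)) (c : β → ENNReal) :
    mean (independent n fun _ => q) (fun x => ∏ i ∈ S, c (x i)) = mean q c ^ #S := by
  have := mean_independent_finset (fun _ => q) S fun _ => c
  rw [this, prod_const]

end copy

end Monitoring

end

noncomputable section

namespace Monitoring

open Finset

set_option linter.unusedSectionVars false

/-! ### The expected cost of refreshing a copy -/

section copy

variable {α : Type u} [LinearOrder α] {n m : ℕ} {d : Fin n → α}

theorem under_best_iff {x : Fin n → ℕ} {l : ℕ} {a : α} :
    Under (best x d l) a ↔ ∀ j, l ≤ x j → a < d j := by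
  constructor
  · intro h j hj
    obtain ⟨y, hy, hyj⟩ := exists_best_le (d := d) hj
    rw [hy] at h
    exact lt_of_lt_of_le h hyj
  · intro h
    cases hb : best x d l with
    | none => trivial
    | some y =>
      obtain ⟨⟨i, hi, rfl⟩, -⟩ := best_eq_some_iff.1 hb
      exact h i hi

/-- The nodes of height `h` with a smaller item than all higher nodes. -/
def replies (x : Fin n → ℕ) (d : Fin n → α) (l : ℕ) : Finset (Fin n) :=
  univ.filter fun i => x i + 1 = l ∧ Under (best x d l) (d i)

theorem mem_replies_succ {x : Fin n → ℕ} {h : ℕ} {i : Fin n} :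
    i ∈ replies x d (h + 1) ↔ x i = h ∧ ∀ j, d j ≤ d i → x j ≤ h := by
  simp only [replies, mem_filter, mem_univ, true_and, under_best_iff, Nat.add_right_cancel_iff]
  refine and_congr Iff.rfl (forall_congr' fun j => ?_)
  constructor
  · intro h1 h2
    by_contra h3
    exact absurd (h1 (by omega)) (not_lt.2 h2)
  · intro h1 h2
    by_contra h3
    have := h1 (not_lt.1 h3)
    omega

theorem prod_ite_one_zero {ι : Type*} (S : Finset ι) (A : ι → Prop) [DecidablePred A] :
    ∏ i ∈ S, (if A i then (1 : ENNReal) else 0) = if ∀ i ∈ S, A i then 1 else 0 := by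
  split_ifs with h
  · exact prod_eq_one fun i hi => if_pos (h i hi)
  · push Not at h
    obtain ⟨i, hi, hA⟩ := h
    exact prod_eq_zero hi (if_neg hA)

theorem card_filter_eq_sum {ι : Type*} (S : Finset ι) (A : ι → Prop) [DecidablePred A] :
    (#(S.filter A) : ENNReal) = ∑ i ∈ S, if A i then 1 else 0 := by
  rw [sum_boole]

theorem inv_two_pow_mul_le {n m : ℕ} (h : n ≤ 2 ^ m) : (n : ENNReal) * (1 / 2) ^ m ≤ 1 := by
  rw [one_div, ← ENNReal.inv_pow, ← div_eq_mul_inv]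
  refine ENNReal.div_le_of_le_mul ?_
  rw [one_mul]
  exact_mod_cast h

/-- Below the truncation this is a geometric series in the position of the item. At height `m` the
crude bound `n * 2 ^ (-m) ≤ 1` suffices. -/
theorem sum_replies_le (hd : Function.Injective d) (hn : n ≤ 2 ^ m) {h : ℕ} (hh : h ≤ m)
    (S : Finset (Fin n)) :
    ∑ i ∈ S, mean (geom m) (fun x => if x = h then 1 else 0) *
      mean (geom m) (fun x => if x ≤ h then 1 else 0) ^ #(S.filter fun j => d j < d i) ≤ 1 := by
  rcases hh.lt_or_eq with hh | rfl
  · rw [sum_card_filter_lt d hd (fun k => mean (geom m) (fun x => if x = h then 1 else 0) *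
      mean (geom m) (fun x => if x ≤ h then 1 else 0) ^ k) S]
    exact sum_geometric_le (mean_geom_eq_add_lt hh) _
  · calc _ ≤ ∑ i ∈ S, mean (geom h) (fun x => if x = h then 1 else 0) * 1 := by
          refine sum_le_sum fun i _ => ?_
          gcongr
          exact pow_le_one' (mean_ite_le_one _ _) _
      _ ≤ n * (1 / 2) ^ h := by
          rw [mean_geom_top, mul_one, sum_const, nsmul_eq_mul]
          gcongr
          simpa using card_le_univ S
      _ ≤ 1 := inv_two_pow_mul_le hn

/-- A node replies only if it has height `h` and no smaller item has a larger height; these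
conditions are independent. -/
theorem mean_replies_le (hd : Function.Injective d) (hn : n ≤ 2 ^ m) {h : ℕ} (hh : h ≤ m) :
    mean (independent n fun _ => geom m) (fun x => (#(replies x d (h + 1)) : ENNReal)) ≤ 1 := by
  refine le_trans ?_ (sum_replies_le hd hn hh univ)
  have h1 : ∀ x : Fin n → ℕ, (#(replies x d (h + 1)) : ENNReal) ≤ ∑ i,
      (if x i = h then 1 else 0) * ∏ j ∈ univ.filter (fun j => d j < d i),
        (if x j ≤ h then 1 else 0) := by
    intro x
    rw [replies, card_filter_eq_sum]
    refine sum_le_sum fun i _ => ?_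
    split_ifs with h1 h2
    · rw [prod_ite_one_zero, if_pos, mul_one]
      intro j hj
      have h3 : i ∈ replies x d (h + 1) := mem_filter.2 ⟨mem_univ _, h1⟩
      exact (mem_replies_succ.1 h3).2 j (mem_filter.1 hj).2.le
    · omega
    · exact zero_le
    · exact zero_le
  refine (mean_mono h1).trans (le_of_eq ?_)
  rw [mean_sum]
  refine sum_congr rfl fun i _ => ?_
  exact mean_independent_single (geom m) (by simp) (fun x => if x = h then 1 else 0)
    fun x => if x ≤ h then 1 else 0

/-- The event that a changed node `u` reaches height `h` has to be combined with the replies.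
Leaving `u` out of the count makes both independent; `u` itself adds at most one reply. -/
theorem mean_ge_mul_replies_le (hd : Function.Injective d) (hn : n ≤ 2 ^ m) {h : ℕ} (hh : h ≤ m)
    (u : Fin n) :
    mean (independent n fun _ => geom m) (fun x => (if h ≤ x u then 1 else 0) *
      (1 + #(replies x d (h + 1)) : ENNReal)) ≤ 3 * (1 / 2) ^ h := by
  have h1 : ∀ x : Fin n → ℕ, (if h ≤ x u then 1 else 0) * (1 + #(replies x d (h + 1)) : ENNReal) ≤
      2 * (if h ≤ x u then 1 else 0) + ∑ i ∈ univ.erase u, (if h ≤ x u then 1 else 0) *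
        ((if x i = h then 1 else 0) * ∏ j ∈ (univ.erase u).filter (fun j => d j < d i),
          (if x j ≤ h then 1 else 0)) := by
    intro x
    rw [← mul_sum, mul_comm 2, ← mul_add]
    refine mul_le_mul' le_rfl ?_
    rw [show (2 : ENNReal) = 1 + 1 by norm_num, add_assoc]
    refine add_le_add le_rfl ?_
    rw [replies, card_filter_eq_sum, ← add_sum_erase _ _ (mem_univ u)]
    refine add_le_add (by split_ifs <;> simp) (sum_le_sum fun i _ => ?_)
    split_ifs with h1 h2
    · rw [prod_ite_one_zero, if_pos, mul_one]
      intro j hj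
      have h3 : i ∈ replies x d (h + 1) := mem_filter.2 ⟨mem_univ _, h1⟩
      exact (mem_replies_succ.1 h3).2 j (mem_filter.1 hj).2.le
    · omega
    · exact zero_le
    · exact zero_le
  refine (mean_mono h1).trans ?_
  rw [mean_add, mean_sum, mean_const_mul,
    mean_independent_eval (geom m) u (fun y => if h ≤ y then 1 else 0), mean_geom_ge hh]
  have h2 : ∀ i ∈ univ.erase u, mean (independent n fun _ => geom m) (fun x =>
      (if h ≤ x u then 1 else 0) * ((if x i = h then 1 else 0) *
        ∏ j ∈ (univ.erase u).filter (fun j => d j < d i), (if x j ≤ h then 1 else 0))) =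
      (1 / 2) ^ h * (mean (geom m) (fun x => if x = h then 1 else 0) *
      mean (geom m) (fun x => if x ≤ h then 1 else 0) ^
        #((univ.erase u).filter fun j => d j < d i)) := by
    intro i hi
    rw [← mean_geom_ge hh]
    exact mean_independent_pair (geom m) (ne_of_mem_erase hi).symm (by simp) (by simp)
      (fun y => if h ≤ y then 1 else 0) (fun x => if x = h then 1 else 0)
      fun x => if x ≤ h then 1 else 0
  rw [sum_congr rfl h2, ← mul_sum]
  calc 2 * (1 / 2 : ENNReal) ^ h + _ ≤ 2 * (1 / 2) ^ h + (1 / 2) ^ h * 1 := by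
        gcongr
        exact sum_replies_le hd hn hh _
    _ = 3 * (1 / 2) ^ h := by ring

/-- Counts ties for the largest height in `D`. The first bound holds since few ties are expected,
the second since few nodes reach height `h`. -/
theorem mean_pings_le (hn : n ≤ 2 ^ m) {h : ℕ} (hh : h ≤ m) (D : Finset (Fin n)) :
    mean (independent n fun _ => geom m) (fun x => ((if ∀ i ∈ D, x i ≤ h then
      #(D.filter fun i => x i = h) else 0 : ℕ) : ENNReal)) ≤ min (1 : ENNReal) (#D * (1 / 2) ^ h) := by
  have h1 : mean (independent n fun _ => geom m) (fun x => ((if ∀ i ∈ D, x i ≤ h then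
      #(D.filter fun i => x i = h) else 0 : ℕ) : ENNReal)) ≤
      #D * (mean (geom m) (fun x => if x = h then 1 else 0) *
        mean (geom m) (fun x => if x ≤ h then 1 else 0) ^ (#D - 1)) := by
    have h2 : ∀ x : Fin n → ℕ, ((if ∀ i ∈ D, x i ≤ h then
      #(D.filter fun i => x i = h) else 0 : ℕ) : ENNReal) ≤ ∑ i ∈ D,
        (if x i = h then 1 else 0) * ∏ j ∈ D.erase i, (if x j ≤ h then 1 else 0) := by
      intro x
      split_ifs with hx
      · rw [card_filter_eq_sum]
        refine sum_le_sum fun i _ => ?_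
        rw [prod_ite_one_zero, if_pos fun j hj => hx j (mem_of_mem_erase hj), mul_one]
      · simp
    refine (mean_mono h2).trans (le_of_eq ?_)
    rw [mean_sum, ← nsmul_eq_mul, ← sum_const]
    refine sum_congr rfl fun i hi => ?_
    rw [← card_erase_of_mem hi]
    exact mean_independent_single (geom m) (by simp) (fun x => if x = h then 1 else 0)
      fun x => if x ≤ h then 1 else 0
  refine le_min ?_ ?_
  · rcases hh.lt_or_eq with hh | rfl
    · exact h1.trans (card_mul_pow_le (mean_geom_eq_add_lt hh) _)
    · refine h1.trans (le_trans ?_ (inv_two_pow_mul_le hn))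
      rw [mean_geom_top]
      have : #D ≤ n := by simpa using card_le_univ D
      refine mul_le_mul' (by exact_mod_cast this) ?_
      exact mul_le_of_le_one_right' (pow_le_one' (mean_ite_le_one _ _) _)
  · refine h1.trans ?_
    gcongr
    exact (mul_le_of_le_one_right' (pow_le_one' (mean_ite_le_one _ _) _)).trans
      (mean_geom_eq_le hh)

/-- The constant bound ignores the event; the other one is a union bound over the changed nodes. -/
theorem mean_hot_le (hd : Function.Injective d) (hn : n ≤ 2 ^ m) {h : ℕ} (hh : h ≤ m)
    (D : Finset (Fin n)) :
    mean (independent n fun _ => geom m) (fun x => ((if ∃ i ∈ D, h ≤ x i then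
      1 + #(replies x d (h + 1)) else 0 : ℕ) : ENNReal)) ≤ min (2 : ENNReal) (3 * #D * (1 / 2) ^ h) := by
  refine le_min ?_ ?_
  · calc _ ≤ mean (independent n fun _ => geom m) (fun x =>
            (1 : ENNReal) + #(replies x d (h + 1))) := by
          refine mean_mono fun x => ?_
          split_ifs <;> simp
      _ ≤ 1 + 1 := by
          rw [mean_add, mean_const]
          gcongr
          exact mean_replies_le hd hn hh
      _ = 2 := by norm_num
  · calc _ ≤ mean (independent n fun _ => geom m) (fun x => ∑ u ∈ D,
            (if h ≤ x u then 1 else 0) * (1 + #(replies x d (h + 1)) : ENNReal)) := by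
          refine mean_mono fun x => ?_
          split_ifs with hx
          · obtain ⟨u, hu, hxu⟩ := hx
            refine le_trans ?_ (single_le_sum (fun _ _ => zero_le) hu)
            rw [if_pos hxu, one_mul]
            push_cast
            exact le_rfl
          · simp
      _ ≤ ∑ u ∈ D, 3 * (1 / 2) ^ h := by
          rw [mean_sum]
          exact sum_le_sum fun u _ => mean_ge_mul_replies_le hd hn hh u
      _ = 3 * #D * (1 / 2) ^ h := by
          rw [sum_const, nsmul_eq_mul]
          ring

/-- The first `a` levels cost at most `3` each, and from there on the terms decrease geometrically.
-/
theorem sum_min_le {M a : ℕ} (ha : M ≤ 2 ^ a) (K : ℕ) :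
    ∑ h ∈ range K, min (3 : ENNReal) (4 * M * (1 / 2) ^ h) ≤ 3 * a + 8 := by
  calc ∑ h ∈ range K, min (3 : ENNReal) (4 * M * (1 / 2) ^ h)
      ≤ ∑ h ∈ range (a + K), min (3 : ENNReal) (4 * M * (1 / 2) ^ h) :=
        sum_le_sum_of_subset (range_subset_range.2 (by omega))
    _ = ∑ h ∈ range a, min (3 : ENNReal) (4 * M * (1 / 2) ^ h) +
        ∑ h ∈ range K, min (3 : ENNReal) (4 * M * (1 / 2) ^ (a + h)) := sum_range_add _ _ _
    _ ≤ ∑ h ∈ range a, 3 + ∑ h ∈ range K, 8 * (1 / 2 * (1 / 2) ^ h) := by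
        refine add_le_add (sum_le_sum fun _ _ => min_le_left _ _) (sum_le_sum fun h _ => ?_)
        refine (min_le_right _ _).trans ?_
        calc 4 * (M : ENNReal) * (1 / 2) ^ (a + h) = 4 * (M * (1 / 2) ^ a) * (1 / 2) ^ h := by
              rw [pow_add]
              ring
          _ ≤ 4 * 1 * (1 / 2) ^ h := by
              gcongr
              exact inv_two_pow_mul_le ha
          _ = 8 * (1 / 2 * (1 / 2) ^ h) := by
              rw [← mul_assoc]
              congr 1
              rw [show (8 : ENNReal) = 4 * 2 by norm_num, mul_assoc, one_div,
                ENNReal.mul_inv_cancel (by norm_num) (by norm_num)]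
    _ ≤ 3 * a + 8 * 1 := by
        rw [← mul_sum, sum_const, card_range, nsmul_eq_mul, mul_comm (a : ENNReal)]
        gcongr
        exact sum_geometric_le (ENNReal.add_halves 1) K
    _ = 3 * a + 8 := by rw [mul_one]

/-- The expected cost of refreshing a copy after changes at the nodes in `D`. -/
theorem mean_copy_le (hd : Function.Injective d) (hn : n ≤ 2 ^ m) (D : Finset (Fin n)) {a : ℕ}
    (ha : #D ≤ 2 ^ a) :
    mean (independent n fun _ => geom m) (fun x => (((∑ h ∈ range (m + 1),
      if ∀ i ∈ D, x i ≤ h then #(D.filter fun i => x i = h) else 0) +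
      ∑ l ∈ range (m + 2), if ∃ i ∈ D, l ≤ x i + 1 then 1 + #(replies x d l) else 0 : ℕ) :
        ENNReal)) ≤ 3 * a + 9 := by
  have h1 : ∀ x : Fin n → ℕ, (((∑ h ∈ range (m + 1),
      if ∀ i ∈ D, x i ≤ h then #(D.filter fun i => x i = h) else 0) +
      ∑ l ∈ range (m + 2), if ∃ i ∈ D, l ≤ x i + 1 then 1 + #(replies x d l) else 0 : ℕ) :
        ENNReal) ≤ (∑ h ∈ range (m + 1), (((if ∀ i ∈ D, x i ≤ h then #(D.filter fun i => x i = h)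
          else 0 : ℕ) : ENNReal) + ((if ∃ i ∈ D, h ≤ x i then 1 + #(replies x d (h + 1)) else 0 : ℕ)
          : ENNReal))) + 1 := by
    intro x
    -- The replies at level `h + 1` belong to height `h`; the announcement of level `0` has no
    -- replies and accounts for the additional `1`.
    rw [sum_range_succ' _ (m + 1), sum_add_distrib, ← add_assoc, Nat.cast_add, Nat.cast_add,
      Nat.cast_sum, Nat.cast_sum]
    simp only [Nat.add_le_add_iff_right]
    gcongr
    have : replies x d 0 = ∅ := by simp [replies]
    rw [this]
    split_ifs <;> simp
  refine (mean_mono h1).trans ?_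
  rw [mean_add, mean_const, mean_sum, show (3 * a + 9 : ENNReal) = 3 * a + 8 + 1 by
    rw [add_assoc]; norm_num]
  gcongr
  refine le_trans (sum_le_sum fun h hh => ?_) (sum_min_le ha (m + 1))
  rw [mem_range] at hh
  rw [mean_add]
  have h2 := mean_pings_le hn (h := h) (by omega) D
  have h3 := mean_hot_le hd hn (h := h) (by omega) D
  refine le_min ((add_le_add (h2.trans (min_le_left _ _)) (h3.trans (min_le_left _ _))).trans
    (by norm_num)) ((add_le_add (h2.trans (min_le_right _ _)) (h3.trans (min_le_right _ _))).trans
    (le_of_eq (by ring)))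

end copy

end Monitoring

end

noncomputable section

namespace Monitoring

open Finset

set_option linter.unusedSectionVars false

/-! ### The level of the smallest high item -/

section before

variable {α : Type u} [LinearOrder α] {n m : ℕ} {d : Fin n → α}

theorem rank_eq (hd : Function.Injective d) (v : Fin n) :
    rank d (d v) = #(univ.filter fun w => d w < d v) + 1 := by
  have h : (univ.filter fun w => d w ≤ d v) = insert v (univ.filter fun w => d w < d v) := by
    ext w
    simp only [mem_filter, mem_univ, true_and, mem_insert, le_iff_lt_or_eq, hd.eq_iff]
    tauto
  rw [rank, h, card_insert_of_notMem (by simp)]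

theorem card_rank_le (hd : Function.Injective d) {X : ℕ} (hX : X ≤ n) :
    #(univ.filter fun v => rank d (d v) ≤ X) = X := by
  have h := sum_card_filter_lt d hd (fun r => if r < X then 1 else 0) univ
  rw [card_filter]
  simp only [rank_eq hd, Nat.succ_le_iff]
  have h2 : (range n).filter (· < X) = range X := by
    ext r
    simp only [mem_filter, mem_range]
    omega
  rw [h, card_univ, Fintype.card_fin, ← card_filter, h2, card_range]

/-- The nodes with smaller items than all nodes of height at least `l`. -/
def before (x : Fin n → ℕ) (d : Fin n → α) (l : ℕ) : Finset (Fin n) :=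
  univ.filter fun v => ∀ w, d w ≤ d v → x w < l

theorem before_of_best_eq_none {x : Fin n → ℕ} {l : ℕ} (h : best x d l = none) :
    before x d l = univ := by
  rw [best_eq_none_iff] at h
  simp [before, h]

theorem before_of_best_eq_some {x : Fin n → ℕ} {l : ℕ} {v : Fin n} (h : best x d l = some (d v)) :
    before x d l = univ.filter fun w => d w < d v := by
  obtain ⟨⟨i, hi, hiv⟩, h2⟩ := best_eq_some_iff.1 h
  ext w
  simp only [before, mem_filter, mem_univ, true_and]
  constructor
  · intro h3
    by_contra h4
    exact absurd (h3 i (hiv.trans_le (not_lt.1 h4))) (by omega)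
  · intro h3 z hz
    by_contra h4
    exact absurd (h2 z (not_lt.1 h4)) (not_le.2 (hz.trans_lt h3))

theorem rank_of_best_eq_some (hd : Function.Injective d) {x : Fin n → ℕ} {l : ℕ} {v : Fin n}
    (h : best x d l = some (d v)) : rank d (d v) = #(before x d l) + 1 := by
  rw [rank_eq hd, before_of_best_eq_some h]

theorem half_pow_add_lt {l : ℕ} (hl : l ≤ m) :
    (1 / 2 : ENNReal) ^ l + mean (geom m) (fun x => if x < l then 1 else 0) = 1 := by
  rw [← mean_geom_ge hl]
  refine Eq.trans ?_ (mean_ite_add_ite_not (geom m) (fun x => l ≤ x))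
  refine congrArg _ (mean_congr_support fun x _ => ?_)
  split_ifs <;> first | omega | rfl

theorem half_pow_eq_ofReal (l : ℕ) : (1 / 2 : ENNReal) ^ l = ENNReal.ofReal ((1 / 2) ^ l) := by
  rw [ENNReal.ofReal_pow (by norm_num), half_ofReal]

theorem mean_geom_lt {l : ℕ} (hl : l ≤ m) :
    mean (geom m) (fun x => if x < l then 1 else 0) = ENNReal.ofReal (1 - (1 / 2) ^ l) := by
  have h := half_pow_add_lt hl
  rw [half_pow_eq_ofReal] at h
  have h1 : ((1 : ℝ) / 2) ^ l ≤ 1 := pow_le_one₀ (by norm_num) (by norm_num)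
  rw [ENNReal.ofReal_sub _ (by positivity), ENNReal.ofReal_one]
  refine ENNReal.eq_sub_of_add_eq ENNReal.ofReal_ne_top ?_
  rw [add_comm, h]

/-- The position of the first node reaching height `l` is a geometric variable with mean at most `2
^ l`. -/
theorem mean_card_before_le (hd : Function.Injective d) {l : ℕ} (hl : l ≤ m) :
    mean (independent n fun _ => geom m) (fun x => (#(before x d l) : ENNReal)) ≤
      ENNReal.ofReal (2 ^ l) := by
  set r := mean (geom m) (fun x => if x < l then 1 else 0) with hr
  have h1 : ∀ x : Fin n → ℕ, (#(before x d l) : ENNReal) ≤ ∑ v,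
      ∏ w ∈ univ.filter (fun w => d w < d v), (if x w < l then 1 else 0) := by
    intro x
    rw [before, card_filter_eq_sum]
    refine sum_le_sum fun v _ => ?_
    split_ifs with h
    · rw [prod_ite_one_zero, if_pos]
      exact fun w hw => h w (mem_filter.1 hw).2.le
    · exact zero_le
  have h2 : mean (independent n fun _ => geom m) (fun x => (#(before x d l) : ENNReal)) ≤
      ∑ k ∈ range n, r ^ k := by
    refine (mean_mono h1).trans (le_of_eq ?_)
    rw [mean_sum]
    have h3 := sum_card_filter_lt d hd (fun k => r ^ k) univ
    rw [card_univ, Fintype.card_fin] at h3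
    rw [← h3]
    refine sum_congr rfl fun v _ => ?_
    exact mean_independent_pow (geom m) _ fun x => if x < l then 1 else 0
  refine h2.trans ?_
  have h4 := sum_geometric_le (half_pow_add_lt hl) n
  rw [← mul_sum, half_pow_eq_ofReal] at h4
  have h5 : ENNReal.ofReal (2 ^ l) * ENNReal.ofReal ((1 / 2) ^ l) = 1 := by
    rw [← ENNReal.ofReal_mul (by positivity), ← mul_pow]
    norm_num
  calc ∑ k ∈ range n, r ^ k = ENNReal.ofReal (2 ^ l) * (ENNReal.ofReal ((1 / 2) ^ l) *
        ∑ k ∈ range n, r ^ k) := by rw [← mul_assoc, h5, one_mul]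
    _ ≤ ENNReal.ofReal (2 ^ l) * 1 := by gcongr
    _ = _ := mul_one _

-- Union bound over the `X` smallest items.
open Classical in
theorem mean_rank_le_le (hd : Function.Injective d) {l : ℕ} (hl : l ≤ m) (X : ℕ) :
    mean (independent n fun _ => geom m) (fun x =>
      if ∃ v, best x d l = some (d v) ∧ rank d (d v) ≤ X then 1 else 0) ≤
      ENNReal.ofReal (X / 2 ^ l) := by
  have h0 : #(univ.filter fun v => rank d (d v) ≤ X) ≤ X := by
    rcases le_total X n with h | h
    · exact (card_rank_le hd h).le
    · exact (card_le_univ _).trans (by simpa using h)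
  calc _ ≤ mean (independent n fun _ => geom m) (fun x =>
        ∑ v ∈ univ.filter (fun v => rank d (d v) ≤ X), if l ≤ x v then 1 else 0) := by
        refine mean_mono fun x => ?_
        split_ifs with h
        · obtain ⟨v, hv, hX⟩ := h
          obtain ⟨⟨i, hi, hiv⟩, h2⟩ := best_eq_some_iff.1 hv
          obtain rfl : i = v := hd hiv
          refine le_trans ?_ (single_le_sum (fun _ _ => zero_le)
            (mem_filter.2 ⟨mem_univ i, hX⟩))
          rw [if_pos hi]
        · exact zero_le
    _ = #(univ.filter fun v => rank d (d v) ≤ X) * (1 / 2) ^ l := by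
        rw [mean_sum, ← nsmul_eq_mul, ← sum_const]
        refine sum_congr rfl fun v _ => ?_
        rw [← mean_geom_ge hl]
        exact mean_independent_eval (geom m) v fun y => if l ≤ y then 1 else 0
    _ ≤ X * (1 / 2) ^ l := by gcongr
    _ = ENNReal.ofReal (X / 2 ^ l) := by
        rw [half_pow_eq_ofReal, ← ENNReal.ofReal_natCast, ← ENNReal.ofReal_mul (by positivity)]
        congr 1
        rw [one_div, inv_pow]
        rfl

/-- If the first `X` items are all before the threshold, none of their nodes reaches height `l`,
which has probability `(1 - 2 ^ (-l)) ^ X`. -/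
theorem mean_le_card_before_le (hd : Function.Injective d) {l : ℕ} (hl : l ≤ m) (X : ℕ) :
    mean (independent n fun _ => geom m) (fun x => if X ≤ #(before x d l) then 1 else 0) ≤
      ENNReal.ofReal (Real.exp (-(X / 2 ^ l))) := by
  rcases le_or_gt X n with hX | hX
  · have h1 : ∀ x : Fin n → ℕ, (if X ≤ #(before x d l) then (1 : ENNReal) else 0) ≤
        ∏ w ∈ univ.filter (fun v => rank d (d v) ≤ X), (if x w < l then 1 else 0) := by
      intro x
      split_ifs with h
      · rw [prod_ite_one_zero, if_pos]
        intro v hv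
        have h2 : v ∈ before x d l := by
          by_contra h3
          have h4 : before x d l ⊆ univ.filter fun w => d w < d v := by
            intro w hw
            refine mem_filter.2 ⟨mem_univ _, ?_⟩
            by_contra h5
            refine h3 (mem_filter.2 ⟨mem_univ _, fun z hz => ?_⟩)
            exact (mem_filter.1 hw).2 z (hz.trans (not_lt.1 h5))
          have h5 := card_le_card h4
          have h6 := (mem_filter.1 hv).2
          rw [rank_eq hd] at h6
          omega
        exact (mem_filter.1 h2).2 v le_rfl
      · exact zero_le
    refine (mean_mono h1).trans ?_
    have h2 := mean_independent_pow (n := n) (geom m) (univ.filter fun v => rank d (d v) ≤ X)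
      fun y => if y < l then 1 else 0
    rw [h2, card_rank_le hd hX, mean_geom_lt hl]
    have h3 : ((1 : ℝ) / 2) ^ l ≤ 1 := pow_le_one₀ (by norm_num) (by norm_num)
    rw [← ENNReal.ofReal_pow (by linarith)]
    refine ENNReal.ofReal_le_ofReal ?_
    have h4 : 1 - (1 / 2 : ℝ) ^ l ≤ Real.exp (-((1 / 2) ^ l)) := by
      have := Real.add_one_le_exp (-((1 / 2 : ℝ) ^ l))
      linarith
    refine (pow_le_pow_left₀ (by linarith) h4 X).trans (le_of_eq ?_)
    rw [← Real.exp_nat_mul]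
    congr 1
    rw [one_div, inv_pow]
    ring
  · have h1 : ∀ x : Fin n → ℕ, (if X ≤ #(before x d l) then (1 : ENNReal) else 0) = 0 := by
      intro x
      have : #(before x d l) ≤ n := by simpa using card_le_univ (before x d l)
      rw [if_neg (by omega)]
    simp only [h1, mean_const]
    exact zero_le

/-- The probability that the item of a node is the least one at its height. -/
theorem mean_not_min_le (hd : Function.Injective d) (hm : 2 * n ≤ 2 ^ m) (v : Fin n) :
    mean (independent n fun _ => geom m) (fun x => if best x d (x v) = some (d v) then 0 else 1) ≤
      ENNReal.ofReal (1 - 1 / (8 * rank d (d v))) := by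
  set r := rank d (d v) with hr
  have hr1 : 1 ≤ r := by rw [hr, rank_eq hd]; omega
  have hrn : r ≤ n := by
    rw [hr, rank]
    simpa using card_le_univ (univ.filter fun j => d j ≤ d v)
  -- With `2 * r ≤ 2 ^ l ≤ 4 * r` the node reaches height `l` with probability at least `1 / (4 *
  -- r)`, and then all smaller items stay below height `l` with probability at least `1 / 2`.
  set l := Nat.clog 2 (2 * r) with hl
  have hlm : l ≤ m := (Nat.clog_le_iff_le_pow one_lt_two).2 (by omega)
  have hl1 : 2 * r ≤ 2 ^ l := Nat.le_pow_clog one_lt_two _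
  have hl2 : 2 ^ l ≤ 4 * r := by
    have := Nat.pow_pred_clog_lt_self one_lt_two (x := 2 * r) (by omega)
    have h0 : l ≠ 0 := fun h => by rw [h] at hl1; omega
    obtain ⟨q, hq⟩ := Nat.exists_eq_succ_of_ne_zero h0
    rw [← hl, hq, Nat.pred_succ] at this
    rw [hq, pow_succ]
    omega
  have h1 : ∀ x : Fin n → ℕ, (if l ≤ x v then (1 : ENNReal) else 0) *
      ∏ w ∈ univ.filter (fun w => d w < d v), (if x w < l then 1 else 0) ≤
      if best x d (x v) = some (d v) then 1 else 0 := by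
    intro x
    rw [prod_ite_one_zero]
    split_ifs with h2 h3 h4 <;> try simp
    refine h4 (best_eq_some_iff.2 ⟨⟨v, le_rfl, rfl⟩, fun w hw => ?_⟩)
    by_contra h5
    exact absurd (h3 w (mem_filter.2 ⟨mem_univ _, not_le.1 h5⟩)) (by omega)
  have h2 : ENNReal.ofReal (1 / (8 * r)) ≤ mean (independent n fun _ => geom m)
      (fun x => if best x d (x v) = some (d v) then 1 else 0) := by
    refine le_trans ?_ (mean_mono h1)
    have h3 := mean_independent_single (geom m) (v := v)
      (S := univ.filter fun w => d w < d v) (by simp) (fun y => if l ≤ y then 1 else 0)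
      fun y => if y < l then 1 else 0
    rw [h3, mean_geom_ge hlm, mean_geom_lt hlm, half_pow_eq_ofReal]
    have h4 : ((1 : ℝ) / 2) ^ l ≤ 1 := pow_le_one₀ (by norm_num) (by norm_num)
    rw [← ENNReal.ofReal_pow (by linarith), ← ENNReal.ofReal_mul (by positivity)]
    refine ENNReal.ofReal_le_ofReal ?_
    have h5 : #(univ.filter fun w => d w < d v) = r - 1 := by
      have := rank_eq hd v
      omega
    rw [h5]
    have h6 : (2 * r : ℝ) ≤ 2 ^ l := by exact_mod_cast hl1
    have h7 : (2 : ℝ) ^ l ≤ 4 * r := by exact_mod_cast hl2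
    have hr0 : (0 : ℝ) < r := by exact_mod_cast hr1
    have h8 : ((1 : ℝ) / 2) ^ l ≤ 1 / (2 * r) := by
      rw [one_div, inv_pow, ← one_div]
      exact one_div_le_one_div_of_le (by positivity) h6
    have h9 : 1 / (4 * r) ≤ ((1 : ℝ) / 2) ^ l := by
      rw [one_div, one_div, inv_pow]
      exact inv_anti₀ (by positivity) h7
    have h10 := one_add_mul_le_pow (a := -((1 : ℝ) / 2) ^ l) (by linarith) (r - 1)
    have h11 : (1 : ℝ) / 2 ≤ (1 - (1 / 2) ^ l) ^ (r - 1) := by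
      rw [sub_eq_add_neg]
      refine le_trans ?_ h10
      have h12 : ((r - 1 : ℕ) : ℝ) ≤ r := by exact_mod_cast Nat.sub_le r 1
      have h13 : ((r - 1 : ℕ) : ℝ) * (1 / 2) ^ l ≤ r * (1 / (2 * r)) := by gcongr
      have h14 : (r : ℝ) * (1 / (2 * r)) = 1 / 2 := by field_simp
      linarith
    calc (1 : ℝ) / (8 * r) = 1 / (4 * r) * (1 / 2) := by field_simp; norm_num
      _ ≤ _ := by gcongr
  have h3 := mean_ite_add_ite_not (independent n fun _ => geom m)
    fun x => best x d (x v) = some (d v)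
  have h4 : (1 : ℝ) / (8 * r) ≤ 1 := by
    rw [div_le_one (by positivity)]
    have : (1 : ℝ) ≤ r := by exact_mod_cast hr1
    linarith
  have h5 : ENNReal.ofReal (1 / (8 * r)) + ENNReal.ofReal (1 - 1 / (8 * r)) = 1 := by
    rw [← ENNReal.ofReal_add (by positivity) (by linarith)]
    simp
  exact (ENNReal.add_le_add_iff_left (a := ENNReal.ofReal (1 / (8 * r)))
    ENNReal.ofReal_ne_top).1 ((add_le_add h2 le_rfl).trans (h3.trans h5.symm).le)

end before

end Monitoring

end

noncomputable section

namespace Monitoring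

open Finset

set_option linter.unusedSectionVars false

/-! ### Heights of all copies -/

namespace Params

variable (p : Params) {α : Type u} [LinearOrder α] {n : ℕ} {d : Fin n → α}

/-- Nodes draw their own heights, but the estimates are made copy by copy. -/
theorem heights_map_swap :
    (p.heights n).map (fun g c i => g i c) =
      independent (p.B + 1) fun _ => independent n fun _ => geom p.m := by
  refine PMF.ext fun y => ?_
  rw [PMF.map_apply, tsum_eq_single (fun i c => y c i)]
  · rw [if_pos rfl, heights, independent_apply, independent_apply]
    simp only [independent_apply]
    exact prod_comm
  · intro g hg
    rw [if_neg]
    rintro rfl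
    exact hg rfl

theorem mean_heights_single (c : Fin (p.B + 1)) (F : (Fin n → ℕ) → ENNReal) :
    mean (p.heights n) (fun g => F fun i => g i c) = mean (independent n fun _ => geom p.m) F := by
  rw [← mean_independent_eval (n := p.B + 1) (q := independent n fun _ => geom p.m) c F,
    ← heights_map_swap, mean_map]

theorem side_last : side α p.B (Fin.last p.B) = dualOrder α := if_pos rfl

theorem side_castSucc (c : Fin p.B) : side α p.B c.castSucc = ‹LinearOrder α› :=
  if_neg (Fin.castSucc_lt_last c).ne

theorem top_castSucc (g : Fin n → Fin (p.B + 1) → ℕ) (c : Fin p.B) (l : ℕ) :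
    p.top g d c.castSucc l = best (fun i => g i c.castSucc) d l := by
  unfold top
  rw [side_castSucc]

theorem mean_copyCost_le (hd : Function.Injective d) (hn : n ≤ 2 ^ p.m) (dirty : Fin n → Bool)
    {a : ℕ} (ha : #(univ.filter fun i => dirty i = true) ≤ 2 ^ a) (c : Fin (p.B + 1)) :
    mean (p.heights n) (fun g => (p.copyCost g dirty d c p.m : ENNReal)) ≤ 3 * a + 9 := by
  refine le_trans (le_of_eq ?_) (@mean_copy_le α (side α p.B c) n p.m d hd hn _ a ha)
  rw [← p.mean_heights_single c]
  refine mean_congr_support fun g _ => ?_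
  congr 1
  unfold copyCost
  congr 1
  · refine sum_congr rfl fun h _ => ?_
    have h1 : p.pingers g dirty c h =
        (univ.filter fun i => dirty i = true).filter fun i => g i c = h := by
      rw [filter_filter]
      rfl
    rw [h1]
    congr 1
    simp
  · refine sum_congr rfl fun l _ => ?_
    have h1 : p.repliers g d c l = @replies α (side α p.B c) n (fun i => g i c) d l := by
      ext i
      simp only [repliers, replies, mem_filter]
      rfl
    rw [h1]
    congr 1
    simp

theorem mean_refreshCost_le (hd : Function.Injective d) (hn : n ≤ 2 ^ p.m) (dirty : Fin n → Bool)
    {a : ℕ} (ha : #(univ.filter fun i => dirty i = true) ≤ 2 ^ a) :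
    mean (p.heights n) (fun g => (p.refreshCost g dirty d : ENNReal)) ≤
      ENNReal.ofReal (1 + (p.B + 1) * (3 * a + 10)) := by
  have h1 : ∀ g, (p.refreshCost g dirty d : ENNReal) =
      1 + ∑ c, (1 + (p.copyCost g dirty d c p.m : ENNReal)) := by
    intro g
    simp [refreshCost]
  simp only [h1]
  rw [mean_add, mean_const, mean_sum]
  have h2 : ∀ c ∈ (univ : Finset (Fin (p.B + 1))), mean (p.heights n)
      (fun g => 1 + (p.copyCost g dirty d c p.m : ENNReal)) ≤ 3 * a + 10 := by
    intro c _
    rw [mean_add, mean_const]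
    refine (add_le_add le_rfl (p.mean_copyCost_le hd hn dirty ha c)).trans (le_of_eq ?_)
    ring
  refine (add_le_add le_rfl (sum_le_sum h2)).trans (le_of_eq ?_)
  rw [sum_const, card_univ, Fintype.card_fin, nsmul_eq_mul]
  rw [show (1 + (p.B + 1) * (3 * a + 10) : ℝ) = ((1 + (p.B + 1) * (3 * a + 10) : ℕ) : ℝ) by
    push_cast; ring, ENNReal.ofReal_natCast]
  push_cast
  ring

/-- The `B` lower copies are independent, and the last one is ignored. The power of `1 - 1 / (8 *
r)` is weakened to a rational bound whose sum over the ranks is again a harmonic sum. -/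
theorem mean_mem_hidden_le (hd : Function.Injective d) (hm : 2 * n ≤ 2 ^ p.m) (i : Fin n) :
    mean (p.heights n) (fun g => if i ∈ p.hidden g d then 1 else 0) ≤
      ENNReal.ofReal (8 * rank d (d i) / (8 * rank d (d i) + p.B)) := by
  set f : (Fin n → ℕ) → ENNReal := fun x => if best x d (x i) = some (d i) then 0 else 1 with hf
  set F : Fin (p.B + 1) → (Fin n → ℕ) → ENNReal :=
    fun c x => if c = Fin.last p.B then 1 else f x with hF
  have h1 : ∀ g : Fin n → Fin (p.B + 1) → ℕ, (if i ∈ p.hidden g d then (1 : ENNReal) else 0) ≤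
      ∏ c : Fin (p.B + 1), F c fun i => g i c := by
    intro g
    split_ifs with h
    · refine (prod_eq_one fun c _ => ?_).ge
      rw [hF]
      simp only
      split_ifs with hc
      · rfl
      · obtain ⟨c, rfl⟩ := Fin.exists_castSucc_eq.2 hc
        have h2 := (mem_filter.1 h).2 c.castSucc
        rw [top_castSucc] at h2
        exact if_neg h2
    · exact zero_le
  set r := rank d (d i) with hr
  have hr1 : 1 ≤ r := by rw [hr, rank_eq hd]; omega
  have hr0 : (1 : ℝ) ≤ r := by exact_mod_cast hr1
  calc _ ≤ _ := mean_mono h1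
    _ = mean ((p.heights n).map fun g c i => g i c)
        (fun y => ∏ c, F c (y c)) :=
      (mean_map (p.heights n) (fun g c i => g i c) fun y => ∏ c, F c (y c)).symm
    _ = mean (independent n fun _ => geom p.m) f ^ p.B := by
      rw [heights_map_swap, mean_independent_prod, Fin.prod_univ_castSucc]
      simp [hF, Fin.castSucc_ne_last]
    _ ≤ ENNReal.ofReal (1 - 1 / (8 * r)) ^ p.B := by
      gcongr
      exact mean_not_min_le hd hm i
    _ ≤ _ := by
      have h2 : (0 : ℝ) ≤ 1 - 1 / (8 * r) := by
        rw [sub_nonneg, div_le_one (by positivity)]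
        linarith
      rw [← ENNReal.ofReal_pow h2]
      refine ENNReal.ofReal_le_ofReal ?_
      have h3 := Real.one_sub_le_exp_neg (1 / (8 * r : ℝ))
      have h4 : Real.exp (-(1 / (8 * r : ℝ))) ^ p.B = (Real.exp (p.B / (8 * r)))⁻¹ := by
        rw [← Real.exp_nat_mul, ← Real.exp_neg]
        congr 1
        ring
      calc (1 - 1 / (8 * r : ℝ)) ^ p.B ≤ Real.exp (-(1 / (8 * r : ℝ))) ^ p.B := by gcongr
        _ = (Real.exp (p.B / (8 * r)))⁻¹ := h4
        _ ≤ (p.B / (8 * r) + 1 : ℝ)⁻¹ := inv_anti₀ (by positivity) (Real.add_one_le_exp _)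
        _ = _ := by field_simp; ring

/-- By linearity, one summand for each rank up to `k`. -/
theorem mean_open'_hidden_le (hd : Function.Injective d) (hm : 2 * n ≤ 2 ^ p.m) {k : ℕ}
    (hk : k ≤ n) :
    mean (p.heights n) (fun g => (open' d univ k (p.hidden g d) : ENNReal)) ≤
      ENNReal.ofReal (∑ r ∈ range k, 8 * (r + 1 : ℝ) / (8 * (r + 1) + p.B)) := by
  have h1 : ∀ g, (open' d univ k (p.hidden g d) : ENNReal) ≤ ∑ v : Fin n,
      if #(univ.filter fun w => d w < d v) < k then (if v ∈ p.hidden g d then 1 else 0) else 0 := by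
    intro g
    rw [open', ← filter_univ_mem (p.hidden g d), filter_filter, card_filter_eq_sum]
    refine sum_le_sum fun v _ => ?_
    have h2 : Low d univ k (some (d v)) ↔ #(univ.filter fun w => d w < d v) < k := by
      rw [← Nat.add_one_le_iff, ← rank_eq hd]
      rfl
    by_cases h3 : v ∈ p.hidden g d <;> by_cases h4 : Low d univ k (some (d v)) <;>
      simp [h3, h4, h2.symm]
  refine (mean_mono h1).trans ?_
  rw [mean_sum]
  have h2 : ∀ v ∈ (univ : Finset (Fin n)), mean (p.heights n) (fun g =>
      if #(univ.filter fun w => d w < d v) < k then (if v ∈ p.hidden g d then 1 else 0) else 0) ≤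
      (fun r => ENNReal.ofReal (if r < k then 8 * (r + 1 : ℝ) / (8 * (r + 1) + p.B) else 0))
        #(univ.filter fun w => d w < d v) := by
    intro v _
    split_ifs with h
    · simp only [h, if_true]
      refine (p.mean_mem_hidden_le hd hm v).trans (le_of_eq ?_)
      rw [rank_eq hd]
      push_cast
      rfl
    · simp
  refine (sum_le_sum h2).trans (le_of_eq ?_)
  rw [sum_card_filter_lt d hd (fun r => ENNReal.ofReal (if r < k then
    8 * (r + 1 : ℝ) / (8 * (r + 1) + p.B) else 0)) univ, card_univ, Fintype.card_fin,
    ← ENNReal.ofReal_sum_of_nonneg, ← sum_filter]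
  · congr 2
    ext r
    simp only [mem_filter, mem_range]
    omega
  · intro r _
    split_ifs <;> positivity

end Params

end Monitoring

end

noncomputable section

namespace Monitoring

open Finset

set_option linter.unusedSectionVars false

/-! ### The law of a run -/

/-- The items observed after a sequence of epochs. -/
def itemsAt {α : Type u} {n : ℕ} (d : Fin n → α) (es : List (Epoch α n)) : Fin n → α :=
  es.foldl (fun d e => itemsAfter d e.ups) d

theorem itemsAt_append {α : Type u} {n : ℕ} (d : Fin n → α) (es : List (Epoch α n))
    (e : Epoch α n) : itemsAt d (es ++ [e]) = itemsAfter (itemsAt d es) e.ups := by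
  simp [itemsAt]

theorem Admissible.injective {α : Type u} {n : ℕ} :
    ∀ (es : List (Epoch α n)) {d : Fin n → α}, Admissible d es → Function.Injective (itemsAt d es)
  | [], _, h => h
  | _ :: es, _, h => Admissible.injective es h.2.2

theorem Admissible.of_append {α : Type u} {n : ℕ} {e : Epoch α n} :
    ∀ (es : List (Epoch α n)) {d : Fin n → α}, Admissible d (es ++ [e]) →
      Admissible d es ∧ e.query.Valid n
  | [], _, h => ⟨h.1, h.2.1⟩
  | _ :: es, _, h => ⟨⟨h.1, h.2.1, (Admissible.of_append es h.2.2).1⟩,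
      (Admissible.of_append es h.2.2).2⟩

namespace Params

variable {p : Params} {α : Type u} [LinearOrder α] {n : ℕ}

theorem run_append {P : Protocol α n} (d : Fin n → α) (es : List (Epoch α n)) (e : Epoch α n) :
    P.run d (es ++ [e]) = (P.run d es).bind (P.epoch e) := by
  simp [Protocol.run]

theorem Suitable.untilRefresh_eq (hp : p.Suitable n) {g : Fin n → Fin (p.B + 1) → ℕ}
    (hg : ∀ i c, g i c ≤ p.m) {d : Fin n → α} {s : (p.protocol (α := α) n).Config}
    (hs : p.Resting g d s) (e : Epoch α n) :
    ∃ T flag act k, (p.protocol n).untilRefresh e s =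
        PMF.pure (p.conf T (.idle none) g (fun _ => false) flag act .rest (itemsAfter d e.ups) k) ∧
      (∀ c, p.Good T g flag (itemsAfter d e.ups) c) ∧
      k ≤ p.refreshCost g (changed e.ups) (itemsAfter d e.ups) :=
  p.untilRefresh_eq (by have := hp.R'; omega) hg hs e

theorem Resting.epoch (hp : p.Suitable n) {g : Fin n → Fin (p.B + 1) → ℕ}
    (hg : ∀ i c, g i c ≤ p.m) {d : Fin n → α} {s : (p.protocol (α := α) n).Config}
    (hs : p.Resting g d s) {e : Epoch α n} (he : e.query.Valid n)
    (hd : Function.Injective (itemsAfter d e.ups)) :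
    ∀ s' ∈ ((p.protocol n).epoch e s).support, p.Resting g (itemsAfter d e.ups) s' := by
  obtain ⟨T, flag, act, k, h1, h2, -⟩ := hp.untilRefresh_eq hg hs e
  rw [Protocol.epoch, h1, PMF.pure_bind]
  intro s' hs'
  obtain ⟨ups, q⟩ := e
  cases q with
  | topK r =>
    obtain ⟨act', c', rfl⟩ := (answer_topK hp hg h2 hd he.2).1 s' hs'
    exact ⟨_, _, _, _, _, rfl, h2⟩
  | select r ε δ =>
    obtain ⟨F, hF, hF2⟩ := answer_select (act := act) (c := k) (ε := ε) (δ := δ) hp h2 hd he.2.1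
    rw [hF, PMF.mem_support_bind_iff] at hs'
    obtain ⟨b, -, hb⟩ := hs'
    cases b
    · simp only [Bool.false_eq_true, if_false, PMF.support_pure, Set.mem_singleton_iff] at hb
      subst hb
      exact ⟨_, _, _, _, _, rfl, h2⟩
    · simp only [if_true, PMF.mem_support_bind_iff] at hb
      obtain ⟨Pop, -, hb⟩ := hb
      obtain ⟨act', c', rfl⟩ := (hF2 Pop).1 s' hb
      exact ⟨_, _, _, _, _, rfl, h2⟩

/-- Conditioned on the heights, the state after a sequence of epochs is a resting state. -/
theorem Suitable.run_eq (hp : p.Suitable n) {d : Fin n → α} (es : List (Epoch α n))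
    (ha : Admissible d es) :
    ∃ Q : (Fin n → Fin (p.B + 1) → ℕ) → PMF (p.protocol (α := α) n).Config,
      (p.protocol n).run d es = (p.heights n).bind Q ∧
      ∀ g ∈ (p.heights n).support, ∀ s ∈ (Q g).support, p.Resting g (itemsAt d es) s := by
  induction es using List.reverseRecOn with
  | nil =>
    obtain ⟨F, h1, h2⟩ := p.start_eq (n := n) hp.R' d
    refine ⟨fun g => PMF.pure (F g), h1, fun g hg s hs => ?_⟩
    rw [PMF.support_pure, Set.mem_singleton_iff] at hs
    subst hs
    exact (h2 g hg).1
  | append_singleton es e ih =>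
    obtain ⟨h1, h2⟩ := ha.of_append
    obtain ⟨Q, h3, h4⟩ := ih h1
    refine ⟨fun g => (Q g).bind ((p.protocol n).epoch e), ?_, fun g hg s hs => ?_⟩
    · rw [run_append, h3, PMF.bind_bind]
    · rw [PMF.mem_support_bind_iff] at hs
      obtain ⟨s', hs', hs⟩ := hs
      have h5 := ha.injective
      rw [itemsAt_append] at h5 ⊢
      exact (h4 g hg s' hs').epoch hp (p.le_of_mem_support_heights hg) h2 h5 s hs

section bind

variable {d : Fin n → α} {es : List (Epoch α n)} {β : Type u}
  {K : (p.protocol (α := α) n).Config → PMF β} {f : β → ENNReal}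
  {H : (Fin n → Fin (p.B + 1) → ℕ) → ENNReal}

/-- Reduces every statement about a query at any time to one about heights: a bound for all resting
states with heights `g` may be averaged over `g` alone. -/
theorem Suitable.mean_run_bind_le (hp : p.Suitable n) (ha : Admissible d es)
    (h : ∀ g, (∀ i c, g i c ≤ p.m) → ∀ s, p.Resting g (itemsAt d es) s → mean (K s) f ≤ H g) :
    mean (((p.protocol n).run d es).bind K) f ≤ mean (p.heights n) H := by
  obtain ⟨Q, h1, h2⟩ := hp.run_eq es ha
  rw [h1, PMF.bind_bind, mean_bind]
  refine mean_mono_support fun g hg => ?_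
  rw [mean_bind]
  exact mean_le_of_support fun s hs => h g (p.le_of_mem_support_heights hg) s (h2 g hg s hs)

theorem Suitable.le_mean_run_bind (hp : p.Suitable n) (ha : Admissible d es)
    (h : ∀ g, (∀ i c, g i c ≤ p.m) → ∀ s, p.Resting g (itemsAt d es) s → H g ≤ mean (K s) f) :
    mean (p.heights n) H ≤ mean (((p.protocol n).run d es).bind K) f := by
  obtain ⟨Q, h1, h2⟩ := hp.run_eq es ha
  rw [h1, PMF.bind_bind, mean_bind]
  refine mean_mono_support fun g hg => ?_
  rw [mean_bind]
  refine (mean_const (Q g) (H g)).symm.le.trans (mean_mono_support fun s hs => ?_)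
  exact h g (p.le_of_mem_support_heights hg) s (h2 g hg s hs)

end bind

variable {d : Fin n → α} {past : List (Epoch α n)}

open Classical in
theorem Suitable.roughRank_ge (hp : p.Suitable n) {e : Epoch α n} (ha : Admissible d (past ++ [e]))
    {k : ℕ} (hk : k ≤ n) (a b : ℝ) :
    mean (p.heights n) (fun g => if HasRankIn (itemsAt d (past ++ [e]))
        ((p.top g (itemsAt d (past ++ [e])) 0 (p.lev k)).or
          (p.top g (itemsAt d (past ++ [e])) (Fin.last p.B) 0)) a b then 1 else 0) ≤
      prob (((p.protocol n).run d past).bind ((p.protocol n).untilRefresh e)) (fun s =>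
        HasRankIn s.item ((p.protocol n).roughRank s.server k) a b) := by
  rw [prob_eq_mean]
  refine hp.le_mean_run_bind ha.of_append.1 fun g hg s hs => ?_
  obtain ⟨T, flag, act, k, h1, h2, -⟩ := hp.untilRefresh_eq hg hs e
  rw [h1, mean_pure, itemsAt_append]
  refine le_of_eq ?_
  change _ = if HasRankIn (itemsAfter (itemsAt d past) e.ups)
    ((T 0 (p.lev _)).or (T (Fin.last p.B) 0)) a b then _ else _
  rw [(h2 0).1 _ ((hp.lev _ hk).trans (Nat.le_succ _)) trivial, (h2 _).1 0 (Nat.zero_le _) trivial]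

theorem Suitable.topK_support (hp : p.Suitable n) {ups : List (Fin n × α)} {k : ℕ}
    (ha : Admissible d (past ++ [⟨ups, .topK k⟩])) :
    ∀ s ∈ ((p.protocol n).run d (past ++ [⟨ups, .topK k⟩])).support,
      (p.protocol n).outTopK s.server = some (topKSet s.item k) := by
  intro s hs
  obtain ⟨h1, h2⟩ := ha.of_append
  have h3 := ha.injective
  obtain ⟨Q, hQ, hQ2⟩ := hp.run_eq past h1
  rw [run_append, hQ, PMF.bind_bind, PMF.mem_support_bind_iff] at hs
  obtain ⟨g, hg, hs⟩ := hs
  rw [PMF.mem_support_bind_iff] at hs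
  obtain ⟨s', hs', hs⟩ := hs
  have hg' := p.le_of_mem_support_heights hg
  obtain ⟨T, flag, act, c, h4, h5, -⟩ := hp.untilRefresh_eq hg' (hQ2 g hg s' hs') ⟨ups, .topK k⟩
  rw [Protocol.epoch, h4, PMF.pure_bind] at hs
  rw [itemsAt_append] at h3
  obtain ⟨act', c', rfl⟩ := (answer_topK hp hg' h5 h3 h2.2).1 s hs
  rfl

theorem Suitable.topK_msgs_le (hp : p.Suitable n) {ups : List (Fin n × α)} {k : ℕ}
    (ha : Admissible d (past ++ [⟨ups, .topK k⟩])) {d' : Fin n → α}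
    (hd' : itemsAt d (past ++ [⟨ups, .topK k⟩]) = d') :
    mean ((p.protocol n).run d (past ++ [⟨ups, .topK k⟩])) (fun s => (s.msgs : ENNReal)) ≤
      mean (p.heights n) fun g => ENNReal.ofReal (p.refreshCost g (changed ups) d' + 1 +
        (open' d' univ k (p.hidden g d') + 2 * (1 + start d' univ k (p.hidden g d')
          (p.top g d' 0 (p.lev k)).toList))) := by
  obtain ⟨h1, h2⟩ := ha.of_append
  have h3 := ha.injective
  rw [hd'] at h3
  rw [itemsAt_append] at hd'
  rw [run_append]
  refine hp.mean_run_bind_le h1 fun g hg s hs => ?_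
  obtain ⟨T, flag, act, c, h4, h5, h6⟩ := hp.untilRefresh_eq hg hs ⟨ups, .topK k⟩
  rw [Protocol.epoch, h4, PMF.pure_bind]
  simp only [hd'] at h5 h6 ⊢
  refine (answer_topK hp hg h5 h3 h2.2).2.trans (ENNReal.ofReal_le_ofReal ?_)
  gcongr

theorem reactProb_nonneg {δ : ℝ} (h : δ < 1) : 0 ≤ reactProb δ := by
  unfold reactProb
  split_ifs <;> linarith

theorem reactProb_le_one (δ : ℝ) : reactProb δ ≤ 1 := by
  unfold reactProb
  split_ifs <;> linarith

/-- The REFRESH is always paid, the search only if the server reacts. The sample is drawn after the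
heights and independently of them. -/
theorem Suitable.select_msgs_le (hp : p.Suitable n) {ups : List (Fin n × α)} {k : ℕ} {ε δ : ℝ}
    (ha : Admissible d (past ++ [⟨ups, .select k ε δ⟩])) {d' : Fin n → α}
    (hd' : itemsAt d (past ++ [⟨ups, .select k ε δ⟩]) = d') {j t : ℕ}
    (hj : rateExp p.m k ε (errProb δ) = j) (ht : sampleRank k j ε = t) :
    mean ((p.protocol n).run d (past ++ [⟨ups, .select k ε δ⟩])) (fun s => (s.msgs : ENNReal)) ≤
      mean (p.heights n) (fun g => (p.refreshCost g (changed ups) d' : ENNReal)) +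
      ENNReal.ofReal (reactProb δ) * mean (p.heights n) fun g =>
        mean (sample ((1 / 2) ^ j) univ) fun Pop =>
          ENNReal.ofReal (1 + (open' d' Pop t Pop + 2 * (1 + start d' Pop t Pop
            (p.top g d' 0 (p.lev k)).toList))) := by
  obtain ⟨h1, h2⟩ := ha.of_append
  have h3 := ha.injective
  rw [hd'] at h3
  rw [itemsAt_append] at hd'
  rw [run_append, ← mean_const_mul, ← mean_add]
  refine hp.mean_run_bind_le h1 fun g hg s hs => ?_
  obtain ⟨T, flag, act, c, h4, h5, h6⟩ := hp.untilRefresh_eq hg hs ⟨ups, .select k ε δ⟩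
  rw [Protocol.epoch, h4, PMF.pure_bind]
  simp only [hd'] at h5 h6 ⊢
  obtain ⟨F, hF, hF2⟩ := answer_select (act := act) (c := c) (ε := ε) (δ := δ) hp h5 h3 h2.2.1
  rw [hj, ht] at hF2
  rw [hj] at hF
  have hδ0 := reactProb_nonneg h2.2.2.2.2.2
  have hδ1 := reactProb_le_one δ
  rw [hF, mean_bind, mean_flip hδ0 hδ1]
  simp only [Bool.false_eq_true, if_false, if_true, mean_pure, mean_bind]
  have h7 : mean (sample ((1 / 2) ^ j) univ) (fun Pop => mean (F Pop) fun s =>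
      (s.msgs : ENNReal)) ≤ mean (sample ((1 / 2) ^ j) univ) (fun Pop => (c : ENNReal) +
        ENNReal.ofReal (1 + (open' d' Pop t Pop + 2 * (1 + start d' Pop t Pop
            (p.top g d' 0 (p.lev k)).toList)))) := by
    refine mean_mono fun Pop => (hF2 Pop).2.trans (le_of_eq ?_)
    rw [← ENNReal.ofReal_natCast, ← ENNReal.ofReal_add (by positivity), add_assoc]
    have := start_nonneg (d := d') (Pop := Pop) (t := t) Pop (p.top g d' 0 (p.lev k)).toList
    positivity
  rw [mean_add, mean_const] at h7
  have h8 : (c : ENNReal) ≤ p.refreshCost g (changed ups) d' := by exact_mod_cast h6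
  refine (add_le_add (mul_le_mul_right h7 _) le_rfl).trans ?_
  rw [show (p.conf T (Stage.idle none) g (fun _ => false) flag act Mode.rest d' c).msgs = c from rfl,
    mul_add, add_right_comm, ← add_mul, ← ENNReal.ofReal_add hδ0 (by linarith),
    add_sub_cancel, ENNReal.ofReal_one, one_mul]
  exact add_le_add h8 le_rfl

open Classical in
theorem Suitable.select_prob_ge (hp : p.Suitable n) {ups : List (Fin n × α)} {k : ℕ} {ε δ : ℝ}
    (ha : Admissible d (past ++ [⟨ups, .select k ε δ⟩])) {d' : Fin n → α}
    (hd' : itemsAt d (past ++ [⟨ups, .select k ε δ⟩]) = d') {j t : ℕ}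
    (hj : rateExp p.m k ε (errProb δ) = j) (ht : sampleRank k j ε = t) (a b : ℝ) :
    ENNReal.ofReal (reactProb δ) * mean (sample ((1 / 2) ^ j) univ) (fun Pop : Finset (Fin n) =>
        if ∃ h : (smallest t (Pop.image d')).Nonempty,
          a ≤ rank d' ((smallest t (Pop.image d')).max' h) ∧
          (rank d' ((smallest t (Pop.image d')).max' h) : ℝ) ≤ b then 1 else 0) ≤
      prob ((p.protocol n).run d (past ++ [⟨ups, .select k ε δ⟩])) (fun s =>
        HasRankIn s.item ((p.protocol n).outSelect s.server) a b) := by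
  obtain ⟨h1, h2⟩ := ha.of_append
  have h3 := ha.injective
  rw [hd'] at h3
  rw [itemsAt_append] at hd'
  rw [run_append, prob_eq_mean]
  refine le_trans (mean_const (p.heights n) _).symm.le (hp.le_mean_run_bind h1 fun g hg s hs => ?_)
  obtain ⟨T, flag, act, c, h4, h5, h6⟩ := hp.untilRefresh_eq hg hs ⟨ups, .select k ε δ⟩
  rw [Protocol.epoch, h4, PMF.pure_bind]
  simp only [hd'] at h5 h6 ⊢
  obtain ⟨F, hF, hF2⟩ := answer_select (act := act) (c := c) (ε := ε) (δ := δ) hp h5 h3 h2.2.1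
  rw [hj, ht] at hF2
  rw [hj] at hF
  have hδ0 := reactProb_nonneg h2.2.2.2.2.2
  have hδ1 := reactProb_le_one δ
  rw [hF, mean_bind, mean_flip hδ0 hδ1]
  simp only [if_true, mean_bind]
  refine le_add_right (mul_le_mul_right (mean_mono fun Pop => ?_) _)
  split_ifs with h
  · obtain ⟨hne, ha, hb⟩ := h
    refine (mean_const (F Pop) 1).symm.le.trans (mean_mono_support fun s hs => ?_)
    obtain ⟨act', c', rfl⟩ := (hF2 Pop).1 s hs
    rw [if_pos]
    obtain ⟨i, -, hi⟩ := mem_image.1 ((filter_subset _ _) (max'_mem _ hne))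
    refine ⟨i, ?_, ?_, ?_⟩
    · change (if h : (smallest t (Pop.image d')).Nonempty then
        some ((smallest t (Pop.image d')).max' h) else none) = _
      rw [dif_pos hne, ← hi]
      rfl
    · change a ≤ rank d' (d' i)
      rwa [hi]
    · change (rank d' (d' i) : ℝ) ≤ b
      rwa [hi]
  · exact zero_le

theorem Suitable.mean_start_le (hp : p.Suitable n) :
    mean ((p.protocol n).start d) (fun s => (s.msgs : ENNReal)) ≤
      1 + mean (p.heights n) fun g => (p.refreshCost g (fun _ => true) d : ENNReal) := by
  obtain ⟨F, h1, h2⟩ := p.start_eq (n := n) hp.R' d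
  rw [h1, mean_map, ← mean_const (p.heights n) 1, ← mean_add]
  refine mean_mono_support fun g hg => ?_
  exact_mod_cast (h2 g hg).2

end Params

end Monitoring

end

noncomputable section

namespace Monitoring

open Finset

set_option linter.unusedSectionVars false

/-! ### The cost of a Top-`k` request -/

/-- The tangent of the concave logarithm at `a`. It replaces Jensen's inequality: the expectation of
a logarithm is reduced to a mean. -/
theorem log_le_log_add_div {a y : ℝ} (ha : 0 < a) (hy : 0 < y) :
    Real.log y ≤ Real.log a + (y / a - 1) := by
  have h := Real.log_le_sub_one_of_pos (div_pos hy ha)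
  rw [Real.log_div hy.ne' ha.ne'] at h
  linarith

theorem harm_one_add_le (x : ℕ) {X : ℝ} (hX : 0 ≤ X) :
    harm (1 + x) ≤ Real.log (1 + X) + (1 + x) / (1 + X) := by
  have h1 := harm_le (1 + x)
  have h2 := log_le_log_add_div (a := 1 + X) (y := 1 + x) (by positivity) (by positivity)
  push_cast at h1
  linarith

/-- Expected value of a cost that depends on a count and an event. -/
theorem mean_ofReal_affine_le {β : Type*} (q : PMF β) (N : β → ℕ) (A : β → Prop) [DecidablePred A]
    {c₀ c₁ c₂ x y : ℝ} (h₀ : 0 ≤ c₀) (h₁ : 0 ≤ c₁) (h₂ : 0 ≤ c₂) (hx0 : 0 ≤ x) (hy0 : 0 ≤ y)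
    (hx : mean q (fun b => (N b : ENNReal)) ≤ ENNReal.ofReal x)
    (hy : mean q (fun b => if A b then 1 else 0) ≤ ENNReal.ofReal y) :
    mean q (fun b => ENNReal.ofReal (c₀ + c₁ * N b + c₂ * if A b then 1 else 0)) ≤
      ENNReal.ofReal (c₀ + c₁ * x + c₂ * y) := by
  have h : ∀ b, ENNReal.ofReal (c₀ + c₁ * N b + c₂ * if A b then 1 else 0) =
      ENNReal.ofReal c₀ + ENNReal.ofReal c₁ * N b + ENNReal.ofReal c₂ * if A b then 1 else 0 := by
    intro b
    rw [ENNReal.ofReal_add (by positivity) (by split_ifs <;> simp [h₂]),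
      ENNReal.ofReal_add h₀ (by positivity), ENNReal.ofReal_mul h₁, ENNReal.ofReal_natCast,
      ENNReal.ofReal_mul h₂]
    split_ifs <;> simp
  simp only [h]
  rw [mean_add, mean_add, mean_const, mean_const_mul, mean_const_mul,
    ENNReal.ofReal_add (by positivity) (by positivity), ENNReal.ofReal_add h₀ (by positivity),
    ENNReal.ofReal_mul h₁, ENNReal.ofReal_mul h₂]
  gcongr

theorem sum_one_div_ge (b k : ℕ) :
    Real.log (k + 1 + b) - Real.log (1 + b) ≤ ∑ r ∈ range k, 1 / (r + 1 + b : ℝ) := by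
  induction k with
  | zero => simp
  | succ k ih =>
    rw [sum_range_succ]
    have h := Real.log_le_sub_one_of_pos (x := ((k + 1 + 1 + b : ℝ)) / (k + 1 + b)) (by positivity)
    rw [Real.log_div (by positivity) (by positivity)] at h
    have h2 : ((k + 1 + 1 + b : ℝ)) / (k + 1 + b) - 1 = 1 / (k + 1 + b) := by
      field_simp
      ring
    push_cast
    linarith

/-- How much the items in the sketch contribute to the answer. -/
theorem sum_hidden_le (b : ℕ) {k : ℕ} (hk : 1 ≤ k) :
    ∑ r ∈ range k, 8 * (r + 1 : ℝ) / (8 * (r + 1) + (8 * b : ℕ)) ≤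
      k - b * Real.log k + b * Real.log (1 + b) := by
  have h1 : ∀ r ∈ range k, 8 * (r + 1 : ℝ) / (8 * (r + 1) + (8 * b : ℕ)) =
      1 - b * (1 / (r + 1 + b : ℝ)) := by
    intro r _
    push_cast
    field_simp
    ring
  rw [sum_congr rfl h1, sum_sub_distrib, ← mul_sum, sum_const, card_range, nsmul_eq_mul, mul_one]
  have h2 := sum_one_div_ge b k
  have hk' : (1 : ℝ) ≤ k := by exact_mod_cast hk
  have h3 : Real.log k ≤ Real.log (k + 1 + b) :=
    Real.log_le_log (by linarith) (by linarith [show (0 : ℝ) ≤ b from Nat.cast_nonneg b])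
  have h4 := mul_le_mul_of_nonneg_left (h2.trans' (sub_le_sub_right h3 _))
    (Nat.cast_nonneg (α := ℝ) b)
  linarith

section start

variable {α : Type u} [LinearOrder α] {n : ℕ} {d : Fin n → α} {x : Fin n → ℕ} {l : ℕ}

/-- If the first threshold is high, the surplus lies before it, up to the node of the threshold
itself. -/
theorem surplus_le_or (hd : Function.Injective d) (Pop U : Finset (Fin n)) (t : ℕ) :
    surplus d Pop t U (best x d l).toList ≤ 1 + #(U ∩ before x d l) ∨
      ∃ v, best x d l = some (d v) ∧ Low d Pop t (some (d v)) := by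
  rcases hb : best x d l with _ | y
  · left
    rw [before_of_best_eq_none hb, inter_univ]
    exact (card_filter_le _ _).trans (Nat.le_add_left _ _)
  · obtain ⟨⟨v, -, rfl⟩, -⟩ := best_eq_some_iff.1 hb
    by_cases h : Low d Pop t (some (d v))
    · exact Or.inr ⟨v, rfl, h⟩
    · left
      rw [before_of_best_eq_some hb, add_comm]
      refine le_trans (card_le_card fun i hi => ?_) (card_insert_le v _)
      simp only [mem_filter, Option.toList_some, List.find?_cons, h, not_false_eq_true,
        decide_true, upTo_some] at hi
      simp only [mem_insert, mem_inter, mem_filter, mem_univ, true_and]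
      rcases hi.2.2.lt_or_eq with h' | h'
      · exact Or.inr ⟨hi.1, h'⟩
      · exact Or.inl (hd h')

-- The unlikely case of a low first threshold leaves no bound but `n` for the surplus, whence the
-- term with `harm n`. Otherwise the harmonic number is linearized at the expected number `X` of
-- nodes before the threshold.
open Classical in
theorem start_best_le (hd : Function.Injective d) (Pop U : Finset (Fin n)) (t : ℕ) {X : ℝ}
    (hX : 0 ≤ X) :
    start d Pop t U (best x d l).toList ≤ bigA * harm (open' d Pop t U) +
      bigA * Real.log (1 + X) + bigA * ((1 + #(U ∩ before x d l)) / (1 + X)) +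
      bigA * harm n * (if ∃ v, best x d l = some (d v) ∧ Low d Pop t (some (d v)) then 1 else 0)
      + 7 := by
  have hA := bigA_pos
  refine (start_le_base _ _).trans ?_
  unfold base
  have h1 : (((best x d l).toList.countP fun x => Low d Pop t (some x) : ℕ) : ℝ) ≤ 1 := by
    have := List.countP_le_length (p := fun x => decide (Low d Pop t (some x)))
      (l := (best x d l).toList)
    have h2 : (best x d l).toList.length ≤ 1 := by
      cases best x d l <;> simp
    exact_mod_cast this.trans h2
  have h2 : harm (surplus d Pop t U (best x d l).toList) ≤ Real.log (1 + X) +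
      (1 + #(U ∩ before x d l)) / (1 + X) + harm n *
      (if ∃ v, best x d l = some (d v) ∧ Low d Pop t (some (d v)) then 1 else 0) := by
    have h3 := harm_one_add_le #(U ∩ before x d l) hX
    have h4 : 0 ≤ Real.log (1 + X) := Real.log_nonneg (by linarith)
    split_ifs with h
    · have h5 : surplus d Pop t U (best x d l).toList ≤ n := by
        refine (card_filter_le _ _).trans ?_
        simpa using card_le_univ U
      have h6 := harm_mono h5
      have h7 : 0 ≤ (1 + (#(U ∩ before x d l) : ℝ)) / (1 + X) := by positivity
      linarith
    · have h5 := (surplus_le_or hd Pop U t).resolve_right h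
      linarith [harm_mono h5]
  have h3 := mul_le_mul_of_nonneg_left h2 hA.le
  linarith

end start

namespace Params

variable {p : Params} {α : Type u} [LinearOrder α] {n : ℕ}

theorem top_zero (hB : p.B ≠ 0) (g : Fin n → Fin (p.B + 1) → ℕ) (d : Fin n → α) (l : ℕ) :
    p.top g d 0 l = best (fun i => g i 0) d l := by
  obtain ⟨b, hb⟩ := Nat.exists_eq_succ_of_ne_zero hB
  have : (0 : Fin (p.B + 1)) = (⟨0, by omega⟩ : Fin p.B).castSucc := rfl
  rw [this, top_castSucc]

theorem le_two_pow_lev (k : ℕ) : 16 * k * p.L ^ 2 ≤ 2 ^ p.lev k := Nat.le_pow_clog one_lt_two _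

theorem two_pow_lev_le {k : ℕ} (hk : 1 ≤ k) (hL : 1 ≤ p.L) : 2 ^ p.lev k ≤ 32 * k * p.L ^ 2 := by
  have h1 : 1 ≤ k * p.L ^ 2 := Nat.one_le_iff_ne_zero.2 (by positivity)
  have h2 := Nat.pow_pred_clog_lt_self one_lt_two (x := 16 * k * p.L ^ 2) (by nlinarith)
  have h3 : p.lev k ≠ 0 := by
    have := Nat.clog_pos one_lt_two (n := 16 * k * p.L ^ 2) (by nlinarith)
    exact this.ne'
  obtain ⟨q, hq⟩ := Nat.exists_eq_succ_of_ne_zero h3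
  unfold lev at hq ⊢
  rw [hq] at h2 ⊢
  rw [Nat.pred_succ] at h2
  rw [pow_succ]
  linarith

open Classical in
theorem mean_rank_top_le (hB : p.B ≠ 0) {d : Fin n → α} (hd : Function.Injective d) {l : ℕ}
    (hl : l ≤ p.m) (X : ℕ) :
    mean (p.heights n) (fun g => if ∃ v, p.top g d 0 l = some (d v) ∧ rank d (d v) ≤ X
      then 1 else 0) ≤ ENNReal.ofReal (X / 2 ^ l) := by
  refine le_trans (le_of_eq ?_) (mean_rank_le_le hd hl X)
  rw [← p.mean_heights_single 0]
  refine mean_congr_support fun g _ => ?_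
  simp only [top_zero hB]

theorem card_changed_le (ups : List (Fin n × α)) :
    #(univ.filter fun i => changed ups i = true) ≤ 2 ^ Nat.clog 2 ups.length := by
  refine le_trans ?_ (Nat.le_pow_clog one_lt_two _)
  refine le_trans (card_le_card (t := (ups.map Prod.fst).toFinset) fun i hi => ?_)
    ((List.toFinset_card_le _).trans (List.length_map _).le)
  have h := (mem_filter.1 hi).2
  rw [List.mem_toFinset]
  exact of_decide_eq_true h

theorem clog_two_le (m : ℕ) : (Nat.clog 2 m : ℝ) ≤ 1 + 2 * Real.log m := by
  rcases Nat.lt_or_ge m 2 with h | h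
  · interval_cases m <;> simp
  · have h1 := Nat.pow_pred_clog_lt_self one_lt_two (x := m) h
    have h2 : 0 < Nat.clog 2 m := Nat.clog_pos one_lt_two h
    have h3 : ((Nat.clog 2 m).pred : ℝ) * Real.log 2 ≤ Real.log m := by
      rw [← Real.log_pow]
      exact Real.log_le_log (by positivity) (by exact_mod_cast h1.le)
    have h4 : ((Nat.clog 2 m).pred : ℝ) = Nat.clog 2 m - 1 := by
      rw [Nat.pred_eq_sub_one, Nat.cast_sub h2]
      simp
    have h5 := Real.log_two_gt_d9
    have h6 : (0 : ℝ) ≤ (Nat.clog 2 m).pred := Nat.cast_nonneg _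
    nlinarith

/-- Open members and surplus enter with `2 * bigA * log k` each. Their sum is exactly what the
sketch saves for `b = 4 * bigA`; only `4 * bigA * log L` remains from the excess of the first
threshold. -/
theorem Suitable.topK_le (hp : p.Suitable n) {b : ℕ} (hB : p.B = 8 * b)
    (hb : (b : ℝ) = 4 * bigA) (hm : 2 * n ≤ 2 ^ p.m) (hL : 1 ≤ p.L)
    (hh : harm n ≤ 16 * p.L ^ 2) {d : Fin n → α} {past : List (Epoch α n)}
    {ups : List (Fin n × α)} {k : ℕ} (ha : Admissible d (past ++ [⟨ups, .topK k⟩])) :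
    mean ((p.protocol n).run d (past ++ [⟨ups, .topK k⟩])) (fun s => (s.msgs : ENNReal)) ≤
      ENNReal.ofReal (k + b * Real.log (1 + b) + (p.B + 1) * (13 + 6 * Real.log ups.length) +
        4 * bigA * Real.log p.L + 14 * bigA + 18) := by
  classical
  have hA := bigA_pos
  obtain ⟨d', hd'⟩ : ∃ d', itemsAt d (past ++ [⟨ups, .topK k⟩]) = d' := ⟨_, rfl⟩
  have hd := ha.injective
  rw [hd'] at hd
  obtain ⟨-, hk1, hkn⟩ := ha.of_append
  have hB0 : p.B ≠ 0 := by
    rintro h0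
    have : (b : ℝ) = 0 := by
      have : b = 0 := by omega
      simp [this]
    linarith
  have hlev := hp.lev k hkn
  set l := p.lev k with hl
  have hk0 : (1 : ℝ) ≤ k := by exact_mod_cast hk1
  have hL0 : (1 : ℝ) ≤ p.L := by exact_mod_cast hL
  have hX1 : (16 * k * p.L ^ 2 : ℝ) ≤ 2 ^ l := by exact_mod_cast p.le_two_pow_lev k
  have hX2 : (2 ^ l : ℝ) ≤ 32 * k * p.L ^ 2 := by exact_mod_cast p.two_pow_lev_le hk1 hL
  set X : ℝ := 2 ^ l with hX
  have hX0 : 0 < X := by positivity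
  set f : (Fin n → Fin (p.B + 1) → ℕ) → ℝ := fun g =>
    (17 + 2 * bigA * harm k + 2 * bigA * Real.log (1 + X) + 2 * bigA / (1 + X)) +
      2 * bigA / (1 + X) * #(before (fun i => g i 0) d' l) +
      2 * bigA * harm n * if ∃ v, p.top g d' 0 l = some (d' v) ∧ rank d' (d' v) ≤ k then 1 else 0
    with hf
  have hlog : 0 ≤ Real.log (1 + X) := Real.log_nonneg (by linarith)
  have hf0 : ∀ g, 0 ≤ f g := by
    intro g
    have h1 := mul_nonneg hA.le (harm_nonneg k)
    have h2 := mul_nonneg hA.le (harm_nonneg n)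
    have h3 := mul_nonneg hA.le hlog
    have h4 : 0 ≤ 2 * bigA / (1 + X) * #(before (fun i => g i 0) d' l) := by positivity
    have h5 : 0 ≤ 2 * bigA / (1 + X) := by positivity
    rw [hf]
    simp only
    split_ifs <;> nlinarith
  have h1 : ∀ g, (p.refreshCost g (changed ups) d' + 1 +
        (open' d' univ k (p.hidden g d') + 2 * (1 + start d' univ k (p.hidden g d')
          (p.top g d' 0 l).toList)) : ℝ) ≤
      p.refreshCost g (changed ups) d' + open' d' univ k (p.hidden g d') + f g := by
    intro g
    have h1 := start_best_le (x := fun i => g i 0) (l := l) hd univ (p.hidden g d') k hX0.le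
    rw [← top_zero hB0] at h1
    have h2 := mul_le_mul_of_nonneg_left (harm_mono (open'_le (d := d') (t := k) (Pop := univ)
      (p.hidden g d') (subset_univ _))) hA.le
    have h3 : (#(p.hidden g d' ∩ before (fun i => g i 0) d' l) : ℝ) ≤
        #(before (fun i => g i 0) d' l) := by exact_mod_cast card_le_card inter_subset_right
    have h4 : bigA * ((1 + #(p.hidden g d' ∩ before (fun i => g i 0) d' l)) / (1 + X)) ≤
        bigA * ((1 + #(before (fun i => g i 0) d' l)) / (1 + X)) := by gcongr
    have h5 : 2 * bigA / (1 + X) + 2 * bigA / (1 + X) * #(before (fun i => g i 0) d' l) =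
        2 * (bigA * ((1 + #(before (fun i => g i 0) d' l)) / (1 + X))) := by ring
    have h6 : (if ∃ v, p.top g d' 0 l = some (d' v) ∧ Low d' univ k (some (d' v)) then (1 : ℝ)
        else 0) = if ∃ v, p.top g d' 0 l = some (d' v) ∧ rank d' (d' v) ≤ k then 1 else 0 := by
      congr 1
    rw [h6] at h1
    rw [hf]
    simp only
    linarith
  have h2 : ∀ g, ENNReal.ofReal (p.refreshCost g (changed ups) d' + 1 +
        (open' d' univ k (p.hidden g d') + 2 * (1 + start d' univ k (p.hidden g d')
          (p.top g d' 0 l).toList)) : ℝ) ≤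
      p.refreshCost g (changed ups) d' + open' d' univ k (p.hidden g d') +
        ENNReal.ofReal (f g) := by
    intro g
    refine (ENNReal.ofReal_le_ofReal (h1 g)).trans ?_
    rw [ENNReal.ofReal_add (by positivity) (hf0 g), ENNReal.ofReal_add (by positivity)
      (by positivity), ENNReal.ofReal_natCast, ENNReal.ofReal_natCast]
  refine (hp.topK_msgs_le ha hd').trans ((mean_mono h2).trans ?_)
  rw [mean_add, mean_add]
  have h3 := p.mean_refreshCost_le hd (by omega) (changed ups) (card_changed_le ups)
  have h4 := p.mean_open'_hidden_le hd hm hkn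
  have h5 : mean (p.heights n) (fun g => (#(before (fun i => g i 0) d' l) : ENNReal)) ≤
      ENNReal.ofReal X := by
    refine le_trans (le_of_eq ?_) (mean_card_before_le (m := p.m) hd hlev)
    rw [← p.mean_heights_single 0]
  have h6 : mean (p.heights n) (fun g => ENNReal.ofReal (f g)) ≤ _ :=
    mean_ofReal_affine_le _ _ _ (by have := harm_nonneg k; positivity) (by positivity)
      (by have := harm_nonneg n; positivity) hX0.le (by positivity) h5
      (p.mean_rank_top_le hB0 hd hlev k)
  refine (add_le_add (add_le_add h3 h4) h6).trans ?_
  rw [← ENNReal.ofReal_add (by positivity) (sum_nonneg fun r _ => by positivity),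
    ← ENNReal.ofReal_add (add_nonneg (by positivity) (sum_nonneg fun r _ => by positivity))
      (by have := harm_nonneg k; have := harm_nonneg n; positivity)]
  refine ENNReal.ofReal_le_ofReal ?_
  -- The term `- b * log k` obtained here cancels the logarithms of `k` in `h9` and `h10`.
  have h7 := sum_hidden_le b hk1
  rw [← hB, hb] at h7
  have h8 : ((p.B : ℝ) + 1) * (3 * Nat.clog 2 ups.length + 10) ≤
      (p.B + 1) * (13 + 6 * Real.log ups.length) := by
    have := clog_two_le ups.length
    exact mul_le_mul_of_nonneg_left (by linarith) (by positivity)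
  have h9 : bigA * harm k ≤ bigA * (1 + Real.log k) := by gcongr; exact harm_le k
  have h10 : Real.log (1 + X) ≤ 4 + Real.log k + 2 * Real.log p.L := by
    have h11 : 1 + X ≤ Real.exp 1 ^ 4 * (k * p.L ^ 2) := by
      have h12 : (1 : ℝ) ≤ k * p.L ^ 2 := one_le_mul_of_one_le_of_one_le hk0 (one_le_pow₀ hL0)
      have h13 : (33 : ℝ) ≤ Real.exp 1 ^ 4 := by
        calc (33 : ℝ) ≤ 2.7 ^ 4 := by norm_num
          _ ≤ _ := by
            gcongr
            linarith [Real.exp_one_gt_d9]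
      nlinarith
    have h12 := Real.log_le_log (by positivity) h11
    rw [Real.log_mul (by positivity) (by positivity), Real.log_mul (by positivity) (by positivity),
      Real.log_pow, Real.log_pow, Real.log_exp] at h12
    push_cast at h12
    linarith
  have h11 := mul_le_mul_of_nonneg_left h10 hA.le
  have h12 : 2 * bigA / (1 + X) + 2 * bigA / (1 + X) * X = 2 * bigA := by
    field_simp
  -- A low first threshold has probability at most `1 / (16 * L ^ 2)`, which makes up for `harm n`.
  have h13 : bigA * harm n * (k / X) ≤ bigA := by
    have h14 : harm n * (k / X) ≤ 1 := by
      rw [← mul_div_assoc, div_le_one hX0]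
      refine le_trans ?_ hX1
      nlinarith
    nlinarith
  rw [hb]
  linarith

end Params

end Monitoring

end

noncomputable section

namespace Monitoring

open Finset

set_option linter.unusedSectionVars false

/-! ### Random samples of the nodes -/

section sample

variable {n : ℕ} {x : ℝ}

theorem sample_univ : sample x (univ : Finset (Fin n)) =
    (independent n fun _ => flip x).map fun b => univ.filter fun i => b i = true := by
  simp [sample]

theorem sample_one : sample 1 (univ : Finset (Fin n)) = PMF.pure univ := by
  have h : flip 1 = PMF.pure true := by
    ext b
    cases b <;> simp [flip, PMF.pure_apply]
  rw [sample_univ, h, independent_pure, PMF.pure_map]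
  simp

theorem mean_sample_card_inter (h0 : 0 ≤ x) (h1 : x ≤ 1) (W : Finset (Fin n)) :
    mean (sample x univ) (fun Pop => (#(Pop ∩ W) : ENNReal)) = ENNReal.ofReal (x * #W) := by
  have h2 : ∀ b : Fin n → Bool, (#((univ.filter fun i => b i = true) ∩ W) : ENNReal) =
      ∑ i ∈ W, if b i = true then 1 else 0 := by
    intro b
    rw [filter_inter, univ_inter, card_filter]
    push_cast
    rfl
  rw [sample_univ, mean_map]
  simp only [h2]
  rw [mean_sum]
  have h3 : ∀ i ∈ W, mean (independent n fun _ => flip x)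
      (fun b => if b i = true then (1 : ENNReal) else 0) = ENNReal.ofReal x := by
    intro i _
    rw [mean_independent_eval _ i fun b => if b = true then (1 : ENNReal) else 0, mean_flip h0 h1]
    simp
  rw [sum_congr rfl h3, sum_const, nsmul_eq_mul, ENNReal.ofReal_mul h0, ENNReal.ofReal_natCast,
    mul_comm]

theorem mean_sample_pow (h0 : 0 ≤ x) (h1 : x ≤ 1) {z : ℝ} (hz : 0 ≤ z) (W : Finset (Fin n)) :
    mean (sample x univ) (fun Pop => ENNReal.ofReal (z ^ #(Pop ∩ W))) =
      ENNReal.ofReal ((x * z + (1 - x)) ^ #W) := by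
  have h2 : ∀ b : Fin n → Bool, ENNReal.ofReal (z ^ #((univ.filter fun i => b i = true) ∩ W)) =
      ∏ i ∈ W, if b i = true then ENNReal.ofReal z else 1 := by
    intro b
    rw [filter_inter, univ_inter, ENNReal.ofReal_pow hz, prod_ite]
    simp
  rw [sample_univ, mean_map]
  simp only [h2]
  have h3 : 0 ≤ x * z := mul_nonneg h0 hz
  rw [mean_independent_pow _ W fun b => if b = true then ENNReal.ofReal z else 1, mean_flip h0 h1]
  simp only [if_true, Bool.false_eq_true, if_false, mul_one]
  rw [← ENNReal.ofReal_mul h0, ← ENNReal.ofReal_add h3 (by linarith),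
    ENNReal.ofReal_pow (by linarith)]

/-- Bernstein's inequality. -/
theorem mean_sample_tail_le (h0 : 0 ≤ x) (h1 : x ≤ 1) {z : ℝ} (hz : 0 < z) (W : Finset (Fin n))
    (t : ℕ) (A : Finset (Fin n) → Prop) [DecidablePred A]
    (hA : ∀ Pop, A Pop → z ^ t ≤ z ^ #(Pop ∩ W)) :
    mean (sample x univ) (fun Pop => if A Pop then 1 else 0) ≤
      ENNReal.ofReal (z⁻¹ ^ t * Real.exp (x * (z - 1) * #W)) := by
  have h2 : ∀ Pop, (if A Pop then (1 : ENNReal) else 0) ≤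
      ENNReal.ofReal (z⁻¹ ^ t) * ENNReal.ofReal (z ^ #(Pop ∩ W)) := by
    intro Pop
    split_ifs with h
    · rw [← ENNReal.ofReal_mul (by positivity), ← ENNReal.ofReal_one]
      refine ENNReal.ofReal_le_ofReal ?_
      rw [inv_pow, ← div_eq_inv_mul, one_le_div (by positivity)]
      exact hA Pop h
    · exact zero_le
  refine (mean_mono h2).trans ?_
  rw [mean_const_mul, mean_sample_pow h0 h1 hz.le, ← ENNReal.ofReal_mul (by positivity)]
  refine ENNReal.ofReal_le_ofReal (mul_le_mul_of_nonneg_left ?_ (by positivity))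
  have h3 : x * z + (1 - x) ≤ Real.exp (x * (z - 1)) := by
    linarith [Real.add_one_le_exp (x * (z - 1))]
  calc (x * z + (1 - x)) ^ #W ≤ Real.exp (x * (z - 1)) ^ #W :=
        pow_le_pow_left₀ (by nlinarith) h3 _
    _ = _ := by
      rw [← Real.exp_nat_mul]
      congr 1
      ring

end sample

section smallest

variable {α : Type u} [LinearOrder α] {n : ℕ} {d : Fin n → α}

/-- If the item next to the maximum in the population were also among the `t` smallest, the maximum
would be wrong; hence the count at the maximum is exactly `t`. -/
theorem exists_max_smallest (hd : Function.Injective d) {Pop : Finset (Fin n)} {t : ℕ}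
    (ht : 1 ≤ t) (hP : t ≤ #Pop) :
    ∃ h : (smallest t (Pop.image d)).Nonempty, ∃ v ∈ Pop,
      (smallest t (Pop.image d)).max' h = d v ∧ #(Pop.filter fun i => d i ≤ d v) = t := by
  set P := Pop.image d with hPd
  have hcard : ∀ y, #(P.filter fun z => z ≤ y) = #(Pop.filter fun i => d i ≤ y) := by
    intro y
    rw [hPd, filter_image, card_image_of_injective _ hd]
  have hne : P.Nonempty := by
    rw [hPd, image_nonempty, ← card_pos]
    omega
  have h : (smallest t P).Nonempty := by
    refine ⟨P.min' hne, mem_filter.2 ⟨min'_mem _ _, ?_⟩⟩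
    refine (card_le_one.2 fun a ha b hb => ?_).trans ht
    rw [mem_filter] at ha hb
    exact (le_antisymm ha.2 (min'_le _ _ ha.1)).trans (le_antisymm hb.2 (min'_le _ _ hb.1)).symm
  obtain ⟨h1, h2⟩ := mem_filter.1 (max'_mem _ h)
  set M := (smallest t P).max' h with hM
  obtain ⟨v, hv, hvM⟩ := mem_image.1 h1
  refine ⟨h, v, hv, hvM.symm, ?_⟩
  rw [← hcard, hvM]
  refine le_antisymm h2 (not_lt.1 fun h3 => ?_)
  have h4 : (P.filter fun z => M < z).Nonempty := by
    rw [nonempty_iff_ne_empty]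
    intro h5
    have h6 : P.filter (fun z => z ≤ M) = P := by
      rw [filter_eq_self]
      intro z hz
      by_contra h7
      exact absurd (mem_filter.2 ⟨hz, not_le.1 h7⟩) (by rw [h5]; exact notMem_empty _)
    rw [h6, hPd, card_image_of_injective _ hd] at h3
    omega
  set y := (P.filter fun z => M < z).min' h4 with hy
  obtain ⟨h5, h6⟩ := mem_filter.1 (min'_mem _ h4)
  have h7 : P.filter (fun z => z ≤ y) ⊆ insert y (P.filter fun z => z ≤ M) := by
    intro z hz
    rw [mem_filter] at hz
    rw [mem_insert, mem_filter]
    by_cases h8 : z ≤ M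
    · exact Or.inr ⟨hz.1, h8⟩
    · exact Or.inl (le_antisymm hz.2 (min'_le _ _ (mem_filter.2 ⟨hz.1, not_le.1 h8⟩)))
  have h8 : y ∈ smallest t P :=
    mem_filter.2 ⟨h5, (card_le_card h7).trans ((card_insert_le _ _).trans (by omega))⟩
  exact absurd (le_max' _ _ h8) (not_le.2 h6)

/-- When the item of rank `t` in a sample has a bad rank. -/
theorem bad_sample (hd : Function.Injective d) {Pop : Finset (Fin n)} {t k : ℕ} {a : ℝ}
    (ht : 1 ≤ t)
    (h : ¬ ∃ h : (smallest t (Pop.image d)).Nonempty,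
      a ≤ rank d ((smallest t (Pop.image d)).max' h) ∧
      (rank d ((smallest t (Pop.image d)).max' h) : ℝ) ≤ k) :
    #(Pop ∩ univ.filter fun v => rank d (d v) ≤ k) ≤ t - 1 ∨
      t ≤ #(Pop ∩ univ.filter fun v => rank d (d v) ≤ ⌊a⌋₊) := by
  by_contra! hc
  have hP : t ≤ #Pop := by
    have := card_le_card (inter_subset_left (s₁ := Pop)
      (s₂ := univ.filter fun v => rank d (d v) ≤ k))
    omega
  obtain ⟨hne, v, hv, hmax, hcount⟩ := exists_max_smallest hd ht hP
  refine h ⟨hne, ?_, ?_⟩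
  · by_contra! h1
    rw [hmax] at h1
    have h2 : Pop.filter (fun i => d i ≤ d v) ⊆
        Pop ∩ univ.filter fun w => rank d (d w) ≤ ⌊a⌋₊ := by
      intro i hi
      rw [mem_filter] at hi
      rw [mem_inter, mem_filter]
      refine ⟨hi.1, mem_univ _, le_trans (card_le_card ?_) (Nat.le_floor h1.le)⟩
      intro j hj
      simp only [mem_filter, mem_univ, true_and] at hj ⊢
      exact hj.trans hi.2
    have h3 := card_le_card h2
    omega
  · by_contra! h1
    rw [hmax] at h1
    have h2 : k < rank d (d v) := by exact_mod_cast h1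
    have h3 : Pop ∩ (univ.filter fun w => rank d (d w) ≤ k) ⊆
        (Pop.filter fun i => d i ≤ d v).erase v := by
      intro i hi
      simp only [mem_inter, mem_filter, mem_univ, true_and] at hi
      rw [mem_erase, mem_filter]
      have h4 : d i < d v := by
        by_contra h5
        refine absurd (card_le_card (?_ : (univ.filter fun j => d j ≤ d v) ⊆
          univ.filter fun j => d j ≤ d i)) (not_le.2 (hi.2.trans_lt h2))
        intro j hj
        simp only [mem_filter, mem_univ, true_and] at hj ⊢
        exact hj.trans (not_lt.1 h5)
      exact ⟨fun h => by rw [h] at h4; exact lt_irrefl _ h4, hi.1, h4.le⟩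
    have h4 := card_le_card h3
    rw [card_erase_of_mem (mem_filter.2 ⟨hv, le_refl (d v)⟩), hcount] at h4
    omega

end smallest

end Monitoring

end

noncomputable section

namespace Monitoring

open Finset

set_option linter.unusedSectionVars false

/-! ### Correctness of approximate selection -/

section rate

variable {m k : ℕ} {ε δ : ℝ}

theorem le_sampleSize (hε0 : 0 < ε) (hε1 : ε < 1) (hδ0 : 0 < δ) :
    11 ≤ sampleSize ε (errProb δ) := by
  have h1 : errProb δ ≤ 1 / 2 := min_le_right _ _
  have h2 : 0 < errProb δ := lt_min hδ0 (by norm_num)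
  have h3 : Real.log 2 ≤ Real.log (2 / errProb δ) := by
    refine Real.log_le_log (by norm_num) ?_
    rw [le_div_iff₀ h2]
    linarith
  have h4 := Real.log_two_gt_d9
  rw [sampleSize, le_div_iff₀ (by positivity)]
  nlinarith

/-- By maximality of the exponent the sample is not too large. Maximality is available since `k < 2
^ m` keeps the exponent below its limit `m`. -/
theorem div_rateExp_lt (hS : 1 ≤ sampleSize ε δ) (hk : 1 ≤ k) (hm : k < 2 ^ m) :
    (k / 2 ^ rateExp m k ε δ : ℝ) < 2 * sampleSize ε δ := by
  classical
  set j := rateExp m k ε δ with hj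
  have hm' : (k : ℝ) < 2 ^ m := by exact_mod_cast hm
  have hm0 : m ≠ 0 := by
    rintro rfl
    simp at hm
    omega
  have h1 : j < m := by
    refine lt_of_le_of_ne (Nat.findGreatest_le _) fun h => ?_
    have h2 : sampleSize ε δ * 2 ^ j ≤ k := Nat.findGreatest_of_ne_zero hj.symm (by omega)
    rw [h] at h2
    have h3 : (0 : ℝ) < 2 ^ m := by positivity
    nlinarith
  have h2 : ¬ sampleSize ε δ * 2 ^ (j + 1) ≤ k :=
    Nat.findGreatest_is_greatest (Nat.lt_succ_self j) h1
  rw [div_lt_iff₀ (by positivity)]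
  rw [pow_succ] at h2
  linarith [not_le.1 h2]

theorem le_div_rateExp (h : rateExp m k ε δ ≠ 0) :
    sampleSize ε δ ≤ k / 2 ^ rateExp m k ε δ := by
  classical
  rw [le_div_iff₀ (by positivity)]
  exact Nat.findGreatest_of_ne_zero (P := fun j => sampleSize ε δ * 2 ^ j ≤ k) rfl h

theorem sampleRank_le {j : ℕ} (hε0 : 0 < ε) (hε1 : ε < 1) :
    (sampleRank k j ε : ℝ) ≤ k / 2 ^ j + 1 := by
  unfold sampleRank
  have h2 : (0 : ℝ) ≤ k / 2 ^ j := by positivity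
  split_ifs with h
  · subst h
    simp
  · have h1 := Nat.ceil_lt_add_one (a := (1 - ε / 2) * (k / 2 ^ j : ℝ))
      (mul_nonneg (by linarith) h2)
    nlinarith

theorem one_le_sampleRank {j : ℕ} (hε1 : ε < 1) (hk : 1 ≤ k) : 1 ≤ sampleRank k j ε := by
  unfold sampleRank
  split_ifs with h
  · exact hk
  · refine Nat.one_le_ceil_iff.2 (mul_pos (by linarith) ?_)
    have : (0 : ℝ) < k := by exact_mod_cast hk
    positivity

end rate

theorem exp_neg_log_inv {y : ℝ} (hy : 0 < y) : Real.exp (-Real.log (2 / y)) = y / 2 := by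
  rw [Real.exp_neg, Real.exp_log (by positivity), inv_div]

section

variable {α : Type u} [LinearOrder α] {n m k : ℕ} {d : Fin n → α} {ε δ : ℝ}

-- The target rank is about `(1 - ε / 2) * μ`, halfway between the expected numbers `(1 - ε) * μ`
-- and `μ` of sample members up to the two ends of the allowed range. Each of the two deviations has
-- probability at most `δ / 2`.
open Classical in
theorem mean_sample_bad_le (hd : Function.Injective d) (hk : 1 ≤ k) (hkn : k ≤ n) (hε0 : 0 < ε)
    (hε1 : ε < 1) (hδ0 : 0 < δ) {j : ℕ} (hj0 : j ≠ 0) (hj : sampleSize ε δ ≤ k / 2 ^ j) {t : ℕ}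
    (ht : sampleRank k j ε = t) :
    mean (sample ((1 / 2) ^ j) univ) (fun Pop : Finset (Fin n) =>
        if ∃ h : (smallest t (Pop.image d)).Nonempty,
          (1 - ε) * k ≤ rank d ((smallest t (Pop.image d)).max' h) ∧
          (rank d ((smallest t (Pop.image d)).max' h) : ℝ) ≤ k then 0 else 1) ≤
      ENNReal.ofReal δ := by
  have ht1 : 1 ≤ t := ht ▸ one_le_sampleRank hε1 hk
  have hx0 : (0 : ℝ) ≤ (1 / 2) ^ j := by positivity
  have hx1 : ((1 : ℝ) / 2) ^ j ≤ 1 := pow_le_one₀ (by norm_num) (by norm_num)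
  set x : ℝ := (1 / 2) ^ j with hx
  have hμ : (k : ℝ) / 2 ^ j = x * k := by rw [hx, one_div, inv_pow]; ring
  set μ : ℝ := x * k with hμ'
  rw [hμ] at hj
  have hμ0 : 0 ≤ μ := by positivity
  rw [sampleRank, if_neg hj0, hμ] at ht
  have ht2 : (1 - ε / 2) * μ ≤ t := ht ▸ Nat.le_ceil _
  have ht3 : ((t - 1 : ℕ) : ℝ) ≤ (1 - ε / 2) * μ := by
    have h1 := Nat.ceil_lt_add_one (a := (1 - ε / 2) * μ) (mul_nonneg (by linarith) hμ0)
    rw [ht] at h1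
    rw [Nat.cast_sub ht1]
    push_cast
    linarith
  have hkey : Real.exp (-(μ * (ε ^ 2 / 16))) ≤ δ / 2 := by
    rw [← exp_neg_log_inv hδ0]
    refine Real.exp_le_exp.2 (neg_le_neg ?_)
    have h1 : Real.log (2 / δ) = sampleSize ε δ * (ε ^ 2 / 16) := by
      unfold sampleSize
      field_simp
    rw [h1]
    gcongr
  have hb0 : 0 < 1 + ε / 4 := by linarith
  -- The base `1 + ε / 4`, or its inverse, brings both exponents down to at most `-(μ * (ε ^ 2 /
  -- 16))`, which matches the constant `16` in `sampleSize`.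
  have h1 := mean_sample_tail_le hx0 hx1 (z := (1 + ε / 4)⁻¹) (by positivity)
    (univ.filter fun v => rank d (d v) ≤ k) (t - 1)
    (fun Pop => #(Pop ∩ univ.filter fun v => rank d (d v) ≤ k) ≤ t - 1) fun Pop h =>
      pow_le_pow_of_le_one (by positivity) (inv_le_one_of_one_le₀ (by linarith)) h
  have h2 := mean_sample_tail_le hx0 hx1 (z := 1 + ε / 4) hb0
    (univ.filter fun v => rank d (d v) ≤ ⌊(1 - ε) * k⌋₊) t
    (fun Pop => t ≤ #(Pop ∩ univ.filter fun v => rank d (d v) ≤ ⌊(1 - ε) * k⌋₊)) fun Pop h =>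
      pow_le_pow_right₀ (by linarith) h
  have hK : ((⌊(1 - ε) * k⌋₊ : ℕ) : ℝ) ≤ (1 - ε) * k :=
    Nat.floor_le (mul_nonneg (by linarith) (Nat.cast_nonneg _))
  have hKn : ⌊(1 - ε) * (k : ℝ)⌋₊ ≤ n := by
    refine (Nat.floor_le_of_le ?_).trans hkn
    nlinarith [show (0 : ℝ) ≤ k from Nat.cast_nonneg k]
  rw [card_rank_le hd hkn, inv_inv] at h1
  rw [card_rank_le hd hKn] at h2
  have h3 : ∀ Pop : Finset (Fin n), (if ∃ h : (smallest t (Pop.image d)).Nonempty,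
          (1 - ε) * k ≤ rank d ((smallest t (Pop.image d)).max' h) ∧
          (rank d ((smallest t (Pop.image d)).max' h) : ℝ) ≤ k then (0 : ENNReal) else 1) ≤
      (if #(Pop ∩ univ.filter fun v => rank d (d v) ≤ k) ≤ t - 1 then 1 else 0) +
      if t ≤ #(Pop ∩ univ.filter fun v => rank d (d v) ≤ ⌊(1 - ε) * k⌋₊) then 1 else 0 := by
    intro Pop
    split_ifs with h
    all_goals first
      | exact zero_le
      | simp
    rcases bad_sample hd ht1 h with h | h <;> contradiction
  refine (mean_mono h3).trans ?_
  rw [mean_add]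
  have hε4 : 0 < ε / 4 := by linarith
  have hexp : ∀ {y : ℝ}, y ≤ -(μ * (ε ^ 2 / 16)) → Real.exp y ≤ δ / 2 := fun h =>
    (Real.exp_le_exp.2 h).trans hkey
  have h4 : (1 + ε / 4) ^ (t - 1) * Real.exp (x * ((1 + ε / 4)⁻¹ - 1) * k) ≤ δ / 2 := by
    have h5 : 1 + ε / 4 ≤ Real.exp (ε / 4) := by linarith [Real.add_one_le_exp (ε / 4)]
    have h6 : (1 + ε / 4)⁻¹ - 1 ≤ -(ε / 4) + (ε / 4) ^ 2 := by
      rw [sub_le_iff_le_add, inv_le_iff_one_le_mul₀ hb0]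
      nlinarith [pow_pos hε4 3]
    calc _ ≤ Real.exp (ε / 4) ^ (t - 1) * Real.exp (μ * (-(ε / 4) + (ε / 4) ^ 2)) := by
          refine mul_le_mul (pow_le_pow_left₀ hb0.le h5 _) (Real.exp_le_exp.2 ?_)
            (Real.exp_pos _).le (by positivity)
          rw [show x * ((1 + ε / 4)⁻¹ - 1) * k = μ * ((1 + ε / 4)⁻¹ - 1) by rw [hμ']; ring]
          gcongr
      _ = Real.exp ((t - 1 : ℕ) * (ε / 4) + μ * (-(ε / 4) + (ε / 4) ^ 2)) := by
          rw [← Real.exp_nat_mul, ← Real.exp_add]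
      _ ≤ _ := by
          refine hexp ?_
          nlinarith [mul_le_mul_of_nonneg_right ht3 hε4.le]
  have h5 : (1 + ε / 4)⁻¹ ^ t * Real.exp (x * (1 + ε / 4 - 1) * ⌊(1 - ε) * k⌋₊) ≤ δ / 2 := by
    have h6 : (1 + ε / 4)⁻¹ ≤ Real.exp (-(ε / 4 - (ε / 4) ^ 2)) := by
      have h7 := Real.add_one_le_exp (-(ε / 4 - (ε / 4) ^ 2))
      refine le_trans ?_ h7
      rw [inv_le_iff_one_le_mul₀ hb0]
      nlinarith [pow_pos hε4 3]
    calc _ ≤ Real.exp (-(ε / 4 - (ε / 4) ^ 2)) ^ t * Real.exp (ε / 4 * ((1 - ε) * μ)) := by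
          refine mul_le_mul (pow_le_pow_left₀ (by positivity) h6 _) (Real.exp_le_exp.2 ?_)
            (Real.exp_pos _).le (by positivity)
          rw [show ε / 4 * ((1 - ε) * μ) = x * (1 + ε / 4 - 1) * ((1 - ε) * k) by rw [hμ']; ring]
          rw [add_sub_cancel_left]
          gcongr
      _ = Real.exp (t * (-(ε / 4 - (ε / 4) ^ 2)) + ε / 4 * ((1 - ε) * μ)) := by
          rw [← Real.exp_nat_mul, ← Real.exp_add]
      _ ≤ _ := by
          refine hexp ?_
          have h8 : 0 ≤ ε / 4 - (ε / 4) ^ 2 := by nlinarith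
          nlinarith [mul_le_mul_of_nonneg_right ht2 h8, mul_nonneg hμ0 (pow_pos hε0 3).le]
  calc _ ≤ ENNReal.ofReal (δ / 2) + ENNReal.ofReal (δ / 2) :=
        add_le_add (h1.trans (ENNReal.ofReal_le_ofReal h4)) (h2.trans (ENNReal.ofReal_le_ofReal h5))
    _ = _ := by
      rw [← ENNReal.ofReal_add (by linarith) (by linarith), add_halves]

-- Exponent `0` means that the whole population is searched, and the answer is exact.
open Classical in
theorem mean_sample_good_ge (hd : Function.Injective d) (hk : 1 ≤ k) (hkn : k ≤ n) (hε0 : 0 < ε)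
    (hε1 : ε < 1) (hδ0 : 0 < δ) {j t : ℕ} (hj : rateExp m k ε δ = j)
    (ht : sampleRank k j ε = t) :
    ENNReal.ofReal (1 - δ) ≤ mean (sample ((1 / 2) ^ j) univ) (fun Pop : Finset (Fin n) =>
        if ∃ h : (smallest t (Pop.image d)).Nonempty,
          (1 - ε) * k ≤ rank d ((smallest t (Pop.image d)).max' h) ∧
          (rank d ((smallest t (Pop.image d)).max' h) : ℝ) ≤ k then 1 else 0) := by
  have hk0 : (0 : ℝ) ≤ k := Nat.cast_nonneg k
  by_cases hj0 : j = 0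
  · rw [hj0, pow_zero, sample_one, mean_pure, if_pos]
    · exact ENNReal.ofReal_le_one.2 (by linarith)
    · have htk : t = k := by rw [← ht, sampleRank, if_pos hj0]
      obtain ⟨h, v, -, h1, h2⟩ := exists_max_smallest (Pop := univ) (t := t) hd (by omega)
        (by simpa [htk] using hkn)
      have h3 : rank d (d v) = k := by rw [← htk, ← h2]; rfl
      refine ⟨h, ?_, ?_⟩
      · rw [h1, h3]
        nlinarith
      · rw [h1, h3]
  · have h1 := mean_sample_bad_le hd hk hkn hε0 hε1 hδ0 hj0 (hj ▸ le_div_rateExp (hj ▸ hj0)) ht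
    have h2 := mean_ite_add_ite_not (sample ((1 / 2) ^ j) univ) fun Pop : Finset (Fin n) =>
      ∃ h : (smallest t (Pop.image d)).Nonempty,
          (1 - ε) * k ≤ rank d ((smallest t (Pop.image d)).max' h) ∧
          (rank d ((smallest t (Pop.image d)).max' h) : ℝ) ≤ k
    rw [ENNReal.ofReal_sub _ hδ0.le, ENNReal.ofReal_one, tsub_le_iff_right]
    exact h2.symm.le.trans (add_le_add le_rfl h1)

end

namespace Params

variable {p : Params} {α : Type u} [LinearOrder α] {n : ℕ}

/-- For `δ > 1 / 2` the success probability is `2 * (1 - δ)` times at least `1 / 2`. -/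
theorem Suitable.select_correct (hp : p.Suitable n) {d : Fin n → α} {past : List (Epoch α n)}
    {ups : List (Fin n × α)} {k : ℕ} {ε δ : ℝ}
    (ha : Admissible d (past ++ [⟨ups, .select k ε δ⟩])) :
    ENNReal.ofReal (1 - δ) ≤
      prob ((p.protocol n).run d (past ++ [⟨ups, .select k ε δ⟩])) (fun s =>
        HasRankIn s.item ((p.protocol n).outSelect s.server) ((1 - ε) * k) ((1 + ε) * k)) := by
  classical
  obtain ⟨-, hk1, hkn, hε0, hε1, hδ0, hδ1⟩ := ha.of_append
  have he0 : 0 < errProb δ := lt_min hδ0 (by norm_num)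
  refine le_trans ?_ (hp.select_prob_ge ha rfl rfl rfl _ _)
  have h1 := mean_sample_good_ge (m := p.m) ha.injective hk1 hkn hε0 hε1 he0 rfl rfl
  refine le_trans ?_ (mul_le_mul_right (h1.trans (mean_mono fun Pop => ?_)) _)
  · rw [← ENNReal.ofReal_mul (reactProb_nonneg hδ1)]
    refine ENNReal.ofReal_le_ofReal (le_of_eq ?_)
    unfold reactProb errProb
    split_ifs with h
    · rw [min_eq_left h, one_mul]
    · rw [min_eq_right (by linarith)]
      ring
  · split_ifs with h2 h3 h3
    · exact le_rfl
    · refine absurd ?_ h3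
      obtain ⟨h4, h5, h6⟩ := h2
      refine ⟨h4, h5, h6.trans ?_⟩
      nlinarith [show (0 : ℝ) ≤ k from Nat.cast_nonneg k]
    · exact zero_le
    · exact le_rfl

end Params

end Monitoring

end

noncomputable section

namespace Monitoring

open Finset

set_option linter.unusedSectionVars false

/-! ### The cost of approximate selection -/

section

variable {α : Type u} [LinearOrder α] {n : ℕ} {d : Fin n → α}

theorem rank_mono {a b : α} (h : a ≤ b) : rank d a ≤ rank d b :=
  card_le_card fun j hj => by
    simp only [mem_filter, mem_univ, true_and] at hj ⊢
    exact hj.trans h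

open Classical in
/-- It is unlikely that few items of the sample are below a node of high rank. -/
theorem mean_sample_low_le (hd : Function.Injective d) {x : ℝ} (h0 : 0 ≤ x) (h1 : x ≤ 1)
    (t K : ℕ) :
    mean (sample x univ) (fun Pop : Finset (Fin n) =>
      if ∃ v, K < rank d (d v) ∧ Low d Pop t (some (d v)) then 1 else 0) ≤
      ENNReal.ofReal (Real.exp (t - x * K / 2)) := by
  rcases le_or_gt K n with hK | hK
  · refine (mean_sample_tail_le h0 h1 (z := 1 / 2) (by norm_num)
      (univ.filter fun v => rank d (d v) ≤ K) t _ fun Pop h => ?_).trans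
        (ENNReal.ofReal_le_ofReal ?_)
    · obtain ⟨v, hv, hlow⟩ := h
      refine pow_le_pow_of_le_one (by norm_num) (by norm_num) (le_trans (card_le_card ?_) hlow)
      intro i hi
      simp only [mem_inter, mem_filter, mem_univ, true_and, upTo_some] at hi ⊢
      refine ⟨hi.1, le_of_not_gt fun h => ?_⟩
      have := rank_mono (d := d) h.le
      omega
    · rw [card_rank_le hd hK]
      have h2 : ((1 : ℝ) / 2)⁻¹ ^ t ≤ Real.exp t := by
        rw [← mul_one (t : ℝ), Real.exp_nat_mul]
        gcongr
        linarith [Real.add_one_le_exp (1 : ℝ)]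
      calc _ ≤ Real.exp t * Real.exp (x * (1 / 2 - 1) * K) := by gcongr
        _ = _ := by
          rw [← Real.exp_add]
          congr 1
          ring
  · have h2 : ∀ Pop : Finset (Fin n), ¬ ∃ v, K < rank d (d v) ∧ Low d Pop t (some (d v)) := by
      rintro Pop ⟨v, hv, -⟩
      have : rank d (d v) ≤ n := by
        rw [rank]
        simpa using card_le_univ (univ.filter fun j => d j ≤ d v)
      omega
    simp only [h2, if_false, mean_const]
    exact zero_le

end

theorem harm_le_self (t : ℕ) : harm t ≤ t := by
  unfold harm
  refine (sum_le_sum (g := fun _ => (1 : ℝ)) fun i _ => ?_).trans (by simp)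
  rw [div_le_one (by positivity)]
  linarith [show (0 : ℝ) ≤ i from Nat.cast_nonneg i]

namespace Params

variable {p : Params} {α : Type u} [LinearOrder α] {n : ℕ}

-- As for Top-`k`, but without savings from a sketch: the harmonic number of open members and `log
-- μ` are simply bounded by terms linear in the sample size `μ`.
open Classical in
theorem mean_search_le (hlev : ∀ k ≤ n, p.lev k ≤ p.m) (hB : p.B ≠ 0) (hL : 2 ≤ p.L)
    (hh : harm n ≤ 2 * p.L) {d : Fin n → α}
    (hd : Function.Injective d) {k j t : ℕ} (hk1 : 1 ≤ k) (hkn : k ≤ n)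
    (hμ : 1 ≤ (k / 2 ^ j : ℝ)) (ht : (t : ℝ) ≤ k / 2 ^ j + 1) :
    (mean (p.heights n) fun g =>
        mean (sample ((1 / 2) ^ j) univ) fun Pop =>
          ENNReal.ofReal (1 + (open' d Pop t Pop + 2 * (1 + start d Pop t Pop
            (p.top g d 0 (p.lev k)).toList)))) ≤
      ENNReal.ofReal ((4 * bigA + 1) * (k / 2 ^ j) + 4 * bigA * Real.log p.L + 74 * bigA + 18) := by
  have hA := bigA_pos
  have hx0 : (0 : ℝ) ≤ (1 / 2) ^ j := by positivity
  have hx1 : ((1 : ℝ) / 2) ^ j ≤ 1 := pow_le_one₀ (by norm_num) (by norm_num)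
  set x : ℝ := (1 / 2) ^ j with hx
  have hμ' : (k : ℝ) / 2 ^ j = x * k := by rw [hx, one_div, inv_pow]; ring
  rw [hμ'] at hμ ht ⊢
  set μ : ℝ := x * k with hμdef
  have hlev := hlev k hkn
  set l := p.lev k with hl
  have hk0 : (1 : ℝ) ≤ k := by exact_mod_cast hk1
  have hL0 : (2 : ℝ) ≤ p.L := by exact_mod_cast hL
  have hX1 : (16 * k * p.L ^ 2 : ℝ) ≤ 2 ^ l := by exact_mod_cast p.le_two_pow_lev k
  have hX2 : (2 ^ l : ℝ) ≤ 32 * k * p.L ^ 2 := by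
    exact_mod_cast p.two_pow_lev_le hk1 (by omega)
  set X : ℝ := x * 2 ^ l with hX
  have hX0 : 0 ≤ X := by positivity
  have hlog : 0 ≤ Real.log (1 + X) := Real.log_nonneg (by linarith)
  set q : PMF ((Fin n → Fin (p.B + 1) → ℕ) × Finset (Fin n)) :=
    (p.heights n).bind fun g => (sample x univ).map fun Pop => (g, Pop) with hq
  have hmean : ∀ F : (Fin n → Fin (p.B + 1) → ℕ) × Finset (Fin n) → ENNReal,
      mean q F = mean (p.heights n) fun g => mean (sample x univ) fun Pop => F (g, Pop) := by
    intro F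
    rw [hq, mean_bind]
    simp only [mean_map]
  have h1 : ∀ g Pop, (1 + (open' d Pop t Pop + 2 * (1 + start d Pop t Pop
      (p.top g d 0 l).toList)) : ℝ) ≤
      (18 + μ + 2 * bigA * (μ + 1) + 2 * bigA * Real.log (1 + X) + 2 * bigA / (1 + X)) +
      2 * bigA / (1 + X) * #(Pop ∩ before (fun i => g i 0) d l) +
      2 * bigA * harm n *
        if ∃ v, p.top g d 0 l = some (d v) ∧ Low d Pop t (some (d v)) then 1 else 0 := by
    intro g Pop
    have h1 := start_best_le (x := fun i => g i 0) (l := l) hd Pop Pop t hX0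
    rw [← top_zero hB] at h1
    have h2 : (open' d Pop t Pop : ℝ) ≤ t := by
      exact_mod_cast open'_le (d := d) (t := t) Pop subset_rfl
    have h3 := mul_le_mul_of_nonneg_left (((harm_le_self _).trans h2).trans ht) hA.le
    have h5 : 2 * bigA / (1 + X) + 2 * bigA / (1 + X) * #(Pop ∩ before (fun i => g i 0) d l) =
        2 * (bigA * ((1 + #(Pop ∩ before (fun i => g i 0) d l)) / (1 + X))) := by ring
    linarith
  refine (mean_mono fun g => mean_mono fun Pop => ENNReal.ofReal_le_ofReal (h1 g Pop)).trans ?_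
  rw [← hmean fun y => ENNReal.ofReal ((18 + μ + 2 * bigA * (μ + 1) + 2 * bigA * Real.log (1 + X) +
      2 * bigA / (1 + X)) + 2 * bigA / (1 + X) * #(y.2 ∩ before (fun i => y.1 i 0) d l) +
      2 * bigA * harm n *
        if ∃ v, p.top y.1 d 0 l = some (d v) ∧ Low d y.2 t (some (d v)) then 1 else 0)]
  have h2 : mean q (fun y => (#(y.2 ∩ before (fun i => y.1 i 0) d l) : ENNReal)) ≤
      ENNReal.ofReal X := by
    rw [hmean]
    simp only [mean_sample_card_inter hx0 hx1]
    have h3 : ∀ g : Fin n → Fin (p.B + 1) → ℕ,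
        ENNReal.ofReal (x * #(before (fun i => g i 0) d l)) =
        ENNReal.ofReal x * #(before (fun i => g i 0) d l) := by
      intro g
      rw [ENNReal.ofReal_mul hx0, ENNReal.ofReal_natCast]
    simp only [h3]
    rw [mean_const_mul, hX, ENNReal.ofReal_mul hx0]
    gcongr
    refine le_trans (le_of_eq ?_) (mean_card_before_le (m := p.m) hd hlev)
    rw [← p.mean_heights_single 0]
  -- The first threshold is low for the sample only if its rank is at most `L * k`, or if the sample
  -- has at most `t` members up to an item of rank larger than `L * k`. Both are unlikely enough to
  -- make up for `harm n ≤ 2 * L`.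
  have h3 : mean q (fun y => if ∃ v, p.top y.1 d 0 l = some (d v) ∧ Low d y.2 t (some (d v))
      then 1 else 0) ≤ ENNReal.ofReal (1 / (16 * p.L) + Real.exp (2 - p.L / 2)) := by
    have h4 : ∀ y : (Fin n → Fin (p.B + 1) → ℕ) × Finset (Fin n),
        (if ∃ v, p.top y.1 d 0 l = some (d v) ∧ Low d y.2 t (some (d v)) then (1 : ENNReal)
          else 0) ≤
        (if ∃ v, p.top y.1 d 0 l = some (d v) ∧ rank d (d v) ≤ p.L * k then 1 else 0) +
        if ∃ v, p.L * k < rank d (d v) ∧ Low d y.2 t (some (d v)) then 1 else 0 := by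
      intro y
      by_cases h : ∃ v, p.top y.1 d 0 l = some (d v) ∧ Low d y.2 t (some (d v))
      · rw [if_pos h]
        obtain ⟨v, hv, hlow⟩ := h
        rcases le_or_gt (rank d (d v)) (p.L * k) with h | h
        · rw [if_pos ⟨v, hv, h⟩]
          exact le_add_right le_rfl
        · rw [if_pos (c := ∃ v, p.L * k < rank d (d v) ∧ Low d y.2 t (some (d v))) ⟨v, h, hlow⟩]
          exact le_add_left le_rfl
      · rw [if_neg h]
        exact zero_le
    refine (mean_mono h4).trans ?_
    rw [mean_add, hmean, hmean, ENNReal.ofReal_add (by positivity) (by positivity)]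
    refine add_le_add (le_trans (mean_mono (g := fun g => if ∃ v, p.top g d 0 l = some (d v) ∧
        rank d (d v) ≤ p.L * k then 1 else 0) fun g => mean_le_of_support fun Pop _ => le_rfl)
      ((mean_rank_top_le hB hd hlev _).trans (ENNReal.ofReal_le_ofReal ?_)))
      (mean_le_of_support fun g _ => (mean_sample_low_le hd hx0 hx1 t (p.L * k)).trans
        (ENNReal.ofReal_le_ofReal ?_))
    · rw [div_le_div_iff₀ (by positivity) (by positivity)]
      push_cast
      linarith
    · refine Real.exp_le_exp.2 ?_
      push_cast
      have : x * (p.L * k) = p.L * μ := by rw [hμdef]; ring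
      rw [this]
      nlinarith
  refine (mean_ofReal_affine_le q _ _ (by positivity) (by positivity)
    (by have := harm_nonneg n; positivity) hX0 (by positivity) h2 h3).trans
    (ENNReal.ofReal_le_ofReal ?_)
  have h4 : Real.log (1 + X) ≤ 4 + μ + 2 * Real.log p.L := by
    have h11 : 1 + X ≤ Real.exp 1 ^ 4 * (μ * p.L ^ 2) := by
      have h12 : (1 : ℝ) ≤ μ * p.L ^ 2 :=
        one_le_mul_of_one_le_of_one_le hμ (one_le_pow₀ (by linarith))
      have h13 : (33 : ℝ) ≤ Real.exp 1 ^ 4 := by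
        calc (33 : ℝ) ≤ 2.7 ^ 4 := by norm_num
          _ ≤ _ := by
            gcongr
            linarith [Real.exp_one_gt_d9]
      have h14 : X ≤ 32 * (μ * p.L ^ 2) := by
        calc X ≤ x * (32 * k * p.L ^ 2) := by rw [hX]; gcongr
          _ = _ := by rw [hμdef]; ring
      nlinarith
    have h12 := Real.log_le_log (by positivity) h11
    rw [Real.log_mul (by positivity) (by positivity), Real.log_mul (by positivity) (by positivity),
      Real.log_pow, Real.log_pow, Real.log_exp] at h12
    have h13 := Real.log_le_sub_one_of_pos (show 0 < μ by linarith)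
    push_cast at h12
    linarith
  have h5 := mul_le_mul_of_nonneg_left h4 hA.le
  have h6 : 2 * bigA / (1 + X) + 2 * bigA / (1 + X) * X = 2 * bigA := by
    field_simp
  have h7 : harm n * (1 / (16 * p.L) + Real.exp (2 - p.L / 2)) ≤ 31 := by
    have h8 : p.L * Real.exp (2 - p.L / 2) ≤ 15 := by
      have h9 : Real.exp (2 - p.L / 2) * Real.exp (p.L / 2) = Real.exp 1 ^ 2 := by
        rw [← Real.exp_add, ← Real.exp_nat_mul]
        congr 1
        push_cast
        ring
      have h10 := Real.add_one_le_exp (p.L / 2 : ℝ)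
      have h11 : Real.exp 1 ^ 2 ≤ 7.4 := by
        calc _ ≤ (2.72 : ℝ) ^ 2 := by
              gcongr
              linarith [Real.exp_one_lt_d9]
          _ ≤ _ := by norm_num
      nlinarith [Real.exp_pos (2 - p.L / 2 : ℝ)]
    have h9 : (p.L : ℝ) * (1 / (16 * p.L)) = 1 / 16 := by field_simp
    calc _ ≤ 2 * p.L * (1 / (16 * p.L) + Real.exp (2 - p.L / 2)) := by gcongr
      _ = 2 * (p.L * (1 / (16 * p.L))) + 2 * (p.L * Real.exp (2 - p.L / 2)) := by ring
      _ ≤ _ := by linarith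
  have h8 := mul_le_mul_of_nonneg_left h7 hA.le
  linarith

/-- For `δ ≤ 1 / 2` the number `log 2` is absorbed by `log (1 / δ)`. For larger `δ` the product is a
multiple of `1 - δ ≤ log (1 / δ)`. -/
theorem reactProb_mul_sampleSize_le {ε δ : ℝ} (hδ0 : 0 < δ) (hδ1 : δ < 1) :
    reactProb δ * sampleSize ε (errProb δ) ≤ 64 * (1 / ε ^ 2 * Real.log (1 / δ)) := by
  have h4 := Real.log_two_lt_d9
  have h1 : reactProb δ * Real.log (2 / errProb δ) ≤ 4 * Real.log (1 / δ) := by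
    unfold reactProb errProb
    rw [show Real.log (1 / δ) = -Real.log δ by rw [one_div, Real.log_inv]]
    split_ifs with h
    · rw [min_eq_left h, Real.log_div (by norm_num) hδ0.ne']
      have h2 : Real.log δ ≤ -Real.log 2 := by
        rw [← Real.log_inv]
        exact Real.log_le_log hδ0 (by linarith)
      linarith [Real.log_pos one_lt_two]
    · rw [min_eq_right (by linarith), show (2 : ℝ) / (1 / 2) = 2 ^ 2 by norm_num, Real.log_pow]
      have h2 := Real.log_le_sub_one_of_pos hδ0
      push_cast
      nlinarith
  calc _ = 16 * (1 / ε ^ 2) * (reactProb δ * Real.log (2 / errProb δ)) := by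
        unfold sampleSize
        ring
    _ ≤ 16 * (1 / ε ^ 2) * (4 * Real.log (1 / δ)) := by gcongr
    _ = _ := by ring

theorem Suitable.select_le (hp : p.Suitable n) (hB : p.B ≠ 0) (hm : 2 * n ≤ 2 ^ p.m)
    (hL : 2 ≤ p.L) (hh : harm n ≤ 2 * p.L) {d : Fin n → α} {past : List (Epoch α n)}
    {ups : List (Fin n × α)} {k : ℕ} {ε δ : ℝ}
    (ha : Admissible d (past ++ [⟨ups, .select k ε δ⟩])) :
    mean ((p.protocol n).run d (past ++ [⟨ups, .select k ε δ⟩])) (fun s => (s.msgs : ENNReal)) ≤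
      ENNReal.ofReal ((p.B + 1) * (14 + 6 * Real.log ups.length) +
        128 * (4 * bigA + 1) * (1 / ε ^ 2 * Real.log (1 / δ)) + 4 * bigA * Real.log p.L +
        74 * bigA + 18) := by
  have hA := bigA_pos
  have hd := ha.injective
  obtain ⟨-, hk1, hkn, hε0, hε1, hδ0, hδ1⟩ := ha.of_append
  have hS := le_sampleSize hε0 hε1 hδ0
  have hr0 := reactProb_nonneg hδ1
  have hr1 := reactProb_le_one δ
  have hn := hp.n_ne
  have hlog : 0 ≤ Real.log p.L := Real.log_natCast_nonneg _
  have hμ1 : (1 : ℝ) ≤ k / 2 ^ rateExp p.m k ε (errProb δ) := by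
    by_cases h : rateExp p.m k ε (errProb δ) = 0
    · rw [h, pow_zero, div_one]
      exact_mod_cast hk1
    · linarith [le_div_rateExp h]
  have hμ2 := div_rateExp_lt (m := p.m) (k := k) (ε := ε) (δ := errProb δ) (by linarith) hk1
    (by omega)
  refine (hp.select_msgs_le ha rfl rfl rfl).trans ((add_le_add
    (p.mean_refreshCost_le hd (by omega) (changed ups) (card_changed_le ups))
    (mul_le_mul_right (mean_search_le hp.lev hB hL hh hd hk1 hkn hμ1
      (sampleRank_le hε0 hε1)) _)).trans ?_)
  rw [← ENNReal.ofReal_mul hr0, ← ENNReal.ofReal_add (by positivity) (by positivity)]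
  refine ENNReal.ofReal_le_ofReal ?_
  have h1 := clog_two_le ups.length
  have h2 : (1 : ℝ) + (p.B + 1) * (3 * Nat.clog 2 ups.length + 10) ≤
      (p.B + 1) * (14 + 6 * Real.log ups.length) := by
    have : ((p.B : ℝ) + 1) * (3 * Nat.clog 2 ups.length + 10) ≤
      (p.B + 1) * (13 + 6 * Real.log ups.length) :=
      mul_le_mul_of_nonneg_left (by linarith) (by positivity)
    nlinarith [show (0 : ℝ) ≤ p.B from Nat.cast_nonneg _]
  have h3 := reactProb_mul_sampleSize_le (ε := ε) hδ0 hδ1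
  calc _ ≤ (p.B + 1) * (14 + 6 * Real.log ups.length) + reactProb δ * ((4 * bigA + 1) *
          (2 * sampleSize ε (errProb δ)) + 4 * bigA * Real.log p.L + 74 * bigA + 18) := by
        gcongr
    _ = (p.B + 1) * (14 + 6 * Real.log ups.length) + 2 * (4 * bigA + 1) *
          (reactProb δ * sampleSize ε (errProb δ)) + reactProb δ *
          (4 * bigA * Real.log p.L + 74 * bigA + 18) := by ring
    _ ≤ (p.B + 1) * (14 + 6 * Real.log ups.length) + 2 * (4 * bigA + 1) *
          (64 * (1 / ε ^ 2 * Real.log (1 / δ))) + 1 *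
          (4 * bigA * Real.log p.L + 74 * bigA + 18) := by gcongr
    _ = _ := by ring

end Params

end Monitoring

end

noncomputable section

namespace Monitoring

open Finset

set_option linter.unusedSectionVars false

/-! ### Rough ranks -/

namespace Params

variable {p : Params} {α : Type u} [LinearOrder α] {n : ℕ} {d : Fin n → α}

theorem exists_top_last (hn : n ≠ 0) (g : Fin n → Fin (p.B + 1) → ℕ) :
    ∃ v, p.top g d (Fin.last p.B) 0 = some (d v) ∧ ∀ w, d w ≤ d v := by
  have : Nonempty (Fin n) := ⟨⟨0, Nat.pos_of_ne_zero hn⟩⟩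
  obtain ⟨v, hv⟩ := Finite.exists_max d
  refine ⟨v, ?_, hv⟩
  rw [top, side_last]
  exact (@best_eq_some_iff α (dualOrder α) n (fun i => g i (Fin.last p.B)) d 0 (d v)).2
    ⟨⟨v, Nat.zero_le _, rfl⟩, fun i _ => hv i⟩

/-- If no node reaches the level, then all `n` nodes are before it, so `n < Y`, and the maximum from
the last copy has an admissible rank. -/
theorem hasRankIn_of_top (hn : n ≠ 0) (hB : p.B ≠ 0) (hd : Function.Injective d)
    {g : Fin n → Fin (p.B + 1) → ℕ} {l k Y : ℕ} {b : ℝ} (hk : k ≤ n)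
    (h1 : ¬ ∃ v, p.top g d 0 l = some (d v) ∧ rank d (d v) ≤ k - 1)
    (h2 : ¬ Y ≤ #(before (fun i => g i 0) d l)) (hY : (Y : ℝ) ≤ b) :
    HasRankIn d ((p.top g d 0 l).or (p.top g d (Fin.last p.B) 0)) k b := by
  rw [top_zero hB] at h1 ⊢
  rcases hb : best (fun i => g i 0) d l with _ | y
  · obtain ⟨v, hv, hmax⟩ := exists_top_last (p := p) (d := d) hn g
    have h3 : rank d (d v) = n := by
      rw [rank, filter_true_of_mem fun w _ => hmax w, card_univ, Fintype.card_fin]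
    rw [before_of_best_eq_none hb, card_univ, Fintype.card_fin, not_le] at h2
    refine ⟨v, by rw [hv]; rfl, ?_, ?_⟩
    · rw [h3]
      exact_mod_cast hk
    · rw [h3]
      exact le_trans (by exact_mod_cast h2.le) hY
  · obtain ⟨⟨v, -, rfl⟩, -⟩ := best_eq_some_iff.1 hb
    have h3 := rank_of_best_eq_some hd hb
    have h4 : k ≤ rank d (d v) := by
      by_contra h4
      exact h1 ⟨v, hb, by omega⟩
    refine ⟨v, rfl, by exact_mod_cast h4, ?_⟩
    have h5 : rank d (d v) ≤ Y := by omega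
    exact le_trans (by exact_mod_cast h5) hY

/-- The two summands are the probabilities of a rank that is too small and of one that is too large.
-/
theorem roughRank_error_le {x L : ℝ} (hx : 1.09 ≤ x) (h1 : x ≤ L) (h2 : L ≤ 3 * x) :
    1 / (16 * L ^ 2) + Real.exp (-(x ^ 100 / (64 * L ^ 2))) ≤ 1 / x := by
  have hx0 : 0 < x := by linarith
  have hL0 : 0 < L := by linarith
  have h3 : 1 / (16 * L ^ 2) ≤ 1 / (16 * x) := by
    gcongr
    nlinarith
  -- As `log n` may be as small as `1.09`, only a high power of it exceeds the constants; this is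
  -- the reason for the exponent `100`.
  have h4 : (1000 : ℝ) ≤ x ^ 97 := by
    calc (1000 : ℝ) ≤ 1.09 ^ 97 := by norm_num
      _ ≤ _ := by gcongr
  have h5 : 1.5 * x ≤ x ^ 100 / (64 * L ^ 2) := by
    rw [le_div_iff₀ (by positivity)]
    calc 1.5 * x * (64 * L ^ 2) ≤ 1.5 * x * (64 * (3 * x) ^ 2) := by gcongr
      _ = 864 * x ^ 3 := by ring
      _ ≤ x ^ 97 * x ^ 3 := by gcongr; linarith
      _ = _ := by ring
  have h6 : Real.exp (-(x ^ 100 / (64 * L ^ 2))) ≤ 1 / (1.5 * x) := by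
    rw [Real.exp_neg, one_div]
    refine inv_anti₀ (by positivity) (h5.trans ?_)
    linarith [Real.add_one_le_exp (x ^ 100 / (64 * L ^ 2))]
  have h7 : 1 / (16 * x) + 1 / (1.5 * x) ≤ 1 / x := by
    rw [div_add_div _ _ (by positivity) (by positivity), div_le_div_iff₀ (by positivity) hx0]
    nlinarith [mul_pos hx0 hx0]
  linarith

theorem Suitable.roughRank_correct (hp : p.Suitable n) (hB : p.B ≠ 0)
    (hn : 1.09 ≤ Real.log n) (hL : Real.log n ≤ p.L) (hL' : p.L ≤ 3 * Real.log n)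
    {d : Fin n → α} {past : List (Epoch α n)} {e : Epoch α n}
    (ha : Admissible d (past ++ [e])) {k : ℕ} (hk1 : 1 ≤ k) (hk : k ≤ n) :
    ENNReal.ofReal (1 - 1 / Real.log n) ≤
      prob (((p.protocol n).run d past).bind ((p.protocol n).untilRefresh e)) (fun s =>
        HasRankIn s.item ((p.protocol n).roughRank s.server k) k (k * Real.log n ^ 100)) := by
  classical
  refine le_trans ?_ (hp.roughRank_ge ha hk _ _)
  have hd := ha.injective
  set d' := itemsAt d (past ++ [e])
  have hlev := hp.lev k hk
  set l := p.lev k with hl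
  set x := Real.log n with hx
  have hL1 : 1 ≤ p.L := by
    have : (0 : ℝ) < p.L := by linarith
    exact_mod_cast this
  have hk0 : (1 : ℝ) ≤ k := by exact_mod_cast hk1
  have hL0 : (1 : ℝ) ≤ p.L := by exact_mod_cast hL1
  have hX1 : (16 * k * p.L ^ 2 : ℝ) ≤ 2 ^ l := by exact_mod_cast p.le_two_pow_lev k
  have hX2 : (2 ^ l : ℝ) ≤ 32 * k * p.L ^ 2 := by exact_mod_cast p.two_pow_lev_le hk1 hL1
  have hY := Nat.floor_le (a := k * x ^ 100) (by positivity)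
  have hY2 := Nat.lt_floor_add_one (k * x ^ 100)
  set Y := ⌊k * x ^ 100⌋₊ with hYdef
  have h1 := p.mean_rank_top_le hB hd hlev (k - 1)
  have h2 : mean (p.heights n) (fun g => if Y ≤ #(before (fun i => g i 0) d' l) then 1 else 0) ≤
      ENNReal.ofReal (Real.exp (-(Y / 2 ^ l))) := by
    refine le_trans (le_of_eq ?_) (mean_le_card_before_le (m := p.m) hd hlev Y)
    rw [← p.mean_heights_single 0]
  set A : (Fin n → Fin (p.B + 1) → ℕ) → Prop := fun g => HasRankIn d'
    ((p.top g d' 0 l).or (p.top g d' (Fin.last p.B) 0)) k (k * x ^ 100) with hA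
  have h3 : ∀ g, (if A g then (0 : ENNReal) else 1) ≤
      (if ∃ v, p.top g d' 0 l = some (d' v) ∧ rank d' (d' v) ≤ k - 1 then 1 else 0) +
        if Y ≤ #(before (fun i => g i 0) d' l) then 1 else 0 := by
    intro g
    by_cases h4 : ∃ v, p.top g d' 0 l = some (d' v) ∧ rank d' (d' v) ≤ k - 1
    · rw [if_pos h4]
      split_ifs <;> simp
    · by_cases h5 : Y ≤ #(before (fun i => g i 0) d' l)
      · rw [if_pos h5]
        split_ifs <;> simp
      · rw [if_pos (hasRankIn_of_top hp.n_ne hB hd hk h4 h5 hY)]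
        exact zero_le
  have h4 : mean (p.heights n) (fun g => if A g then (0 : ENNReal) else 1) ≤
      ENNReal.ofReal (1 / x) := by
    refine (mean_mono h3).trans ?_
    rw [mean_add]
    refine (add_le_add h1 h2).trans ?_
    rw [← ENNReal.ofReal_add (by positivity) (by positivity)]
    refine ENNReal.ofReal_le_ofReal (le_trans (add_le_add ?_ (Real.exp_le_exp.2 (neg_le_neg ?_)))
      (roughRank_error_le (L := p.L) hn hL hL'))
    · rw [div_le_div_iff₀ (by positivity) (by positivity), one_mul]
      refine le_trans ?_ hX1
      have : ((k - 1 : ℕ) : ℝ) ≤ k := by exact_mod_cast Nat.sub_le k 1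
      nlinarith [sq_nonneg (p.L : ℝ)]
    · have h5 : (2 : ℝ) ≤ x ^ 100 := by
        calc (2 : ℝ) ≤ 1.09 ^ 100 := by norm_num
          _ ≤ _ := by gcongr
      have h6 : k * x ^ 100 / 2 ≤ Y := by nlinarith
      calc x ^ 100 / (64 * p.L ^ 2) = k * x ^ 100 / 2 / (32 * k * p.L ^ 2) := by
            field_simp
            norm_num
        _ ≤ (Y : ℝ) / 2 ^ l := by gcongr
  have h5 := mean_ite_add_ite_not (p.heights n) A
  rw [ENNReal.ofReal_sub _ (by positivity), ENNReal.ofReal_one, tsub_le_iff_right]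
  exact h5.symm.le.trans (add_le_add le_rfl h4)

end Params

end Monitoring

end

noncomputable section

namespace Monitoring

open Finset

set_option linter.unusedSectionVars false

/-! ### The choice of the parameters -/

namespace Params

/-- The parameters for `n` nodes. -/
def forSize (n : ℕ) : Params where
  B := 2 ^ 47
  m := 3 * (Nat.log 2 n + 1) + 4
  E := Nat.log 2 n + 1 + 12
  N := (Nat.log 2 n + 1 + 13) * (2 ^ 45 * (Nat.log 2 n + 1) + 8)
  ph := Nat.log 2 n + 1 + 1
  R := (Nat.log 2 n + 1 + 1) * ((Nat.log 2 n + 1 + 13) * (2 ^ 45 * (Nat.log 2 n + 1) + 8) + 1) + 2 +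
    (2 ^ 47 + 1) * (2 * (3 * (Nat.log 2 n + 1) + 4) + 3)
  L := Nat.log 2 n + 1

variable {n : ℕ}

/-- A bound above `1` makes `log (log n)` positive, so that it can absorb constants (`loglog_ge`).
-/
theorem log_ge (hn : 3 ≤ n) : 1.09 ≤ Real.log n := by
  rw [Real.le_log_iff_exp_le (by positivity)]
  have h1 : Real.exp 0.09 ≤ 1.099 := by
    have h2 := Real.add_one_le_exp (-0.09 : ℝ)
    rw [Real.exp_neg] at h2
    have h3 := Real.exp_pos (0.09 : ℝ)
    have h4 : Real.exp 0.09 * (Real.exp 0.09)⁻¹ = 1 := mul_inv_cancel₀ h3.ne'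
    nlinarith
  have h2 : Real.exp 1.09 = Real.exp 1 * Real.exp 0.09 := by
    rw [← Real.exp_add]
    norm_num
  rw [h2]
  have h3 : (3 : ℝ) ≤ n := by exact_mod_cast hn
  calc Real.exp 1 * Real.exp 0.09 ≤ 2.72 * 1.099 := by
        gcongr
        linarith [Real.exp_one_lt_d9]
    _ ≤ n := by linarith

theorem lt_two_pow_L : n < 2 ^ (Nat.log 2 n + 1) := Nat.lt_pow_succ_log_self one_lt_two n

theorem log_le_L (hn : 3 ≤ n) : Real.log n ≤ (Nat.log 2 n + 1 : ℕ) := by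
  have h1 : (n : ℝ) ≤ 2 ^ (Nat.log 2 n + 1) := by exact_mod_cast lt_two_pow_L.le
  have h2 := Real.log_le_log (by positivity) h1
  rw [Real.log_pow] at h2
  have h3 := Real.log_two_lt_d9
  nlinarith [show (0 : ℝ) ≤ (Nat.log 2 n + 1 : ℕ) from Nat.cast_nonneg _]

theorem L_le_log (hn : 3 ≤ n) : ((Nat.log 2 n + 1 : ℕ) : ℝ) ≤ 3 * Real.log n := by
  have h1 : (2 ^ Nat.log 2 n : ℝ) ≤ n := by exact_mod_cast Nat.pow_log_le_self 2 (by omega)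
  have h2 := Real.log_le_log (by positivity) h1
  rw [Real.log_pow] at h2
  have h3 := Real.log_two_gt_d9
  have h4 := log_ge hn
  push_cast
  nlinarith [show (0 : ℝ) ≤ Nat.log 2 n from Nat.cast_nonneg _]

theorem two_le_L (hn : 3 ≤ n) : 2 ≤ Nat.log 2 n + 1 := by
  have := Nat.log_pos one_lt_two (show 2 ≤ n by omega)
  omega

theorem harm_le_L (hn : 3 ≤ n) : harm n ≤ 2 * (Nat.log 2 n + 1 : ℕ) := by
  have h1 := log_le_L hn
  have h2 : (2 : ℝ) ≤ (Nat.log 2 n + 1 : ℕ) := by exact_mod_cast two_le_L hn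
  linarith [harm_le n]

theorem suitable_forSize (hn : 3 ≤ n) : (forSize n).Suitable n where
  n_ne := by omega
  ph := by
    have := lt_two_pow_L (n := n)
    simp only [forSize]
    rw [pow_succ]
    omega
  E := by
    have := lt_two_pow_L (n := n)
    simp only [forSize]
    rw [pow_add]
    omega
  -- The first factor of `N` is `E + 1`, which cancels `tau`; the second one is `2 * (2 * bigA * (2
  -- * L) + 4)`.
  N := by
    have h1 := harm_le_L hn
    simp only [forSize, tau, bigA]
    push_cast at h1 ⊢
    rw [show (Nat.log 2 n : ℝ) + 1 + 12 + 1 = Nat.log 2 n + 1 + 13 by ring,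
      mul_one_div, mul_div_cancel_left₀ _ (by positivity)]
    linarith
  -- The factors `k`, `L`, `L` are at most `2 ^ L` each and `16 = 2 ^ 4`, whence `m = 3 * L + 4`.
  lev := by
    intro k hk
    have h1 := lt_two_pow_L (n := n)
    simp only [forSize, lev]
    rw [Nat.clog_le_iff_le_pow one_lt_two]
    set L := Nat.log 2 n + 1
    have h2 : L ≤ 2 ^ L := Nat.lt_two_pow_self.le
    calc 16 * k * L ^ 2 ≤ 16 * 2 ^ L * (2 ^ L) ^ 2 := by
          gcongr
          omega
      _ = 2 ^ (3 * L + 4) := by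
          rw [pow_add 2 (3 * L), pow_mul']
          generalize 2 ^ L = y
          ring
  R := Nat.le_add_right _ _
  R' := by
    simp only [forSize]
    have : 0 < (Nat.log 2 n + 1 + 1) * ((Nat.log 2 n + 1 + 13) *
      (2 ^ 45 * (Nat.log 2 n + 1) + 8) + 1) := by positivity
    omega

theorem two_mul_le (n : ℕ) : 2 * n ≤ 2 ^ (forSize n).m := by
  have h1 := lt_two_pow_L (n := n)
  calc 2 * n ≤ 2 ^ (Nat.log 2 n + 1 + 1) := by rw [pow_succ]; omega
    _ ≤ _ := Nat.pow_le_pow_right two_pos (by simp only [forSize]; omega)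

theorem forSize_B_ne : (forSize n).B ≠ 0 := by simp [forSize]

theorem W_le (hn : 3 ≤ n) : ((8 * (forSize n).X : ℕ) : ℝ) ≤ n ^ (52 : ℕ) := by
  have h1 : Nat.log 2 n ≤ n := Nat.log_le_self 2 n
  have h2 : 8 * (forSize n).X ≤ 2 ^ 51 * n := by
    simp only [X, forSize]
    omega
  have h3 : 2 ^ 51 * n ≤ n ^ 52 := by
    rw [pow_succ n 51]
    gcongr
    omega
  exact_mod_cast h2.trans h3

theorem R_le (hn : 3 ≤ n) : ((forSize n).R : ℝ) ≤ 2 ^ 60 * Real.log n ^ (3 : ℕ) := by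
  have h1 := L_le_log hn
  have h2 := two_le_L hn
  have h3 : (forSize n).R ≤ 2 ^ 53 * (Nat.log 2 n + 1) ^ 3 := by
    simp only [forSize]
    obtain ⟨q, hq⟩ : ∃ q, Nat.log 2 n + 1 = q + 2 := ⟨_, (Nat.sub_add_cancel h2).symm⟩
    rw [hq]
    ring_nf
    gcongr <;> norm_num
  calc ((forSize n).R : ℝ) ≤ 2 ^ 53 * ((Nat.log 2 n + 1 : ℕ) : ℝ) ^ 3 := by exact_mod_cast h3
    _ ≤ 2 ^ 53 * (3 * Real.log n) ^ 3 := by gcongr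
    _ = 2 ^ 53 * 27 * Real.log n ^ 3 := by ring
    _ ≤ _ := by
      have := log_ge hn
      gcongr
      norm_num

variable {α : Type u} [LinearOrder α] {d : Fin n → α}

theorem start_forSize_le (hn : 3 ≤ n) (hd : Function.Injective d) :
    mean (((forSize n).protocol n).start d) (fun s => (s.msgs : ENNReal)) ≤
      ENNReal.ofReal (2 ^ 60 * Real.log n) := by
  have h1 := (forSize n).mean_refreshCost_le hd (by have := two_mul_le n; omega) (fun _ => true)
    (a := Nat.log 2 n + 1) (by
      rw [filter_true_of_mem fun _ _ => rfl, card_univ, Fintype.card_fin]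
      exact lt_two_pow_L.le)
  refine ((suitable_forSize hn).mean_start_le).trans ((add_le_add le_rfl h1).trans ?_)
  rw [← ENNReal.ofReal_one, ← ENNReal.ofReal_add zero_le_one (by positivity)]
  refine ENNReal.ofReal_le_ofReal ?_
  have h2 := L_le_log hn
  have h3 := log_ge hn
  have h4 : ((forSize n).B : ℝ) = 2 ^ 47 := by norm_num [forSize]
  rw [h4]
  nlinarith

theorem loglog_ge (hn : 3 ≤ n) : 0.08 ≤ Real.log (Real.log n) := by
  have h1 := log_ge hn
  have h2 := Real.one_sub_inv_le_log_of_pos (show (0 : ℝ) < 1.09 by norm_num)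
  have h3 := Real.log_le_log (by norm_num) h1
  norm_num at h2 h3 ⊢
  linarith

theorem log_L_le (hn : 3 ≤ n) :
    Real.log ((forSize n).L : ℝ) ≤ 2 + Real.log (Real.log n) := by
  have h1 := log_ge hn
  have h2 : (2 : ℝ) ≤ (Nat.log 2 n + 1 : ℕ) := by exact_mod_cast two_le_L hn
  have h3 := Real.log_le_log (by linarith) (L_le_log hn)
  rw [Real.log_mul (by norm_num) (by linarith)] at h3
  have h4 := Real.log_le_sub_one_of_pos (show (0 : ℝ) < 3 by norm_num)
  exact h3.trans (by linarith)

/-- The choice `B = 2 ^ 47 = 8 * (4 * bigA)` is the one required by the cancellation in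
`Suitable.topK_le`. -/
theorem topK_forSize_le (hn : 3 ≤ n) {past : List (Epoch α n)} {ups : List (Fin n × α)} {k : ℕ}
    (ha : Admissible d (past ++ [⟨ups, .topK k⟩])) :
    mean (((forSize n).protocol n).run d (past ++ [⟨ups, .topK k⟩]))
        (fun s => (s.msgs : ENNReal)) ≤
      ENNReal.ofReal (k + 2 ^ 64 * (Real.log ups.length + Real.log (Real.log n))) := by
  have hL := two_le_L hn
  have hL0 : (2 : ℝ) ≤ (Nat.log 2 n + 1 : ℕ) := by exact_mod_cast hL
  refine ((suitable_forSize hn).topK_le (b := 2 ^ 44) (by norm_num [forSize])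
    (by norm_num [bigA]) (two_mul_le n) (one_le_two.trans hL) ?_ ha).trans
      (ENNReal.ofReal_le_ofReal ?_)
  · refine (harm_le_L hn).trans ?_
    change 2 * ((Nat.log 2 n + 1 : ℕ) : ℝ) ≤ 16 * ((Nat.log 2 n + 1 : ℕ) : ℝ) ^ 2
    nlinarith
  · have h1 := log_L_le hn
    have h2 := loglog_ge hn
    have h3 : ((forSize n).B : ℝ) = 2 ^ 47 := by norm_num [forSize]
    have h4 : Real.log (1 + ((2 ^ 44 : ℕ) : ℝ)) ≤ 45 := by
      have h5 : (1 : ℝ) + ((2 ^ 44 : ℕ) : ℝ) ≤ 2 ^ 45 := by norm_num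
      have h6 := Real.log_le_log (by positivity) h5
      rw [Real.log_pow] at h6
      have h7 := Real.log_two_lt_d9
      push_cast at h6 ⊢
      linarith
    have h5 : ((2 ^ 44 : ℕ) : ℝ) * Real.log (1 + ((2 ^ 44 : ℕ) : ℝ)) ≤ ((2 ^ 44 : ℕ) : ℝ) * 45 := by
      gcongr
    have h6 : 0 ≤ Real.log (ups.length : ℝ) := Real.log_natCast_nonneg _
    rw [h3]
    unfold bigA
    push_cast at h5 ⊢
    linarith

theorem select_forSize_le (hn : 3 ≤ n) {past : List (Epoch α n)} {ups : List (Fin n × α)} {k : ℕ}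
    {ε δ : ℝ} (ha : Admissible d (past ++ [⟨ups, .select k ε δ⟩])) :
    mean (((forSize n).protocol n).run d (past ++ [⟨ups, .select k ε δ⟩]))
        (fun s => (s.msgs : ENNReal)) ≤
      ENNReal.ofReal (2 ^ 64 * (1 / ε ^ 2 * Real.log (1 / δ) + Real.log ups.length +
        Real.log (Real.log n) ^ 2)) := by
  refine ((suitable_forSize hn).select_le forSize_B_ne (two_mul_le n) (two_le_L hn)
    (harm_le_L hn) ha).trans (ENNReal.ofReal_le_ofReal ?_)
  obtain ⟨-, -, -, hε0, -, hδ0, hδ1⟩ := ha.of_append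
  have h0 : 0 ≤ 1 / ε ^ 2 * Real.log (1 / δ) :=
    mul_nonneg (by positivity) (Real.log_nonneg (by rw [le_div_iff₀ hδ0]; linarith))
  have h1 := log_L_le hn
  have h2 := loglog_ge hn
  have h3 : ((forSize n).B : ℝ) = 2 ^ 47 := by norm_num [forSize]
  have h6 : 0 ≤ Real.log (ups.length : ℝ) := Real.log_natCast_nonneg _
  have h7 : 0.0064 ≤ Real.log (Real.log n) ^ 2 := by nlinarith
  have h8 : 0.08 * Real.log (Real.log n) ≤ Real.log (Real.log n) ^ 2 := by nlinarith
  rw [h3]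
  unfold bigA
  linarith

end Params

end Monitoring

end

theorem mainTheorem10 :
    ∃ C c c' : ℝ, 0 < C ∧ 0 < c ∧ 0 < c' ∧
      ∀ (α : Type u) [LinearOrder α] (n : ℕ), 3 ≤ n →
        ∃ P : Monitoring.Protocol α n,
          -- message size, number of rounds per operation, and cost of INITIALIZE
          (P.W : ℝ) ≤ (n : ℝ) ^ C ∧
          (P.R : ℝ) ≤ C * Real.log n ^ C ∧
          (∀ d : Fin n → α, Function.Injective d →
            Monitoring.expect (P.start d) (fun s => s.msgs) ≤
              ENNReal.ofReal (C * Real.log n)) ∧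
          -- ROUGH-RANK after the REFRESH of any epoch
          (∀ (d : Fin n → α) (past : List (Monitoring.Epoch α n)) (e : Monitoring.Epoch α n),
            Monitoring.Admissible d (past ++ [e]) →
            ∀ k : ℕ, 1 ≤ k → k ≤ n →
              ENNReal.ofReal (1 - Real.log n ^ (-c')) ≤
                Monitoring.prob ((P.run d past).bind (P.untilRefresh e)) (fun s =>
                  Monitoring.HasRankIn s.item (P.roughRank s.server k)
                    k (k * Real.log n ^ c))) ∧
          -- Top-k
          (∀ (d : Fin n → α) (past : List (Monitoring.Epoch α n)) (ups : List (Fin n × α))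
              (k : ℕ),
            Monitoring.Admissible d (past ++ [⟨ups, .topK k⟩]) →
            (∀ s ∈ (P.run d (past ++ [⟨ups, .topK k⟩])).support,
              P.outTopK s.server = some (Monitoring.topKSet s.item k)) ∧
            Monitoring.expect (P.run d (past ++ [⟨ups, .topK k⟩])) (fun s => s.msgs) ≤
              ENNReal.ofReal
                (k + C * (Real.log ups.length + Real.log (Real.log n)))) ∧
          -- approximate k-Select
          (∀ (d : Fin n → α) (past : List (Monitoring.Epoch α n)) (ups : List (Fin n × α))
              (k : ℕ) (ε δ : ℝ),
            Monitoring.Admissible d (past ++ [⟨ups, .select k ε δ⟩]) →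
            ENNReal.ofReal (1 - δ) ≤
              Monitoring.prob (P.run d (past ++ [⟨ups, .select k ε δ⟩])) (fun s =>
                Monitoring.HasRankIn s.item (P.outSelect s.server)
                  ((1 - ε) * k) ((1 + ε) * k)) ∧
            Monitoring.expect (P.run d (past ++ [⟨ups, .select k ε δ⟩])) (fun s => s.msgs) ≤
              ENNReal.ofReal
                (C * (1 / ε ^ 2 * Real.log (1 / δ) + Real.log ups.length +
                  Real.log (Real.log n) ^ 2))) := by
  classical
  refine ⟨2 ^ 64, 100, 1, by positivity, by positivity, one_pos, fun α _ n hn =>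
    ⟨(Monitoring.Params.forSize n).protocol n, ?_, ?_, fun d hd => ?_,
      fun d past e ha k hk1 hk => ?_, fun d past ups k ha => ⟨?_, ?_⟩, fun d past ups k ε δ ha => ⟨?_, ?_⟩⟩⟩
  · refine (Monitoring.Params.W_le hn).trans ?_
    rw [← Real.rpow_natCast]
    exact Real.rpow_le_rpow_of_exponent_le (by exact_mod_cast (by omega : 1 ≤ n)) (by norm_num)
  · have h1 := Monitoring.Params.log_ge hn
    refine (Monitoring.Params.R_le hn).trans ?_
    have h2 : Real.log n ^ 3 ≤ Real.log n ^ (2 ^ 64 : ℝ) := by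
      rw [← Real.rpow_natCast]
      exact Real.rpow_le_rpow_of_exponent_le (by linarith) (by norm_num)
    exact mul_le_mul (by norm_num) h2 (by positivity) (by positivity)
  · refine (Monitoring.Params.start_forSize_le hn hd).trans (ENNReal.ofReal_le_ofReal ?_)
    have h1 := Monitoring.Params.log_ge hn
    exact mul_le_mul_of_nonneg_right (by norm_num) (by linarith)
  · have h1 := (Monitoring.Params.suitable_forSize hn).roughRank_correct
      Monitoring.Params.forSize_B_ne (Monitoring.Params.log_ge hn) (Monitoring.Params.log_le_L hn)
      (Monitoring.Params.L_le_log hn) ha hk1 hk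
    rw [Real.rpow_neg_one, ← one_div, Real.rpow_ofNat]
    exact h1
  · exact (Monitoring.Params.suitable_forSize hn).topK_support ha
  · exact Monitoring.Params.topK_forSize_le hn ha
  · exact (Monitoring.Params.suitable_forSize hn).select_correct ha
  · exact Monitoring.Params.select_forSize_le hn ha
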